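/- **Setting.** Let $\Bbbk$ be a field of characteristic $0$. Graded vector spaces are $\mathbb Z$-graded; $V^\vee$ is the graded dual, $(V^\vee)^n=(V^{-n})^*$, and $V[1]^n=V^{n+1}$. For a finite-dimensional graded vector space $V$ let $S(V^\vee)$ be the graded symmetric algebra and $\mathcal O(V)=\prod_{n\ge 0}S^n(V^\vee)$ the algebra of formal power series on $V$. For $v\in V$ let $\omega\mapsto\omega\llcorner v$ be the right contraction, determined by $\xi\llcorner v=\xi(v)$ for $\xi\in V^\vee$ and $(\omega\odot\eta)\llcorner v=(-1)^{|v||\eta|}(\omega\llcorner v)\odot\eta+\omega\odot(\eta\llcorner v)$; on $\mathcal O(V)\otimes X$ put $(\omega\otimes x)\llcorner v=(-1)^{|v||x|}(\omega\llcorner v)\otimes x$. Let $I^V:\mathcal O(V)\to\mathcal O(V)\otimes V^\vee$, $I^V(\omega)=\sum_i(\omega\llcorner b_i)\otimes b^i$ ($b_i$ a basis of $V$, $b^i$ the dual basis) be the algebraic de Rham operator. An SH Lie algebra ($L_\infty[1]$-algebra) structure on $L$ is given by a derivation $Q_L$ of $\mathcal O(L)$ of degree $1$ with $Q_L^2=0$;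 its brackets $\lambda_k$ ($k\ge 0$) satisfy $\xi(\lambda_k(u_1,\dots,u_k))=(-1)^{|\xi|+k}\,Q_L(\xi)\llcorner u_1\cdots\llcorner u_k$ (constant term). An SH Lie pair $(L,A)$ is a finite-dimensional SH Lie algebra $L$ with a graded subspace $j:A\hookrightarrow L$ that is a subalgebra: the restriction $j^\vee:\mathcal O(L)\to\mathcal O(A)$ satisfies $j^\vee Q_L=Q_Aj^\vee$ for a homological vector field $Q_A$ on $A$. Let $E$ be a graded vector space; $\mathcal O(L)\otimes\operatorname{End}(E)$ carries the product $(\omega\otimes\varphi)\circ(\eta\otimes\psi)=(-1)^{|\varphi||\eta|}(\omega\odot\eta)\otimes\varphi\psi$ and acts on $\mathcal O(L)\otimes E$ in the same way. An $L$-connection on $E$ is an operator $\nabla=Q_L+D$ on $\mathcal O(L)\otimes E$ with $D\in(\mathcal O(L)\otimes\operatorname{End}(E))^1$; its curvature is $R^\nabla=\nabla^2=Q_L(D)+D\circ D$. An $A$-module is a graded vector space $E$ with a flat $A$-connection $\partial_A^E=Q_A+D^{A,E}$, $(\partial_A^E)^2=0$. It corresponds to the maps $f_k^E:S^k(A)\to\operatorname{End}(E)[1]$,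 $f^E_k(a_1,\dots,a_k)=(-1)^k D^{A,E}\llcorner a_1\cdots\llcorner a_k$ (constant term). An $L$-connection $\nabla=Q_L+D^{L,E}$ extends $(A,E)$ if $(j^\vee\otimes1)(D^{L,E})=D^{A,E}$. Put $A^\perp=\ker(L^\vee\to A^\vee)\cong(L/A)^\vee$ and $J=(j^\vee\otimes 1)\circ I^L:\mathcal O(L)\to\mathcal O(A)\otimes L^\vee$. The space $L$ is an $A$-module by $(a_1,\dots,a_k,l)\mapsto\lambda_{k+1}(a_1,\dots,a_k,l)$; the dual $A$-module $L^\vee$ has $D^{L^\vee}(\xi)=J(Q_L\xi)$, and $A^\perp\subset L^\vee$ is a submodule. $L^\vee\otimes\operatorname{End}(E)$ is an $A$-module with differential $Q_A+D^{L^\vee}+[D^{A,E},-]$, which restricts to the differential of $A^\perp\otimes\operatorname{End}(E)$. The $A$-module $\operatorname{End}(E)[1]$ is the shift of the $A$-module $(\operatorname{End}(E),\,Q_A+[D^{A,E},-])$. The Atiyah cocycle of an $L$-connection $\nabla$ extending $(A,E)$ is $\alpha^E_\nabla=(J\otimes 1)(R^\nabla)\in\mathcal O(A)\otimes A^\perp\otimes\operatorname{End}(E)$,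 of degree $2$; the Atiyah class is $[\alpha^E]=[\alpha^E_\nabla]\in H^2_{\mathrm{CE}}(A,A^\perp\otimes\operatorname{End}(E))$, for any such $\nabla$. A morphism of $A$-modules $L\to\operatorname{End}(E)[1]$ is an $\mathcal O(A)$-linear map $\phi:\mathcal O(A)\otimes L\to\mathcal O(A)\otimes\operatorname{End}(E)[1]$ of degree $0$ commuting with the differentials; its components are $\phi_k:S^k(A)\otimes L\to\operatorname{End}(E)[1]$, $\phi_k(a_1,\dots,a_k,l)=(-1)^{|l|(|a_1|+\cdots+|a_k|)+k}\,\phi(l)\llcorner a_1\cdots\llcorner a_k$ (constant term). **Theorem 2.13 (Vanishing theorem).** Let $(L,A)$ be an SH Lie pair and $(E,\ \partial_A^E=Q_A+D^{A,E}\sim f^E_\bullet)$ an $A$-module. The following are equivalent: 1. The Atiyah class $[\alpha^E]\in H^2_{\mathrm{CE}}(A,A^\perp\otimes\operatorname{End}(E))$ vanishes. 2. There is a degree $1$ cocycle $\phi\in\mathcal O(A)\otimes L^\vee\otimes\operatorname{End}(E)$ with $(1\otimes j^\vee\otimes1)(\phi)=(I^A\otimes1)(D^{A,E})$ in $\mathcal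 O(A)\otimes A^\vee\otimes\operatorname{End}(E)$. 3. There is an $A$-module morphism $\{\phi_k:S^k(A)\otimes L\to\operatorname{End}(E)[1]\}_{k\ge0}$ from $L$ to $\operatorname{End}(E)[1]$ that extends the canonical morphism $\phi^{A,E}$ from $A$ to $\operatorname{End}(E)[1]$: $\phi_k(a_1,\dots,a_k,j(a))=f^E_{k+1}(a_1,\dots,a_k,a)$ for all $k\ge 0$ and homogeneous $a_i,a\in A$. 4. There is an $L$-connection $\nabla$ on $E$ extending $(A,E)$ whose Atiyah cocycle $\alpha^E_\nabla$ vanishes. -/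

import Mathlib

open scoped TensorProduct

namespace SHLie

/-! ### Graded vector spaces

A graded vector space is a `𝕜`-module `V` together with a family `𝒱 : ℤ → Submodule 𝕜 V` and
`[DirectSum.Decomposition 𝒱]`.  Koszul signs are written without choosing homogeneous elements,
by means of the involution `v ↦ (-1)^|v| v`. -/

section Graded

variable {𝕜 : Type*} [Field 𝕜] {V : Type*} [AddCommGroup V] [Module 𝕜 V]
  {W : Type*} [AddCommGroup W] [Module 𝕜 W]

/-- The involution `v ↦ (-1)^|v| v` of a graded vector space. -/
noncomputable def parity (𝒱 : ℤ → Submodule 𝕜 V) [DirectSum.Decomposition 𝒱] : V →ₗ[𝕜] V :=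
  DirectSum.toModule 𝕜 ℤ V (fun n => n.negOnePow • (𝒱 n).subtype) ∘ₗ
    (DirectSum.decomposeLinearEquiv 𝒱).toLinearMap

/-- The projection to the even part (`v ↦ v` for `|v|` even, `v ↦ 0` for `|v|` odd), for the
grading involution `σ`. -/
noncomputable def evenPart (σ : V →ₗ[𝕜] V) : V →ₗ[𝕜] V := (2⁻¹ : 𝕜) • (LinearMap.id + σ)

/-- The projection to the odd part, for the grading involution `σ`. -/
noncomputable def oddPart (σ : V →ₗ[𝕜] V) : V →ₗ[𝕜] V := (2⁻¹ : 𝕜) • (LinearMap.id - σ)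

/-- The grading of the dual: `(V^∨)^n` is the dual of `V^{-n}`. -/
def dualGr (𝒱 : ℤ → Submodule 𝕜 V) (n : ℤ) : Submodule 𝕜 (Module.Dual 𝕜 V) where
  carrier := {ξ | ∀ m, m ≠ -n → ∀ v ∈ 𝒱 m, ξ v = 0}
  zero_mem' := fun _ _ _ _ => rfl
  add_mem' := fun ha hb m hm v hv => by simp [ha m hm v hv, hb m hm v hv]
  smul_mem' := fun c _ ha m hm v hv => by simp [ha m hm v hv]

/-- The involution `ξ ↦ (-1)^|ξ| ξ` of the dual. -/
noncomputable def dualParity (𝒱 : ℤ → Submodule 𝕜 V) [DirectSum.Decomposition 𝒱] :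
    Module.Dual 𝕜 V →ₗ[𝕜] Module.Dual 𝕜 V :=
  (parity 𝒱).dualMap

/-- The endomorphisms of degree `r`: those that map `V^n` to `V^{n+r}`. -/
def endGr (𝒱 : ℤ → Submodule 𝕜 V) (r : ℤ) : Submodule 𝕜 (Module.End 𝕜 V) where
  carrier := {φ | ∀ n, ∀ v ∈ 𝒱 n, φ v ∈ 𝒱 (n + r)}
  zero_mem' := fun _ _ _ => Submodule.zero_mem _
  add_mem' := fun ha hb n v hv => Submodule.add_mem _ (ha n v hv) (hb n v hv)
  smul_mem' := fun c _ ha n v hv => Submodule.smul_mem _ c (ha n v hv)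

/-- The involution `φ ↦ (-1)^|φ| φ` of `End(V)`. -/
noncomputable def endParity (𝒱 : ℤ → Submodule 𝕜 V) [DirectSum.Decomposition 𝒱] :
    Module.End 𝕜 V →ₗ[𝕜] Module.End 𝕜 V :=
  LinearMap.mulLeft 𝕜 (parity 𝒱) ∘ₗ LinearMap.mulRight 𝕜 (parity 𝒱)

/-- The grading of a tensor product: `(V ⊗ W)^n` is spanned by the `V^i ⊗ W^{n-i}`. -/
def tensorGr (𝒱 : ℤ → Submodule 𝕜 V) (𝒲 : ℤ → Submodule 𝕜 W) (n : ℤ) :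
    Submodule 𝕜 (V ⊗[𝕜] W) :=
  ⨆ i : ℤ, Submodule.map₂ (TensorProduct.mk 𝕜 V W) (𝒱 i) (𝒲 (n - i))

/-- The shift: `(V[k])^n = V^{n+k}`. -/
def shiftGr (𝒱 : ℤ → Submodule 𝕜 V) (k : ℤ) (n : ℤ) : Submodule 𝕜 V := 𝒱 (n + k)

/-- The grading of a subspace `A`: `A^n = A ∩ V^n`.  The subspace is graded when this family
decomposes `A`. -/
def subGr (𝒱 : ℤ → Submodule 𝕜 V) (A : Submodule 𝕜 V) (n : ℤ) : Submodule 𝕜 A :=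
  (𝒱 n).comap A.subtype

theorem parity_of_mem (𝒱 : ℤ → Submodule 𝕜 V) [DirectSum.Decomposition 𝒱] {n : ℤ} {v : V}
    (hv : v ∈ 𝒱 n) : parity 𝒱 v = n.negOnePow • v := by
  simp only [parity, LinearMap.comp_apply, LinearEquiv.coe_coe,
    DirectSum.decomposeLinearEquiv_apply]
  rw [DirectSum.decompose_of_mem 𝒱 hv]
  erw [DirectSum.toModule_lof]
  simp

theorem dual_ext (𝒱 : ℤ → Submodule 𝕜 V) [DirectSum.Decomposition 𝒱]
    {f g : Module.Dual 𝕜 V} (h : ∀ n, ∀ v ∈ 𝒱 n, f v = g v) : f = g := by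
  ext v
  induction v using DirectSum.Decomposition.inductionOn 𝒱 with
  | zero => simp
  | homogeneous m => exact h _ _ m.2
  | add a b ha hb => simp [ha, hb]

theorem dualParity_of_mem (𝒱 : ℤ → Submodule 𝕜 V) [DirectSum.Decomposition 𝒱] {n : ℤ}
    {ξ : Module.Dual 𝕜 V} (hξ : ξ ∈ dualGr 𝒱 n) : dualParity 𝒱 ξ = n.negOnePow • ξ := by
  apply dual_ext 𝒱
  intro m v hv
  have h1 : dualParity 𝒱 ξ v = ξ (parity 𝒱 v) := rfl
  rw [h1, parity_of_mem 𝒱 hv]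
  by_cases hm : m = -n
  · subst hm; simp [Int.negOnePow_neg, Units.smul_def]
  · have := hξ m hm v hv
    simp [Units.smul_def, this]

end Graded

/-! ### The symmetric algebra of the dual, and formal power series -/

section Sym

variable {𝕜 : Type*} [Field 𝕜] {V : Type*} [AddCommGroup V] [Module 𝕜 V]

/-- The relations `ξ ⊙ η = (-1)^{|ξ||η|} η ⊙ ξ` in the tensor algebra of `V^∨`. -/
inductive KoszulRel (𝒱 : ℤ → Submodule 𝕜 V) :
    TensorAlgebra 𝕜 (Module.Dual 𝕜 V) → TensorAlgebra 𝕜 (Module.Dual 𝕜 V) → Prop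
  | swap {i j : ℤ} {ξ η : Module.Dual 𝕜 V} (hξ : ξ ∈ dualGr 𝒱 i) (hη : η ∈ dualGr 𝒱 j) :
      KoszulRel 𝒱 (TensorAlgebra.ι 𝕜 ξ * TensorAlgebra.ι 𝕜 η)
        ((i * j).negOnePow • (TensorAlgebra.ι 𝕜 η * TensorAlgebra.ι 𝕜 ξ))

/-- The graded symmetric algebra `S(V^∨)`. -/
def SymDual (𝒱 : ℤ → Submodule 𝕜 V) : Type _ := RingQuot (KoszulRel 𝒱)

noncomputable instance (𝒱 : ℤ → Submodule 𝕜 V) : Ring (SymDual 𝒱) :=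
  inferInstanceAs (Ring (RingQuot (KoszulRel 𝒱)))

noncomputable instance (𝒱 : ℤ → Submodule 𝕜 V) : Algebra 𝕜 (SymDual 𝒱) :=
  inferInstanceAs (Algebra 𝕜 (RingQuot (KoszulRel 𝒱)))

/-- The quotient map from the tensor algebra. -/
noncomputable def symMk (𝒱 : ℤ → Submodule 𝕜 V) :
    TensorAlgebra 𝕜 (Module.Dual 𝕜 V) →ₐ[𝕜] SymDual 𝒱 :=
  RingQuot.mkAlgHom 𝕜 (KoszulRel 𝒱)

/-- The inclusion `V^∨ → S(V^∨)`. -/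
noncomputable def gen (𝒱 : ℤ → Submodule 𝕜 V) : Module.Dual 𝕜 V →ₗ[𝕜] SymDual 𝒱 :=
  (symMk 𝒱).toLinearMap ∘ₗ TensorAlgebra.ι 𝕜

theorem gen_swap (𝒱 : ℤ → Submodule 𝕜 V) {i j : ℤ} {ξ η : Module.Dual 𝕜 V}
    (hξ : ξ ∈ dualGr 𝒱 i) (hη : η ∈ dualGr 𝒱 j) :
    gen 𝒱 ξ * gen 𝒱 η = (i * j).negOnePow • (gen 𝒱 η * gen 𝒱 ξ) := by
  have : symMk 𝒱 _ = symMk 𝒱 _ := RingQuot.mkAlgHom_rel 𝕜 (KoszulRel.swap (𝒱 := 𝒱) hξ hη)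
  simpa [gen, Units.smul_def] using this

/-- The universal property of `S(V^∨)`. -/
noncomputable def symLift (𝒱 : ℤ → Submodule 𝕜 V) {B : Type*} [Ring B] [Algebra 𝕜 B]
    (f : Module.Dual 𝕜 V →ₗ[𝕜] B)
    (hf : ∀ (i j : ℤ) (ξ η : Module.Dual 𝕜 V), ξ ∈ dualGr 𝒱 i → η ∈ dualGr 𝒱 j →
      f ξ * f η = (i * j).negOnePow • (f η * f ξ)) : SymDual 𝒱 →ₐ[𝕜] B :=
  RingQuot.liftAlgHom 𝕜 ⟨TensorAlgebra.lift 𝕜 f, by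
    rintro _ _ ⟨hξ, hη⟩
    simpa [Units.smul_def] using hf _ _ _ _ hξ hη⟩

theorem symLift_symMk (𝒱 : ℤ → Submodule 𝕜 V) {B : Type*} [Ring B] [Algebra 𝕜 B]
    (f : Module.Dual 𝕜 V →ₗ[𝕜] B)
    (hf : ∀ (i j : ℤ) (ξ η : Module.Dual 𝕜 V), ξ ∈ dualGr 𝒱 i → η ∈ dualGr 𝒱 j →
      f ξ * f η = (i * j).negOnePow • (f η * f ξ)) (t : TensorAlgebra 𝕜 (Module.Dual 𝕜 V)) :
    symLift 𝒱 f hf (symMk 𝒱 t) = TensorAlgebra.lift 𝕜 f t :=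
  RingQuot.liftAlgHom_mkAlgHom_apply 𝕜 _ _ t

theorem symLift_gen (𝒱 : ℤ → Submodule 𝕜 V) {B : Type*} [Ring B] [Algebra 𝕜 B]
    (f : Module.Dual 𝕜 V →ₗ[𝕜] B)
    (hf : ∀ (i j : ℤ) (ξ η : Module.Dual 𝕜 V), ξ ∈ dualGr 𝒱 i → η ∈ dualGr 𝒱 j →
      f ξ * f η = (i * j).negOnePow • (f η * f ξ)) (ξ : Module.Dual 𝕜 V) :
    symLift 𝒱 f hf (gen 𝒱 ξ) = f ξ := by
  have h : gen 𝒱 ξ = symMk 𝒱 (TensorAlgebra.ι 𝕜 ξ) := rfl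
  rw [h, symLift_symMk, TensorAlgebra.lift_ι_apply]

/-- The homogeneous component `S^n(V^∨)`. -/
noncomputable def symPow (𝒱 : ℤ → Submodule 𝕜 V) (n : ℕ) : Submodule 𝕜 (SymDual 𝒱) :=
  (LinearMap.range (gen 𝒱)) ^ n

/-- `p` is a product of `n` homogeneous elements of `V^∨` whose degrees add up to `d`. -/
inductive IsMonomial (𝒱 : ℤ → Submodule 𝕜 V) : ℕ → ℤ → SymDual 𝒱 → Prop
  | one : IsMonomial 𝒱 0 0 1
  | mul {n : ℕ} {i d : ℤ} {ξ : Module.Dual 𝕜 V} {p : SymDual 𝒱} (hξ : ξ ∈ dualGr 𝒱 i)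
      (hp : IsMonomial 𝒱 n d p) : IsMonomial 𝒱 (n + 1) (i + d) (gen 𝒱 ξ * p)

/-- The part `S^n(V^∨)^d` of degree `d` of `S^n(V^∨)`. -/
noncomputable def symPowGr (𝒱 : ℤ → Submodule 𝕜 V) (n : ℕ) (d : ℤ) : Submodule 𝕜 (SymDual 𝒱) :=
  Submodule.span 𝕜 {p | IsMonomial 𝒱 n d p}

/-- The involution `p ↦ (-1)^|p| p` of `S(V^∨)`. -/
noncomputable def symParity (𝒱 : ℤ → Submodule 𝕜 V) [DirectSum.Decomposition 𝒱] :
    SymDual 𝒱 →ₐ[𝕜] SymDual 𝒱 :=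
  symLift 𝒱 (gen 𝒱 ∘ₗ dualParity 𝒱) (by
    intro i j ξ η hξ hη
    simp only [LinearMap.comp_apply, dualParity_of_mem 𝒱 hξ, dualParity_of_mem 𝒱 hη]
    simp only [Units.smul_def, map_zsmul, smul_mul_assoc, mul_smul_comm]
    rw [gen_swap 𝒱 hξ hη, Units.smul_def]
    simp only [smul_smul]
    congr 1
    ring)

/-- Multiplication by `ξ` on pairs `(p, q)`, where `q` is thought of as the contraction of `p`
with `v`. -/
noncomputable def contrGen (𝒱 : ℤ → Submodule 𝕜 V) [DirectSum.Decomposition 𝒱] (v : V) :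
    Module.Dual 𝕜 V →ₗ[𝕜] Module.End 𝕜 (SymDual 𝒱 × SymDual 𝒱) where
  toFun ξ := LinearMap.prod
    (LinearMap.mulLeft 𝕜 (gen 𝒱 ξ) ∘ₗ LinearMap.fst 𝕜 _ _)
    (LinearMap.mulLeft 𝕜 (gen 𝒱 ξ) ∘ₗ LinearMap.snd 𝕜 _ _ +
      (ξ (evenPart (parity 𝒱) v) • LinearMap.id +
        ξ (oddPart (parity 𝒱) v) • (symParity 𝒱).toLinearMap) ∘ₗ LinearMap.fst 𝕜 _ _)
  map_add' ξ η := by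
    refine LinearMap.ext fun x => Prod.ext ?_ ?_
    · simp [add_mul]
    · simp [add_mul, add_smul]; abel
  map_smul' c ξ := by
    refine LinearMap.ext fun x => Prod.ext ?_ ?_
    · simp
    · simp [smul_smul, smul_add]

theorem apply_evenPart (𝒱 : ℤ → Submodule 𝕜 V) [DirectSum.Decomposition 𝒱] {i : ℤ}
    {ξ : Module.Dual 𝕜 V} (hξ : ξ ∈ dualGr 𝒱 i) (v : V) :
    ξ (evenPart (parity 𝒱) v) = (2⁻¹ : 𝕜) * (ξ v + i.negOnePow • ξ v) := by
  have h : ξ (parity 𝒱 v) = i.negOnePow • ξ v :=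
    DFunLike.congr_fun (dualParity_of_mem 𝒱 hξ) v
  simp [evenPart, h, mul_add]

theorem apply_oddPart (𝒱 : ℤ → Submodule 𝕜 V) [DirectSum.Decomposition 𝒱] {i : ℤ}
    {ξ : Module.Dual 𝕜 V} (hξ : ξ ∈ dualGr 𝒱 i) (v : V) :
    ξ (oddPart (parity 𝒱) v) = (2⁻¹ : 𝕜) * (ξ v - i.negOnePow • ξ v) := by
  have h : ξ (parity 𝒱 v) = i.negOnePow • ξ v :=
    DFunLike.congr_fun (dualParity_of_mem 𝒱 hξ) v
  simp [oddPart, h]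

theorem symParity_gen (𝒱 : ℤ → Submodule 𝕜 V) [DirectSum.Decomposition 𝒱]
    (ξ : Module.Dual 𝕜 V) : symParity 𝒱 (gen 𝒱 ξ) = gen 𝒱 (dualParity 𝒱 ξ) := by
  rw [symParity, symLift_gen]; rfl

theorem contrGen_apply (𝒱 : ℤ → Submodule 𝕜 V) [DirectSum.Decomposition 𝒱] (v : V)
    (ξ : Module.Dual 𝕜 V) (x : SymDual 𝒱 × SymDual 𝒱) :
    contrGen 𝒱 v ξ x = (gen 𝒱 ξ * x.1, gen 𝒱 ξ * x.2 +
      (ξ (evenPart (parity 𝒱) v) • x.1 + ξ (oddPart (parity 𝒱) v) • symParity 𝒱 x.1)) := rfl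

theorem contrGen_swap (𝒱 : ℤ → Submodule 𝕜 V) [DirectSum.Decomposition 𝒱] (v : V)
    (i j : ℤ) (ξ η : Module.Dual 𝕜 V) (hξ : ξ ∈ dualGr 𝒱 i) (hη : η ∈ dualGr 𝒱 j) :
    contrGen 𝒱 v ξ * contrGen 𝒱 v η =
      (i * j).negOnePow • (contrGen 𝒱 v η * contrGen 𝒱 v ξ) := by
  have key := gen_swap 𝒱 hξ hη
  have hpar : ∀ {k : ℤ} {ζ : Module.Dual 𝕜 V}, ζ ∈ dualGr 𝒱 k → ∀ p,
      symParity 𝒱 (gen 𝒱 ζ * p) = k.negOnePow • (gen 𝒱 ζ * symParity 𝒱 p) := by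
    intro k ζ hζ p
    rw [map_mul, symParity_gen, dualParity_of_mem 𝒱 hζ]
    simp only [Units.smul_def, map_zsmul, smul_mul_assoc]
  have h (x : SymDual 𝒱 × SymDual 𝒱) : contrGen 𝒱 v ξ (contrGen 𝒱 v η x) =
      (i * j).negOnePow • contrGen 𝒱 v η (contrGen 𝒱 v ξ x) := by
    have k1 (p : SymDual 𝒱) : gen 𝒱 ξ * (gen 𝒱 η * p) =
        (i * j).negOnePow • (gen 𝒱 η * (gen 𝒱 ξ * p)) := by
      rw [← mul_assoc, key, Units.smul_def, Units.smul_def, smul_mul_assoc, mul_assoc]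
    simp only [contrGen_apply, hpar hξ, hpar hη, k1, mul_add, apply_evenPart 𝒱 hξ,
      apply_evenPart 𝒱 hη, apply_oddPart 𝒱 hξ, apply_oddPart 𝒱 hη, mul_smul_comm]
    refine Prod.ext rfl ?_
    rcases Int.even_or_odd i with hi | hi <;> rcases Int.even_or_odd j with hj | hj
    · rw [Int.negOnePow_even _ hi, Int.negOnePow_even _ hj, Int.negOnePow_even _ (hi.mul_right j)]
      simp only [one_smul, sub_self, mul_zero, zero_smul, add_zero]
      abel
    · rw [Int.negOnePow_even _ hi, Int.negOnePow_odd _ hj, Int.negOnePow_even _ (hi.mul_right j)]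
      simp only [one_smul, sub_self, mul_zero, zero_smul, add_zero, Units.neg_smul,
        add_neg_cancel, zero_add]
      abel
    · rw [Int.negOnePow_odd _ hi, Int.negOnePow_even _ hj, Int.negOnePow_even _ (hj.mul_left i)]
      simp only [one_smul, sub_self, mul_zero, zero_smul, add_zero, Units.neg_smul,
        add_neg_cancel, zero_add]
      abel
    · rw [Int.negOnePow_odd _ hi, Int.negOnePow_odd _ hj, Int.negOnePow_odd _ (hi.mul hj)]
      simp only [one_smul, zero_smul, Units.neg_smul, add_neg_cancel, zero_add, neg_add,
        smul_neg, neg_neg, Prod.snd_neg, sub_neg_eq_add]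
      abel
  rcases Int.even_or_odd (i * j) with hi | hi
  · rw [Int.negOnePow_even _ hi, one_smul] at *
    exact LinearMap.ext fun x => by simpa [Int.negOnePow_even _ hi] using h x
  · rw [Int.negOnePow_odd _ hi, Units.neg_smul, one_smul] at *
    exact LinearMap.ext fun x => by simpa [Int.negOnePow_odd _ hi] using h x

/-- The action of `S(V^∨)` on pairs that extends `contrGen`. -/
noncomputable def contrHom (𝒱 : ℤ → Submodule 𝕜 V) [DirectSum.Decomposition 𝒱] (v : V) :
    SymDual 𝒱 →ₐ[𝕜] Module.End 𝕜 (SymDual 𝒱 × SymDual 𝒱) :=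
  symLift (B := Module.End 𝕜 (SymDual 𝒱 × SymDual 𝒱)) 𝒱 (contrGen 𝒱 v) (contrGen_swap 𝒱 v)

/-- The right contraction `p ↦ p ⌞ v` of `S(V^∨)`, determined by `ξ ⌞ v = ξ(v)` and
`(p ⊙ q) ⌞ v = (-1)^{|v||q|} (p ⌞ v) ⊙ q + p ⊙ (q ⌞ v)`. -/
noncomputable def symContr (𝒱 : ℤ → Submodule 𝕜 V) [DirectSum.Decomposition 𝒱] (v : V) :
    SymDual 𝒱 →ₗ[𝕜] SymDual 𝒱 where
  toFun p := (contrHom 𝒱 v p (1, 0)).2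
  map_add' p q := by simp
  map_smul' c p := by simp

theorem contrHom_gen_mul (𝒱 : ℤ → Submodule 𝕜 V) [DirectSum.Decomposition 𝒱] (v : V)
    (ξ : Module.Dual 𝕜 V) (p : SymDual 𝒱) (x : SymDual 𝒱 × SymDual 𝒱) :
    contrHom 𝒱 v (gen 𝒱 ξ * p) x = contrGen 𝒱 v ξ (contrHom 𝒱 v p x) := by
  rw [map_mul, Module.End.mul_apply]
  congr 1
  rw [contrHom, symLift_gen]

theorem contrHom_fst (𝒱 : ℤ → Submodule 𝕜 V) [DirectSum.Decomposition 𝒱] (v : V)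
    (p : SymDual 𝒱) (x : SymDual 𝒱 × SymDual 𝒱) : (contrHom 𝒱 v p x).1 = p * x.1 := by
  obtain ⟨t, rfl⟩ : ∃ t, symMk 𝒱 t = p := RingQuot.mkAlgHom_surjective 𝕜 (KoszulRel 𝒱) p
  induction t using TensorAlgebra.induction generalizing x with
  | algebraMap r => simp [Algebra.algebraMap_eq_smul_one]
  | ι ξ =>
    change (contrHom 𝒱 v (gen 𝒱 ξ) x).1 = gen 𝒱 ξ * x.1
    have := contrHom_gen_mul 𝒱 v ξ 1 x
    rw [mul_one] at this
    rw [this, contrGen_apply]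
    simp
  | mul a b ha hb => simp [ha, hb, mul_assoc]
  | add a b ha hb => simp [ha, hb, add_mul]

theorem symContr_gen_mul (𝒱 : ℤ → Submodule 𝕜 V) [DirectSum.Decomposition 𝒱] (v : V)
    (ξ : Module.Dual 𝕜 V) (p : SymDual 𝒱) :
    symContr 𝒱 v (gen 𝒱 ξ * p) = gen 𝒱 ξ * symContr 𝒱 v p +
      (ξ (evenPart (parity 𝒱) v) • p + ξ (oddPart (parity 𝒱) v) • symParity 𝒱 p) := by
  have h := contrHom_fst 𝒱 v p (1, 0)
  have h2 : symContr 𝒱 v (gen 𝒱 ξ * p) = (contrHom 𝒱 v (gen 𝒱 ξ * p) (1, 0)).2 := rfl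
  rw [h2, contrHom_gen_mul, contrGen_apply, h, mul_one]
  rfl

theorem symContr_algebraMap (𝒱 : ℤ → Submodule 𝕜 V) [DirectSum.Decomposition 𝒱] (v : V)
    (c : 𝕜) : symContr 𝒱 v (algebraMap 𝕜 _ c) = 0 := by
  simp [symContr]

theorem algHom_mem_symPow {W : Type*} [AddCommGroup W] [Module 𝕜 W]
    (𝒱 : ℤ → Submodule 𝕜 V) (𝒲 : ℤ → Submodule 𝕜 W) (f : SymDual 𝒱 →ₐ[𝕜] SymDual 𝒲)
    (hf : ∀ ξ, f (gen 𝒱 ξ) ∈ LinearMap.range (gen 𝒲)) (n : ℕ) (p : SymDual 𝒱)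
    (hp : p ∈ symPow 𝒱 n) : f p ∈ symPow 𝒲 n := by
  induction n generalizing p with
  | zero =>
    simp only [symPow, pow_zero, Submodule.mem_one] at hp ⊢
    obtain ⟨c, rfl⟩ := hp
    exact ⟨c, by simp⟩
  | succ n ih =>
    rw [symPow, pow_succ'] at hp ⊢
    induction hp using Submodule.mul_induction_on' with
    | mem_mul_mem a ha b hb =>
      obtain ⟨ξ, rfl⟩ := ha
      rw [map_mul]
      exact Submodule.mul_mem_mul (hf ξ) (ih b hb)
    | add a _ b _ ha hb => rw [map_add]; exact Submodule.add_mem _ ha hb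

theorem symContr_mem (𝒱 : ℤ → Submodule 𝕜 V) [DirectSum.Decomposition 𝒱] (v : V) (n : ℕ)
    (p : SymDual 𝒱) (hp : p ∈ symPow 𝒱 (n + 1)) : symContr 𝒱 v p ∈ symPow 𝒱 n := by
  have hpar : ∀ (n : ℕ) (p : SymDual 𝒱), p ∈ symPow 𝒱 n → symParity 𝒱 p ∈ symPow 𝒱 n :=
    algHom_mem_symPow 𝒱 𝒱 (symParity 𝒱) fun ξ => ⟨dualParity 𝒱 ξ, (symParity_gen 𝒱 ξ).symm⟩
  induction n generalizing p with
  | zero =>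
    rw [symPow, pow_succ'] at hp
    induction hp using Submodule.mul_induction_on' with
    | mem_mul_mem a ha b hb =>
      obtain ⟨ξ, rfl⟩ := ha
      have hb' := hpar 0 b hb
      simp only [pow_zero, Submodule.mem_one] at hb
      obtain ⟨c, rfl⟩ := hb
      rw [symContr_gen_mul, symContr_algebraMap, mul_zero, zero_add]
      refine Submodule.add_mem _ (Submodule.smul_mem _ _ ?_) (Submodule.smul_mem _ _ hb')
      simp [symPow, Submodule.mem_one]
    | add a _ b _ ha hb => rw [map_add]; exact Submodule.add_mem _ ha hb
  | succ n ih =>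
    rw [symPow, pow_succ'] at hp
    induction hp using Submodule.mul_induction_on' with
    | mem_mul_mem a ha b hb =>
      obtain ⟨ξ, rfl⟩ := ha
      rw [symContr_gen_mul]
      refine Submodule.add_mem _ ?_
        (Submodule.add_mem _ (Submodule.smul_mem _ _ hb) (Submodule.smul_mem _ _ (hpar _ b hb)))
      rw [symPow, pow_succ']
      exact Submodule.mul_mem_mul ⟨_, rfl⟩ (ih b hb)
    | add a _ b _ ha hb => rw [map_add]; exact Submodule.add_mem _ ha hb

/-- The algebra `O(V) = ∏ₙ Sⁿ(V^∨)` of formal power series on `V`, realised as the algebra of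
those power series over `S(V^∨)` whose `n`-th coefficient lies in `Sⁿ(V^∨)`. -/
noncomputable def formalSeries (𝒱 : ℤ → Submodule 𝕜 V) :
    Subalgebra 𝕜 (PowerSeries (SymDual 𝒱)) where
  carrier := {f | ∀ n, PowerSeries.coeff n f ∈ symPow 𝒱 n}
  add_mem' := fun ha hb n => by rw [map_add]; exact Submodule.add_mem _ (ha n) (hb n)
  mul_mem' := fun ha hb n => by
    rw [PowerSeries.coeff_mul]
    refine Submodule.sum_mem _ fun p hp => ?_
    rw [← Finset.HasAntidiagonal.mem_antidiagonal.1 hp, symPow, pow_add]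
    exact Submodule.mul_mem_mul (ha _) (hb _)
  algebraMap_mem' := fun c n => by
    rw [PowerSeries.algebraMap_apply, PowerSeries.coeff_C]
    split_ifs with h
    · subst h
      rw [symPow, pow_zero, Submodule.mem_one]
      exact ⟨c, rfl⟩
    · exact Submodule.zero_mem _

/-- `O(V)` as a type. -/
def Series (𝒱 : ℤ → Submodule 𝕜 V) : Type _ := ↥(formalSeries 𝒱)

noncomputable instance (𝒱 : ℤ → Submodule 𝕜 V) : Ring (Series 𝒱) :=
  inferInstanceAs (Ring ↥(formalSeries 𝒱))

noncomputable instance (𝒱 : ℤ → Submodule 𝕜 V) : Algebra 𝕜 (Series 𝒱) :=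
  inferInstanceAs (Algebra 𝕜 ↥(formalSeries 𝒱))

/-- The component in `Sⁿ(V^∨)` of a series. -/
noncomputable def coeff (𝒱 : ℤ → Submodule 𝕜 V) (n : ℕ) : Series 𝒱 →ₗ[𝕜] SymDual 𝒱 where
  toFun f := PowerSeries.coeff n f.1
  map_add' f g := (PowerSeries.coeff n).map_add f.1 g.1
  map_smul' _ _ := rfl

/-- The series with components `pₙ ∈ Sⁿ(V^∨)`. -/
noncomputable def mkSeries (𝒱 : ℤ → Submodule 𝕜 V) (p : ℕ → SymDual 𝒱)
    (hp : ∀ n, p n ∈ symPow 𝒱 n) : Series 𝒱 :=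
  ⟨PowerSeries.mk p, fun n => by rw [PowerSeries.coeff_mk]; exact hp n⟩

theorem coeff_mem (𝒱 : ℤ → Submodule 𝕜 V) (n : ℕ) (f : Series 𝒱) : coeff 𝒱 n f ∈ symPow 𝒱 n :=
  f.2 n

theorem coeff_mkSeries (𝒱 : ℤ → Submodule 𝕜 V) (p : ℕ → SymDual 𝒱)
    (hp : ∀ n, p n ∈ symPow 𝒱 n) (n : ℕ) : coeff 𝒱 n (mkSeries 𝒱 p hp) = p n :=
  PowerSeries.coeff_mk n p

theorem series_ext {𝒱 : ℤ → Submodule 𝕜 V} {f g : Series 𝒱}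
    (h : ∀ n, coeff 𝒱 n f = coeff 𝒱 n g) : f = g :=
  Subtype.ext (PowerSeries.ext h)

/-- The series of degree `d`: all components are of degree `d`. -/
noncomputable def seriesGr (𝒱 : ℤ → Submodule 𝕜 V) (d : ℤ) : Submodule 𝕜 (Series 𝒱) :=
  ⨅ n, (symPowGr 𝒱 n d).comap (coeff 𝒱 n)

/-- The algebra morphism between algebras of formal series that is given on each component by a
morphism `S(V^∨) → S(W^∨)` induced by a linear map `V^∨ → W^∨`. -/
noncomputable def seriesMap {W : Type*} [AddCommGroup W] [Module 𝕜 W]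
    (𝒱 : ℤ → Submodule 𝕜 V) (𝒲 : ℤ → Submodule 𝕜 W) (f : SymDual 𝒱 →ₐ[𝕜] SymDual 𝒲)
    (hf : ∀ ξ, f (gen 𝒱 ξ) ∈ LinearMap.range (gen 𝒲)) : Series 𝒱 →ₐ[𝕜] Series 𝒲 :=
  ((PowerSeries.mapAlgHom f).comp (formalSeries 𝒱).val).codRestrict (formalSeries 𝒲)
    fun x n => by
      have h : PowerSeries.coeff n (PowerSeries.mapAlgHom f x.1) = f (PowerSeries.coeff n x.1) := by
        rw [PowerSeries.mapAlgHom_apply, PowerSeries.coeff_map]; rfl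
      exact h ▸ algHom_mem_symPow 𝒱 𝒲 f hf n _ (x.2 n)

/-- The involution `ω ↦ (-1)^|ω| ω` of `O(V)`. -/
noncomputable def seriesParity (𝒱 : ℤ → Submodule 𝕜 V) [DirectSum.Decomposition 𝒱] :
    Series 𝒱 →ₐ[𝕜] Series 𝒱 :=
  seriesMap 𝒱 𝒱 (symParity 𝒱) fun ξ => ⟨dualParity 𝒱 ξ, (symParity_gen 𝒱 ξ).symm⟩

/-- The right contraction `ω ↦ ω ⌞ v` of `O(V)`. -/
noncomputable def seriesContr (𝒱 : ℤ → Submodule 𝕜 V) [DirectSum.Decomposition 𝒱] (v : V) :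
    Series 𝒱 →ₗ[𝕜] Series 𝒱 where
  toFun f := mkSeries 𝒱 (fun n => symContr 𝒱 v (coeff 𝒱 (n + 1) f)) fun n =>
    symContr_mem 𝒱 v n _ (coeff_mem 𝒱 (n + 1) f)
  map_add' f g := series_ext fun n => by simp only [map_add, coeff_mkSeries]
  map_smul' c f := series_ext fun n => by simp only [map_smul, coeff_mkSeries, RingHom.id_apply]

/-- The inclusion `V^∨ = S¹(V^∨) → O(V)`. -/
noncomputable def seriesGen (𝒱 : ℤ → Submodule 𝕜 V) : Module.Dual 𝕜 V →ₗ[𝕜] Series 𝒱 where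
  toFun ξ := mkSeries 𝒱 (fun n => if n = 1 then gen 𝒱 ξ else 0) fun n => by
    split_ifs with h
    · subst h; rw [symPow, pow_one]; exact ⟨ξ, rfl⟩
    · exact Submodule.zero_mem _
  map_add' ξ η := series_ext fun n => by
    simp only [map_add, coeff_mkSeries]; split_ifs <;> simp
  map_smul' c ξ := series_ext fun n => by
    simp only [map_smul, coeff_mkSeries, RingHom.id_apply]; split_ifs <;> simp

/-- The projection `pr₀ : O(V) → S⁰(V^∨) = 𝕜`. -/
noncomputable def seriesConst (𝒱 : ℤ → Submodule 𝕜 V) : Series 𝒱 →ₗ[𝕜] 𝕜 :=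
  (symLift 𝒱 (B := 𝕜) 0 (fun _ _ _ _ _ _ => by simp)).toLinearMap ∘ₗ coeff 𝒱 0

/-- The restriction `j^∨ : O(V) → O(A)` to a subspace `A`, dual to the inclusion `j : A → V`. -/
noncomputable def restr (𝒱 : ℤ → Submodule 𝕜 V) (A : Submodule 𝕜 V) :
    Series 𝒱 →ₐ[𝕜] Series (subGr 𝒱 A) :=
  have hsub : ∀ {i : ℤ} {ξ : Module.Dual 𝕜 V}, ξ ∈ dualGr 𝒱 i →
      A.subtype.dualMap ξ ∈ dualGr (subGr 𝒱 A) i := fun hξ m hm v hv => hξ m hm v.1 hv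
  have hgr : ∀ (i j : ℤ) (ξ η : Module.Dual 𝕜 V), ξ ∈ dualGr 𝒱 i → η ∈ dualGr 𝒱 j →
      (gen (subGr 𝒱 A) ∘ₗ A.subtype.dualMap) ξ * (gen (subGr 𝒱 A) ∘ₗ A.subtype.dualMap) η =
        (i * j).negOnePow • ((gen (subGr 𝒱 A) ∘ₗ A.subtype.dualMap) η *
          (gen (subGr 𝒱 A) ∘ₗ A.subtype.dualMap) ξ) :=
    fun _ _ _ _ hξ hη => gen_swap (subGr 𝒱 A) (hsub hξ) (hsub hη)
  seriesMap 𝒱 (subGr 𝒱 A) (symLift 𝒱 (gen (subGr 𝒱 A) ∘ₗ A.subtype.dualMap) hgr)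
    fun ξ => ⟨A.subtype.dualMap ξ, by rw [symLift_gen]; rfl⟩

end Sym

/-! ### The modules `O(V) ⊗ X` over `O(V)` -/

section Coeff

variable {𝕜 : Type*} [Field 𝕜] {V : Type*} [AddCommGroup V] [Module 𝕜 V]
  (𝒱 : ℤ → Submodule 𝕜 V)
  {X : Type*} [AddCommGroup X] [Module 𝕜 X] {Y : Type*} [AddCommGroup Y] [Module 𝕜 Y]
  {Z : Type*} [AddCommGroup Z] [Module 𝕜 Z]

/-- The inclusion `x ↦ 1 ⊗ x` of `X` in `O(V) ⊗ X`. -/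
noncomputable def one (X : Type*) [AddCommGroup X] [Module 𝕜 X] : X →ₗ[𝕜] Series 𝒱 ⊗[𝕜] X :=
  TensorProduct.mk 𝕜 (Series 𝒱) X 1

/-- The pairing `(ω ⊗ x, η ⊗ y) ↦ (-1)^{|x||η|} (ω ⊙ η) ⊗ b(x, y)` that a bilinear map `b` of degree
`0` induces; `σ` is the grading involution of `X`. -/
noncomputable def koszul [DirectSum.Decomposition 𝒱] (σ : X →ₗ[𝕜] X) (b : X →ₗ[𝕜] Y →ₗ[𝕜] Z) :
    Series 𝒱 ⊗[𝕜] X →ₗ[𝕜] Series 𝒱 ⊗[𝕜] Y →ₗ[𝕜] Series 𝒱 ⊗[𝕜] Z :=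
  TensorProduct.map₂ (LinearMap.mul 𝕜 (Series 𝒱)) (b ∘ₗ evenPart σ) +
    TensorProduct.map₂ ((LinearMap.mul 𝕜 (Series 𝒱)).compl₂ (seriesParity 𝒱).toLinearMap)
      (b ∘ₗ oddPart σ)

/-- The operator `Q + D : O(V) ⊗ X → O(V) ⊗ X`,
`ω ⊗ x ↦ Q(ω) ⊗ x + (-1)^|ω| ω ⊙ D(x)`, for an operator `Q` on `O(V)` and `D : X → O(V) ⊗ X`. -/
noncomputable def connOp [DirectSum.Decomposition 𝒱] (Q : Series 𝒱 →ₗ[𝕜] Series 𝒱)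
    (D : X →ₗ[𝕜] Series 𝒱 ⊗[𝕜] X) : Series 𝒱 ⊗[𝕜] X →ₗ[𝕜] Series 𝒱 ⊗[𝕜] X :=
  LinearMap.rTensor X Q +
    LinearMap.rTensor X (LinearMap.mul' 𝕜 (Series 𝒱)) ∘ₗ
      (TensorProduct.assoc 𝕜 (Series 𝒱) (Series 𝒱) X).symm.toLinearMap ∘ₗ
        TensorProduct.map (seriesParity 𝒱).toLinearMap D

/-- The tensor product of two connections: for `D^X : X → O(V) ⊗ X` and `D^Y : Y → O(V) ⊗ Y`,
`D(x ⊗ y) = D^X(x) ⊗ y + (-1)^|x| x ⊗ D^Y(y)`, the last term being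
`(-1)^{|x|+|x||η|} η ⊗ x ⊗ y'` when `D^Y(y) = η ⊗ y'`. -/
noncomputable def tensorD [DirectSum.Decomposition 𝒱] (σ : X →ₗ[𝕜] X)
    (DX : X →ₗ[𝕜] Series 𝒱 ⊗[𝕜] X) (DY : Y →ₗ[𝕜] Series 𝒱 ⊗[𝕜] Y) :
    X ⊗[𝕜] Y →ₗ[𝕜] Series 𝒱 ⊗[𝕜] (X ⊗[𝕜] Y) :=
  TensorProduct.lift
    ((koszul 𝒱 σ (TensorProduct.mk 𝕜 X Y)).compl₁₂ DX (one 𝒱 Y) +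
      (koszul 𝒱 σ (TensorProduct.mk 𝕜 X Y)).compl₁₂ (one 𝒱 X ∘ₗ σ) DY)

/-- The right contraction `(ω ⊗ x) ⌞ v = (-1)^{|v||x|} (ω ⌞ v) ⊗ x`. -/
noncomputable def contr [DirectSum.Decomposition 𝒱] (σ : X →ₗ[𝕜] X) (v : V) :
    Series 𝒱 ⊗[𝕜] X →ₗ[𝕜] Series 𝒱 ⊗[𝕜] X :=
  TensorProduct.map (seriesContr 𝒱 (evenPart (parity 𝒱) v)) LinearMap.id +
    TensorProduct.map (seriesContr 𝒱 (oddPart (parity 𝒱) v)) σ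

/-- The value `t ⌞ v₁ ⌞ ⋯ ⌞ vₖ ∈ X` (the constant term is taken at the end) of the component of `t`
in `Sᵏ(V^∨) ⊗ X` on the list `v₁, …, vₖ`. -/
noncomputable def evalList [DirectSum.Decomposition 𝒱] (σ : X →ₗ[𝕜] X) (t : Series 𝒱 ⊗[𝕜] X)
    (vs : List V) : X :=
  TensorProduct.lid 𝕜 X
    (LinearMap.rTensor X (seriesConst 𝒱) (vs.foldl (fun s v => contr 𝒱 σ v s) t))

/-- The algebraic de Rham operator `I^V : O(V) → O(V) ⊗ V^∨`, that is, the sum of the duals of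
`Sᵏ(V) ⊗ V → Sᵏ⁺¹(V)`.  In a basis `bᵢ` of `V` it reads `ω ↦ ∑ᵢ (ω ⌞ bᵢ) ⊗ bⁱ`, and the sum does
not depend on the basis. -/
noncomputable def deRham [DirectSum.Decomposition 𝒱] [FiniteDimensional 𝕜 V] :
    Series 𝒱 →ₗ[𝕜] Series 𝒱 ⊗[𝕜] Module.Dual 𝕜 V :=
  ∑ i, (TensorProduct.mk 𝕜 (Series 𝒱) (Module.Dual 𝕜 V)).flip ((Module.finBasis 𝕜 V).coord i) ∘ₗ
    seriesContr 𝒱 (Module.finBasis 𝕜 V i)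

end Coeff

/-! ### SH Lie algebras, connections and modules -/

section Lie

variable {𝕜 : Type*} [Field 𝕜]

/-- An SH Lie algebra (`L_∞[1]`-algebra) structure on a graded vector space `L`, in the form of a
homological vector field: a derivation `Q` of `O(L)` of degree `1` and square zero. -/
structure SHLieAlgebra {L : Type*} [AddCommGroup L] [Module 𝕜 L] (ℒ : ℤ → Submodule 𝕜 L)
    [DirectSum.Decomposition ℒ] where
  Q : Series ℒ →ₗ[𝕜] Series ℒ
  degree : ∀ d, ∀ ω ∈ seriesGr ℒ d, Q ω ∈ seriesGr ℒ (d + 1)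
  leibniz : ∀ ω η, Q (ω * η) = Q ω * η + seriesParity ℒ ω * Q η
  sq_zero : Q ∘ₗ Q = 0

/-- An SH Lie pair `(L, A)`: an SH Lie algebra `L` with a graded subspace `A` that is a subalgebra,
i.e. the restriction `O(L) → O(A)` intertwines `Q_L` with a homological vector field `Q_A`. -/
structure SHLiePair {L : Type*} [AddCommGroup L] [Module 𝕜 L] (ℒ : ℤ → Submodule 𝕜 L)
    [DirectSum.Decomposition ℒ] (A : Submodule 𝕜 L) [DirectSum.Decomposition (subGr ℒ A)] where
  toL : SHLieAlgebra ℒ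
  toA : SHLieAlgebra (subGr ℒ A)
  restr_comp : (restr ℒ A).toLinearMap ∘ₗ toL.Q = toA.Q ∘ₗ (restr ℒ A).toLinearMap

section Module

variable {L : Type*} [AddCommGroup L] [Module 𝕜 L] {ℒ : ℤ → Submodule 𝕜 L}
  [DirectSum.Decomposition ℒ] {E : Type*} [AddCommGroup E] [Module 𝕜 E]

/-- The grading of `O(L) ⊗ End(E)`. -/
noncomputable def serEndGr (ℒ : ℤ → Submodule 𝕜 L) (ℰ : ℤ → Submodule 𝕜 E) (d : ℤ) :
    Submodule 𝕜 (Series ℒ ⊗[𝕜] Module.End 𝕜 E) :=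
  tensorGr (seriesGr ℒ) (endGr ℰ) d

/-- The action of `O(L) ⊗ End(E)` on `O(L) ⊗ E`,
`(ω ⊗ φ)(η ⊗ e) = (-1)^{|φ||η|} (ω ⊙ η) ⊗ φ(e)`. -/
noncomputable def act (ℒ : ℤ → Submodule 𝕜 L) [DirectSum.Decomposition ℒ]
    (ℰ : ℤ → Submodule 𝕜 E) [DirectSum.Decomposition ℰ] :
    Series ℒ ⊗[𝕜] Module.End 𝕜 E →ₗ[𝕜] Series ℒ ⊗[𝕜] E →ₗ[𝕜] Series ℒ ⊗[𝕜] E :=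
  koszul ℒ (endParity ℰ) LinearMap.id

/-- The product of `O(L) ⊗ End(E)`,
`(ω ⊗ φ) ∘ (η ⊗ ψ) = (-1)^{|φ||η|} (ω ⊙ η) ⊗ (φ ∘ ψ)`. -/
noncomputable def comp (ℒ : ℤ → Submodule 𝕜 L) [DirectSum.Decomposition ℒ]
    (ℰ : ℤ → Submodule 𝕜 E) [DirectSum.Decomposition ℰ] :
    Series ℒ ⊗[𝕜] Module.End 𝕜 E →ₗ[𝕜] Series ℒ ⊗[𝕜] Module.End 𝕜 E →ₗ[𝕜]
      Series ℒ ⊗[𝕜] Module.End 𝕜 E :=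
  koszul ℒ (endParity ℰ) (LinearMap.mul 𝕜 (Module.End 𝕜 E))

/-- An `L`-connection `∇ = Q_L + D` on `E`, given by an element `D ∈ (O(L) ⊗ End(E))¹`. -/
structure Connection (G : SHLieAlgebra ℒ) (ℰ : ℤ → Submodule 𝕜 E) where
  D : Series ℒ ⊗[𝕜] Module.End 𝕜 E
  degree : D ∈ serEndGr ℒ ℰ 1

variable {G : SHLieAlgebra ℒ} {ℰ : ℤ → Submodule 𝕜 E} [DirectSum.Decomposition ℰ]

/-- The operator `∇ = Q_L + D : O(L) ⊗ E → O(L) ⊗ E`,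
`ω ⊗ e ↦ Q_L(ω) ⊗ e + (-1)^|ω| ω ⊙ D(e)`. -/
noncomputable def Connection.op (N : Connection G ℰ) : Series ℒ ⊗[𝕜] E →ₗ[𝕜] Series ℒ ⊗[𝕜] E :=
  connOp ℒ G.Q (act ℒ ℰ N.D ∘ₗ one ℒ E)

/-- The curvature `R^∇ = ∇² = Q_L(D) + D ∘ D`, an element of `O(L) ⊗ End(E)`. -/
noncomputable def Connection.curvature (N : Connection G ℰ) : Series ℒ ⊗[𝕜] Module.End 𝕜 E :=
  LinearMap.rTensor (Module.End 𝕜 E) G.Q N.D + comp ℒ ℰ N.D N.D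

/-- An `L`-module structure on `E`: a flat `L`-connection `∂ = Q_L + D`, `∂² = 0`. -/
structure SHModule (G : SHLieAlgebra ℒ) (ℰ : ℤ → Submodule 𝕜 E) [DirectSum.Decomposition ℰ]
    extends Connection G ℰ where
  flat : toConnection.op ∘ₗ toConnection.op = 0

/-- The map `End(E) → O(L) ⊗ End(E)`, `φ ↦ [D, φ] = D ∘ φ - (-1)^|φ| φ ∘ D`, of the connection
induced on `End(E)`. -/
noncomputable def Connection.endD (N : Connection G ℰ) :
    Module.End 𝕜 E →ₗ[𝕜] Series ℒ ⊗[𝕜] Module.End 𝕜 E :=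
  comp ℒ ℰ N.D ∘ₗ one ℒ (Module.End 𝕜 E) -
    (comp ℒ ℰ).flip N.D ∘ₗ one ℒ (Module.End 𝕜 E) ∘ₗ endParity ℰ

/-- The induced connection `Q_L + [D, -]` on `O(L) ⊗ End(E)`. -/
noncomputable def Connection.endOp (N : Connection G ℰ) :
    Series ℒ ⊗[𝕜] Module.End 𝕜 E →ₗ[𝕜] Series ℒ ⊗[𝕜] Module.End 𝕜 E :=
  connOp ℒ G.Q N.endD

/-- The induced connection on `O(L) ⊗ End(E)[1]`.  Elements of `End(E)[1]` are endomorphisms, with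
shifted degree; the connection is transported along the isomorphism `ω ⊗ φ ↦ (-1)^|ω| ω ⊗ φ` of
degree `-1` between `O(L) ⊗ End(E)` and `O(L) ⊗ End(E)[1]`, with the sign `-1` of a shift. -/
noncomputable def Connection.endShiftOp (N : Connection G ℰ) :
    Series ℒ ⊗[𝕜] Module.End 𝕜 E →ₗ[𝕜] Series ℒ ⊗[𝕜] Module.End 𝕜 E :=
  -(LinearMap.rTensor _ (seriesParity ℒ).toLinearMap ∘ₗ N.endOp ∘ₗ
    LinearMap.rTensor _ (seriesParity ℒ).toLinearMap)

/-- The `k`-th component `f_k(u₁, …, u_k) = (-1)^k D ⌞ u₁ ⌞ ⋯ ⌞ u_k ∈ End(E)` of the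
`L_∞[1]`-morphism from `L` to `End(E)[1]` that corresponds to a module. -/
noncomputable def Connection.f (N : Connection G ℰ) (us : List L) : Module.End 𝕜 E :=
  (us.length : ℤ).negOnePow • evalList ℒ (endParity ℰ) N.D us

end Module

/-! ### SH Lie pairs and Atiyah classes -/

section Pair

variable {L : Type*} [AddCommGroup L] [Module 𝕜 L] [FiniteDimensional 𝕜 L]
  {ℒ : ℤ → Submodule 𝕜 L} [DirectSum.Decomposition ℒ]
  {A : Submodule 𝕜 L} [DirectSum.Decomposition (subGr ℒ A)]
  {E : Type*} [AddCommGroup E] [Module 𝕜 E] {ℰ : ℤ → Submodule 𝕜 E} [DirectSum.Decomposition ℰ]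

/-- `J = (j^∨ ⊗ 1) ∘ I^L : O(L) → O(A) ⊗ L^∨`. -/
noncomputable def J (ℒ : ℤ → Submodule 𝕜 L) [DirectSum.Decomposition ℒ] (A : Submodule 𝕜 L) :
    Series ℒ →ₗ[𝕜] Series (subGr ℒ A) ⊗[𝕜] Module.Dual 𝕜 L :=
  LinearMap.rTensor (Module.Dual 𝕜 L) (restr ℒ A).toLinearMap ∘ₗ deRham ℒ

/-- The coadjoint `A`-module structure `D^{L^∨} = J ∘ Q_L : L^∨ → O(A) ⊗ L^∨`.  It is dual to the
`A`-module structure `(a₁, …, a_k, l) ↦ λ_{k+1}(a₁, …, a_k, l)` on `L` given by the brackets. -/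
noncomputable def SHLiePair.coadD (P : SHLiePair ℒ A) :
    Module.Dual 𝕜 L →ₗ[𝕜] Series (subGr ℒ A) ⊗[𝕜] Module.Dual 𝕜 L :=
  J ℒ A ∘ₗ P.toL.Q ∘ₗ seriesGen ℒ

/-- The pairing `ω ⊗ ξ ↦ ξ(l) ω` of `O(A) ⊗ L^∨` with `l ∈ L`. -/
noncomputable def evalAt (A : Submodule 𝕜 L) (l : L) :
    Series (subGr ℒ A) ⊗[𝕜] Module.Dual 𝕜 L →ₗ[𝕜] Series (subGr ℒ A) :=
  (TensorProduct.rid 𝕜 (Series (subGr ℒ A))).toLinearMap ∘ₗ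
    LinearMap.lTensor (Series (subGr ℒ A)) (Module.Dual.eval 𝕜 L l)

/-- The `A`-module structure `D^L : L → O(A) ⊗ L` on `L`, determined by
`⟨D^{L^∨}(ξ), l⟩ = -(-1)^|ξ| ⟨ξ, D^L(l)⟩`, where `⟨ξ, ω ⊗ l'⟩ = (-1)^{|ξ||ω|} ξ(l') ω`;
equivalently the coefficient of `D^L(l)` along `ξ` is `-(-1)^{|ξ||l|+|ξ|} ⟨D^{L^∨}(ξ), l⟩`. -/
noncomputable def SHLiePair.adD (P : SHLiePair ℒ A) : L →ₗ[𝕜] Series (subGr ℒ A) ⊗[𝕜] L where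
  toFun l := ∑ i,
    (evalAt A (parity ℒ l) (P.coadD (oddPart (dualParity ℒ) ((Module.finBasis 𝕜 L).coord i))) -
      evalAt A l (P.coadD (evenPart (dualParity ℒ) ((Module.finBasis 𝕜 L).coord i)))) ⊗ₜ[𝕜]
        Module.finBasis 𝕜 L i
  map_add' l l' := by
    simp only [evalAt, map_add, LinearMap.lTensor_add, LinearMap.comp_add, LinearMap.add_apply,
      ← Finset.sum_add_distrib, ← TensorProduct.add_tmul]
    exact Finset.sum_congr rfl fun i _ => by congr 1; abel
  map_smul' c l := by
    simp only [evalAt, map_smul, LinearMap.lTensor_smul, LinearMap.comp_smul,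
      LinearMap.smul_apply, RingHom.id_apply, Finset.smul_sum, TensorProduct.smul_tmul',
      ← smul_sub]

/-- The differential `Q_A + D^L` of the `A`-module `L`. -/
noncomputable def SHLiePair.adOp (P : SHLiePair ℒ A) :
    Series (subGr ℒ A) ⊗[𝕜] L →ₗ[𝕜] Series (subGr ℒ A) ⊗[𝕜] L :=
  connOp (subGr ℒ A) P.toA.Q P.adD

/-- The space `O(A) ⊗ L^∨ ⊗ End(E)`. -/
abbrev LCochain (ℒ : ℤ → Submodule 𝕜 L) (A : Submodule 𝕜 L) (E : Type*) [AddCommGroup E]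
    [Module 𝕜 E] : Type _ :=
  Series (subGr ℒ A) ⊗[𝕜] (Module.Dual 𝕜 L ⊗[𝕜] Module.End 𝕜 E)

/-- The elements of degree `d` of `O(A) ⊗ L^∨ ⊗ End(E)`. -/
noncomputable def cochainGr (ℒ : ℤ → Submodule 𝕜 L) (A : Submodule 𝕜 L)
    (ℰ : ℤ → Submodule 𝕜 E) (d : ℤ) : Submodule 𝕜 (LCochain ℒ A E) :=
  tensorGr (seriesGr (subGr ℒ A)) (tensorGr (dualGr ℒ) (endGr ℰ)) d

/-- `O(A) ⊗ A^⊥ ⊗ End(E)` as a subspace of `O(A) ⊗ L^∨ ⊗ End(E)`, where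
`A^⊥ = ker (L^∨ → A^∨) ≅ (L/A)^∨`. -/
noncomputable def perpCochain (ℒ : ℤ → Submodule 𝕜 L) (A : Submodule 𝕜 L) (E : Type*)
    [AddCommGroup E] [Module 𝕜 E] : Submodule 𝕜 (LCochain ℒ A E) :=
  LinearMap.range (LinearMap.lTensor (Series (subGr ℒ A))
    (LinearMap.rTensor (Module.End 𝕜 E) A.dualAnnihilator.subtype))

variable (P : SHLiePair ℒ A) (M : SHModule P.toA ℰ)

/-- The differential `Q_A + D^{L^∨} + [D^{A,E}, -]` of the `A`-module `L^∨ ⊗ End(E)`.  Its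
restriction to `O(A) ⊗ A^⊥ ⊗ End(E)` is the differential of the `A`-module `A^⊥ ⊗ End(E)`. -/
noncomputable def cochainD : LCochain ℒ A E →ₗ[𝕜] LCochain ℒ A E :=
  connOp (subGr ℒ A) P.toA.Q (tensorD (subGr ℒ A) (dualParity ℒ) P.coadD M.endD)

/-- The cocycles of degree `2` in `O(A) ⊗ A^⊥ ⊗ End(E)`. -/
noncomputable def cocycles : Submodule 𝕜 (LCochain ℒ A E) :=
  perpCochain ℒ A E ⊓ cochainGr ℒ A ℰ 2 ⊓ LinearMap.ker (cochainD P M)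

/-- The coboundaries of degree `2` in `O(A) ⊗ A^⊥ ⊗ End(E)`: the differentials of elements of
degree `1` of `O(A) ⊗ A^⊥ ⊗ End(E)`. -/
noncomputable def coboundaries : Submodule 𝕜 (LCochain ℒ A E) :=
  (perpCochain ℒ A E ⊓ cochainGr ℒ A ℰ 1).map (cochainD P M)

/-- The Chevalley–Eilenberg cohomology `H²_CE(A, A^⊥ ⊗ End(E))`, cocycles modulo coboundaries, as
a subspace of the space of all cochains modulo coboundaries. -/
noncomputable def H2 : Submodule 𝕜 (LCochain ℒ A E ⧸ coboundaries P M) :=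
  (cocycles P M).map (coboundaries P M).mkQ

variable {P}

/-- `∇` extends `(A, E)`: `(j^∨ ⊗ 1)(D^{L,E}) = D^{A,E}`. -/
def Extends (N : Connection P.toL ℰ) (M : SHModule P.toA ℰ) : Prop :=
  LinearMap.rTensor (Module.End 𝕜 E) (restr ℒ A).toLinearMap N.D = M.D

/-- The Atiyah cocycle `α_∇ = (J ⊗ 1)(R^∇) ∈ O(A) ⊗ L^∨ ⊗ End(E)`. -/
noncomputable def atiyahCocycle (N : Connection P.toL ℰ) : LCochain ℒ A E :=
  TensorProduct.assoc 𝕜 (Series (subGr ℒ A)) (Module.Dual 𝕜 L) (Module.End 𝕜 E)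
    (LinearMap.rTensor (Module.End 𝕜 E) (J ℒ A) N.curvature)

/-- The set of the classes `[α_∇] ∈ H²_CE(A, A^⊥ ⊗ End(E))` of the Atiyah cocycles of the
`L`-connections `∇` extending `(A, E)`.  All these classes coincide; the Atiyah class is the only
element of this set. -/
def atiyahClasses (M : SHModule P.toA ℰ) : Set (LCochain ℒ A E ⧸ coboundaries P M) :=
  {c | c ∈ H2 P M ∧ ∃ N : Connection P.toL ℰ, Extends N M ∧
    (coboundaries P M).mkQ (atiyahCocycle N) = c}

/-- `(1 ⊗ j^∨ ⊗ 1) : O(A) ⊗ L^∨ ⊗ End(E) → O(A) ⊗ A^∨ ⊗ End(E)`. -/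
noncomputable def restrictCochain (ℒ : ℤ → Submodule 𝕜 L) (A : Submodule 𝕜 L) (E : Type*)
    [AddCommGroup E] [Module 𝕜 E] : LCochain ℒ A E →ₗ[𝕜]
      Series (subGr ℒ A) ⊗[𝕜] (Module.Dual 𝕜 A ⊗[𝕜] Module.End 𝕜 E) :=
  LinearMap.lTensor (Series (subGr ℒ A))
    (LinearMap.rTensor (Module.End 𝕜 E) A.subtype.dualMap)

/-- `(I^A ⊗ 1)(D^{A,E}) ∈ O(A) ⊗ A^∨ ⊗ End(E)`. -/
noncomputable def deRhamD (M : SHModule P.toA ℰ) :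
    Series (subGr ℒ A) ⊗[𝕜] (Module.Dual 𝕜 A ⊗[𝕜] Module.End 𝕜 E) :=
  TensorProduct.assoc 𝕜 (Series (subGr ℒ A)) (Module.Dual 𝕜 A) (Module.End 𝕜 E)
    (LinearMap.rTensor (Module.End 𝕜 E) (deRham (subGr ℒ A)) M.D)

/-- A morphism of `A`-modules from `L` to `End(E)[1]`: an `O(A)`-linear map
`O(A) ⊗ L → O(A) ⊗ End(E)[1]` of degree `0` that commutes with the differentials. -/
structure IsModuleMorphism (M : SHModule P.toA ℰ)
    (Φ : Series (subGr ℒ A) ⊗[𝕜] L →ₗ[𝕜] Series (subGr ℒ A) ⊗[𝕜] Module.End 𝕜 E) : Prop where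
  linear : ∀ (ω : Series (subGr ℒ A)) x, Φ (ω • x) = ω • Φ x
  degree : ∀ d, ∀ x ∈ tensorGr (seriesGr (subGr ℒ A)) ℒ d,
    Φ x ∈ tensorGr (seriesGr (subGr ℒ A)) (shiftGr (endGr ℰ) 1) d
  chain : Φ ∘ₗ P.adOp = M.endShiftOp ∘ₗ Φ

/-- The component `φ_k(a₁, …, a_k, l) = (-1)^{|l|(|a₁| + ⋯ + |a_k|) + k} φ(l) ⌞ a₁ ⌞ ⋯ ⌞ a_k` in
`End(E)[1]` of a morphism `φ`, for homogeneous arguments with `|l| = m` and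
`|a₁| + ⋯ + |a_k| = s`. -/
noncomputable def morphismComp (ℰ : ℤ → Submodule 𝕜 E) [DirectSum.Decomposition ℰ]
    (Φ : Series (subGr ℒ A) ⊗[𝕜] L →ₗ[𝕜] Series (subGr ℒ A) ⊗[𝕜] Module.End 𝕜 E)
    (s m : ℤ) (as : List A) (l : L) : Module.End 𝕜 E :=
  (m * s + as.length).negOnePow •
    evalList (subGr ℒ A) (-endParity ℰ) (Φ (1 ⊗ₜ[𝕜] l)) as

/-- `φ` extends the canonical morphism from `A` to `End(E)[1]`:
`φ_k(a₁, …, a_k, j(a)) = f_{k+1}(a₁, …, a_k, a)`. -/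
def ExtendsCanonical (M : SHModule P.toA ℰ)
    (Φ : Series (subGr ℒ A) ⊗[𝕜] L →ₗ[𝕜] Series (subGr ℒ A) ⊗[𝕜] Module.End 𝕜 E) : Prop :=
  ∀ (k : ℕ) (n : Fin k → ℤ) (a : Fin k → A) (m : ℤ) (b : A),
    (∀ i, a i ∈ subGr ℒ A (n i)) → b ∈ subGr ℒ A m →
      morphismComp ℰ Φ (∑ i, n i) m (List.ofFn a) b = M.f (List.ofFn a ++ [b])

end Pair
end Lie
end SHLie

/-! Write ∂ for `cochainD` and J for `J ⊗ 1`, which is `JEnd`. The operator J is a derivation along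
the restriction O(L) → O(A) (`J_mul`) and it intertwines Q_L with the coadjoint differential
(`SHLiePair.J_Q`). Apply it to the curvature Q_L(D) + D ∘ D of a connection extending (A, E). In the
quadratic term J acts on one factor while the other is restricted to A, where it becomes D^{A,E};
the two resulting terms make up the commutator with D^{A,E}. Hence the Atiyah cocycle is ∂(J(D))
(`atiyahCocycle_eq`). It need not be a coboundary with coefficients in A^⊥, because J(D) does not
lie there: its restriction to A is (I^A ⊗ 1)(D^{A,E}) (`restrictCochain_JEnd`).

Condition 2 is therefore the centre. If the class vanishes, subtracting from J(D) a primitive with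
values in A^⊥ gives a cocycle with the same restriction. If the Atiyah cocycle itself vanishes, J(D)
is such a cocycle. Conversely, every φ of degree 1 with the right restriction is J(D) for some
extending connection (`exists_connection`): pull D^{A,E} back along a graded retraction L → A, and
repair the error, which has values in A^⊥, by multiplying its L^∨ factor into the series. If φ is
closed, this connection has zero Atiyah cocycle, and since two extending connections have
cohomologous cocycles (`atiyahCocycle_sub_mem`), the class is zero.

The equivalence of 2 and 3 is the correspondence between elements of O(A) ⊗ L^∨ ⊗ End(E) and maps L
→ O(A) ⊗ End(E), twisted by the signs of the shift (`shiftHom`). Under it, closed means commuting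
with the differentials (`cochainD_eq_zero_iff`), and the condition on the restriction becomes the
condition on the components φ_k (`extendsCanonical_iff`). The latter needs that an element of O(A) ⊗
End(E) is determined by its iterated contractions, which follows from Euler's formula in
characteristic 0 (`eq_zero_of_evalList_eq_zero`). -/

open scoped TensorProduct

namespace SHLie

/-! ### Grading involutions and the splitting into even and odd parts. -/

section Involution

variable {𝕜 : Type*} [Field 𝕜] {V : Type*} [AddCommGroup V] [Module 𝕜 V]
  {W : Type*} [AddCommGroup W] [Module 𝕜 W] {U : Type*} [AddCommGroup U] [Module 𝕜 U]

theorem parity_parity (𝒱 : ℤ → Submodule 𝕜 V) [DirectSum.Decomposition 𝒱] (v : V) :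
    parity 𝒱 (parity 𝒱 v) = v := by
  induction v using DirectSum.Decomposition.inductionOn 𝒱 with
  | zero => simp
  | @homogeneous n m =>
    rw [parity_of_mem 𝒱 m.2, Units.smul_def, map_zsmul, parity_of_mem 𝒱 m.2, Units.smul_def,
      smul_smul, ← Units.val_mul, Int.units_mul_self]
    simp
  | add a b ha hb => simp [ha, hb]

theorem dualParity_apply (𝒱 : ℤ → Submodule 𝕜 V) [DirectSum.Decomposition 𝒱]
    (ξ : Module.Dual 𝕜 V) (v : V) : dualParity 𝒱 ξ v = ξ (parity 𝒱 v) := rfl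

theorem dualParity_dualParity (𝒱 : ℤ → Submodule 𝕜 V) [DirectSum.Decomposition 𝒱]
    (ξ : Module.Dual 𝕜 V) : dualParity 𝒱 (dualParity 𝒱 ξ) = ξ := by
  ext v; simp [dualParity_apply, parity_parity]

theorem endParity_apply (𝒱 : ℤ → Submodule 𝕜 V) [DirectSum.Decomposition 𝒱]
    (φ : Module.End 𝕜 V) : endParity 𝒱 φ = parity 𝒱 * (φ * parity 𝒱) := rfl

theorem endParity_endParity (𝒱 : ℤ → Submodule 𝕜 V) [DirectSum.Decomposition 𝒱]
    (φ : Module.End 𝕜 V) : endParity 𝒱 (endParity 𝒱 φ) = φ := by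
  ext v; simp [endParity_apply, parity_parity]

theorem endParity_of_mem (𝒱 : ℤ → Submodule 𝕜 V) [DirectSum.Decomposition 𝒱] {r : ℤ}
    {φ : Module.End 𝕜 V} (hφ : φ ∈ endGr 𝒱 r) : endParity 𝒱 φ = r.negOnePow • φ := by
  ext v
  induction v using DirectSum.Decomposition.inductionOn 𝒱 with
  | zero => simp
  | @homogeneous n m =>
    simp only [endParity_apply, Module.End.mul_apply, parity_of_mem 𝒱 m.2, Units.smul_def,
      map_zsmul, parity_of_mem 𝒱 (hφ n m m.2), smul_smul, ← Units.val_mul]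
    rw [Int.negOnePow_add, ← mul_assoc, Int.units_mul_self, one_mul]
    rfl
  | add a b ha hb => simp only [map_add, ha, hb]

section Parts

variable {σ : V →ₗ[𝕜] V}

theorem evenPart_of_odd {v : V} (h : σ v = -v) : evenPart σ v = 0 := by
  simp [evenPart, h]

theorem oddPart_of_even {v : V} (h : σ v = v) : oddPart σ v = 0 := by
  simp [oddPart, h]

theorem apply_evenPart_self (hσ : ∀ x, σ (σ x) = x) (v : V) :
    σ (evenPart σ v) = evenPart σ v := by
  simp [evenPart, hσ, add_comm]

theorem apply_oddPart_self (hσ : ∀ x, σ (σ x) = x) (v : V) :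
    σ (oddPart σ v) = -oddPart σ v := by
  simp [oddPart, hσ, ← smul_neg]

variable [CharZero 𝕜]

theorem evenPart_add_oddPart (σ : V →ₗ[𝕜] V) (v : V) : evenPart σ v + oddPart σ v = v := by
  simp only [evenPart, oddPart, LinearMap.smul_apply, LinearMap.add_apply, LinearMap.sub_apply,
    LinearMap.id_apply, ← smul_add]
  rw [add_add_sub_cancel, ← two_smul 𝕜 v, smul_smul, inv_mul_cancel₀ two_ne_zero, one_smul]

theorem evenPart_of_even {v : V} (h : σ v = v) : evenPart σ v = v := by
  simp only [evenPart, LinearMap.smul_apply, LinearMap.add_apply, LinearMap.id_apply, h]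
  rw [← two_smul 𝕜 v, smul_smul, inv_mul_cancel₀ two_ne_zero, one_smul]

theorem oddPart_of_odd {v : V} (h : σ v = -v) : oddPart σ v = v := by
  have := evenPart_add_oddPart σ v
  rwa [evenPart_of_odd h, zero_add] at this

/-- In characteristic 0 an involution splits the space into its eigenspaces for 1 and -1. Identities
with Koszul signs are thereby reduced to case distinctions on parity, in which one of `evenPart` and
`oddPart` is zero and the other is the identity. -/
theorem linear_ext_parity (hσ : ∀ x, σ (σ x) = x) {f g : V →ₗ[𝕜] W}
    (h : ∀ v, σ v = v ∨ σ v = -v → f v = g v) : f = g := by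
  ext v
  rw [← evenPart_add_oddPart σ v, map_add, map_add, h _ (.inl (apply_evenPart_self hσ v)),
    h _ (.inr (apply_oddPart_self hσ v))]

end Parts

end Involution

/-! ### Finite-dimensional graded spaces and their duals. -/

section Finite

variable {𝕜 : Type*} [Field 𝕜] {V : Type*} [AddCommGroup V] [Module 𝕜 V]
  {W : Type*} [AddCommGroup W] [Module 𝕜 W]

/-- The projection of a graded vector space to its part of degree `n`. -/
noncomputable def proj (𝒱 : ℤ → Submodule 𝕜 V) [DirectSum.Decomposition 𝒱] (n : ℤ) :
    V →ₗ[𝕜] V :=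
  (𝒱 n).subtype ∘ₗ DirectSum.component 𝕜 ℤ (fun i => 𝒱 i) n ∘ₗ
    (DirectSum.decomposeLinearEquiv 𝒱).toLinearMap

theorem proj_apply (𝒱 : ℤ → Submodule 𝕜 V) [DirectSum.Decomposition 𝒱] (n : ℤ) (v : V) :
    proj 𝒱 n v = DirectSum.decompose 𝒱 v n := rfl

theorem proj_mem (𝒱 : ℤ → Submodule 𝕜 V) [DirectSum.Decomposition 𝒱] (n : ℤ) (v : V) :
    proj 𝒱 n v ∈ 𝒱 n := (DirectSum.decompose 𝒱 v n).2

theorem proj_of_mem (𝒱 : ℤ → Submodule 𝕜 V) [DirectSum.Decomposition 𝒱] {n : ℤ} {v : V}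
    (hv : v ∈ 𝒱 n) : proj 𝒱 n v = v := by
  rw [proj_apply, DirectSum.decompose_of_mem_same 𝒱 hv]

theorem proj_of_mem_ne (𝒱 : ℤ → Submodule 𝕜 V) [DirectSum.Decomposition 𝒱] {n m : ℤ} {v : V}
    (hv : v ∈ 𝒱 m) (h : m ≠ n) : proj 𝒱 n v = 0 := by
  rw [proj_apply, DirectSum.decompose_of_mem_ne 𝒱 hv h]

theorem proj_proj (𝒱 : ℤ → Submodule 𝕜 V) [DirectSum.Decomposition 𝒱] (n : ℤ) (v : V) :
    proj 𝒱 n (proj 𝒱 n v) = proj 𝒱 n v :=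
  proj_of_mem 𝒱 (proj_mem 𝒱 n v)

/-- A finite-dimensional graded vector space is concentrated in finitely many degrees. -/
theorem exists_sum_proj (𝒱 : ℤ → Submodule 𝕜 V) [DirectSum.Decomposition 𝒱]
    [FiniteDimensional 𝕜 V] : ∃ s : Finset ℤ, ∀ v, ∑ n ∈ s, proj 𝒱 n v = v := by
  classical
  let b := Module.finBasis 𝕜 V
  -- The degrees that occur in the components of a basis suffice for all vectors.
  let s : Finset ℤ := Finset.univ.biUnion fun i => (DirectSum.decompose 𝒱 (b i)).support
  refine ⟨s, fun v => ?_⟩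
  have : ∑ n ∈ s, proj 𝒱 n = LinearMap.id := by
    refine b.ext fun i => ?_
    rw [LinearMap.sum_apply, LinearMap.id_apply]
    conv_rhs => rw [← DirectSum.sum_support_decompose 𝒱 (b i)]
    symm
    refine Finset.sum_subset (Finset.subset_biUnion_of_mem
      (fun i => (DirectSum.decompose 𝒱 (b i)).support) (Finset.mem_univ i)) fun n _ hn => ?_
    simpa using hn
  simpa using DFunLike.congr_fun this v

theorem comp_proj_mem_dualGr (𝒱 : ℤ → Submodule 𝕜 V) [DirectSum.Decomposition 𝒱] (n : ℤ)
    (ξ : Module.Dual 𝕜 V) : ξ ∘ₗ proj 𝒱 n ∈ dualGr 𝒱 (-n) := by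
  intro m hm v hv
  rw [neg_neg] at hm
  rw [LinearMap.comp_apply, proj_of_mem_ne 𝒱 hv hm, map_zero]

/-- The dual comes without a chosen decomposition. As only finitely many degrees occur in V, a
functional ξ is the finite sum of the homogeneous functionals `ξ ∘ₗ proj 𝒱 n`. -/
theorem dual_linear_ext (𝒱 : ℤ → Submodule 𝕜 V) [DirectSum.Decomposition 𝒱]
    [FiniteDimensional 𝕜 V] {f g : Module.Dual 𝕜 V →ₗ[𝕜] W}
    (h : ∀ n, ∀ ξ ∈ dualGr 𝒱 n, f ξ = g ξ) : f = g := by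
  obtain ⟨s, hs⟩ := exists_sum_proj 𝒱
  ext ξ
  have : ξ = ∑ n ∈ s, ξ ∘ₗ proj 𝒱 n := by
    ext v
    rw [LinearMap.sum_apply]
    simp only [LinearMap.comp_apply, ← map_sum, hs]
  rw [this, map_sum, map_sum]
  exact Finset.sum_congr rfl fun n _ => h _ _ (comp_proj_mem_dualGr 𝒱 n ξ)

theorem graded_linear_ext (𝒱 : ℤ → Submodule 𝕜 V) [DirectSum.Decomposition 𝒱]
    {f g : V →ₗ[𝕜] W} (h : ∀ n, ∀ v ∈ 𝒱 n, f v = g v) : f = g := by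
  ext v
  induction v using DirectSum.Decomposition.inductionOn 𝒱 with
  | zero => simp
  | homogeneous m => exact h _ _ m.2
  | add a b ha hb => simp [ha, hb]

theorem sum_coord_smul [FiniteDimensional 𝕜 V] (ξ : Module.Dual 𝕜 V) :
    ∑ i, ξ (Module.finBasis 𝕜 V i) • (Module.finBasis 𝕜 V).coord i = ξ :=
  (Module.finBasis 𝕜 V).ext fun i => by
    simp

theorem sum_coord_apply [FiniteDimensional 𝕜 V] (f : V →ₗ[𝕜] W) (v : V) :
    ∑ i, (Module.finBasis 𝕜 V).coord i v • f (Module.finBasis 𝕜 V i) = f v := by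
  conv_rhs => rw [← (Module.finBasis 𝕜 V).sum_repr v, map_sum]
  simp

end Finite

end SHLie

namespace SHLie

/-! ### The graded symmetric algebra: Leibniz rule, graded commutativity, Euler formula, degrees. -/

section SymAlgebra

variable {𝕜 : Type*} [Field 𝕜] {V : Type*} [AddCommGroup V] [Module 𝕜 V]
  {W : Type*} [AddCommGroup W] [Module 𝕜 W] (𝒱 : ℤ → Submodule 𝕜 V)

theorem sym_linear_ext {f g : SymDual 𝒱 →ₗ[𝕜] W} (h1 : f 1 = g 1)
    (hm : ∀ ξ p, f p = g p → f (gen 𝒱 ξ * p) = g (gen 𝒱 ξ * p)) : f = g := by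
  -- Carrying an arbitrary right factor q on which f and g agree makes the product case of the
  -- induction a mere composition.
  suffices h : ∀ t : TensorAlgebra 𝕜 (Module.Dual 𝕜 V), ∀ q, f q = g q →
      f (symMk 𝒱 t * q) = g (symMk 𝒱 t * q) by
    ext p
    obtain ⟨t, rfl⟩ : ∃ t, symMk 𝒱 t = p := RingQuot.mkAlgHom_surjective 𝕜 (KoszulRel 𝒱) p
    simpa using h t 1 h1
  intro t
  induction t using TensorAlgebra.induction with
  | algebraMap r => intro q hq; simp [Algebra.algebraMap_eq_smul_one, hq]
  | ι ξ => intro q hq; exact hm ξ q hq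
  | mul a b ha hb => intro q hq; rw [map_mul (symMk 𝒱), mul_assoc]; exact ha _ (hb _ hq)
  | add a b ha hb => intro q hq; simp [add_mul, ha q hq, hb q hq]

section Parity

variable [DirectSum.Decomposition 𝒱]

theorem symParity_symParity (p : SymDual 𝒱) : symParity 𝒱 (symParity 𝒱 p) = p := by
  have : (symParity 𝒱).toLinearMap ∘ₗ (symParity 𝒱).toLinearMap = LinearMap.id := by
    refine sym_linear_ext 𝒱 (by simp) fun ξ p hp => ?_
    simp only [LinearMap.comp_apply, AlgHom.toLinearMap_apply, LinearMap.id_apply] at hp ⊢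
    rw [map_mul, map_mul, hp, symParity_gen, symParity_gen, dualParity_dualParity]
  exact DFunLike.congr_fun this p

theorem symContr_one (v : V) : symContr 𝒱 v 1 = 0 := by
  simpa using symContr_algebraMap 𝒱 v 1

/-- The contraction is built from the universal property for each vector separately, so its
linearity in the vector has to be checked on products of generators. -/
theorem symContr_add (v w : V) : symContr 𝒱 (v + w) = symContr 𝒱 v + symContr 𝒱 w := by
  refine sym_linear_ext 𝒱 (by simp [symContr_one]) fun ξ p hp => ?_
  rw [LinearMap.add_apply] at hp
  simp only [LinearMap.add_apply, symContr_gen_mul, hp, map_add, mul_add, add_smul]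
  abel

theorem symContr_smul (c : 𝕜) (v : V) : symContr 𝒱 (c • v) = c • symContr 𝒱 v := by
  refine sym_linear_ext 𝒱 (by simp [symContr_one]) fun ξ p hp => ?_
  rw [LinearMap.smul_apply] at hp
  simp only [LinearMap.smul_apply, symContr_gen_mul, hp, map_smul, smul_add, mul_smul_comm,
    smul_smul, smul_eq_mul]

theorem symParity_symContr (v : V) (p : SymDual 𝒱) :
    symParity 𝒱 (symContr 𝒱 v p) = symContr 𝒱 (parity 𝒱 v) (symParity 𝒱 p) := by
  have : (symParity 𝒱).toLinearMap ∘ₗ symContr 𝒱 v =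
      symContr 𝒱 (parity 𝒱 v) ∘ₗ (symParity 𝒱).toLinearMap := by
    refine sym_linear_ext 𝒱 (by simp [symContr_one]) fun ξ p hp => ?_
    simp only [LinearMap.comp_apply, AlgHom.toLinearMap_apply] at hp ⊢
    have h1 : dualParity 𝒱 ξ (evenPart (parity 𝒱) (parity 𝒱 v)) = ξ (evenPart (parity 𝒱) v) := by
      simp [evenPart, dualParity_apply, parity_parity, add_comm]
    have h2 : dualParity 𝒱 ξ (oddPart (parity 𝒱) (parity 𝒱 v)) = ξ (oddPart (parity 𝒱) v) := by
      simp [oddPart, dualParity_apply, parity_parity]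
    rw [map_mul (symParity 𝒱), symParity_gen, symContr_gen_mul, symContr_gen_mul, ← hp, h1, h2]
    simp [symParity_gen]
  exact DFunLike.congr_fun this p

/-- The contraction as a linear map of the vector. -/
noncomputable def symContrHom : V →ₗ[𝕜] SymDual 𝒱 →ₗ[𝕜] SymDual 𝒱 where
  toFun := symContr 𝒱
  map_add' := symContr_add 𝒱
  map_smul' := symContr_smul 𝒱

theorem symContr_zero : symContr 𝒱 (0 : V) = 0 := (symContrHom 𝒱).map_zero

theorem symContr_neg (v : V) : symContr 𝒱 (-v) = -symContr 𝒱 v := (symContrHom 𝒱).map_neg v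

variable [CharZero 𝕜]

/-- For v of definite parity only one of the first two terms survives, and induction on the
generators of p applies. The general rule follows because both sides are linear in v. -/
theorem symContr_mul_aux (v : V) (hv : parity 𝒱 v = v ∨ parity 𝒱 v = -v) (p q : SymDual 𝒱) :
    symContr 𝒱 v (p * q) = symContr 𝒱 (evenPart (parity 𝒱) v) p * q +
      symContr 𝒱 (oddPart (parity 𝒱) v) p * symParity 𝒱 q + p * symContr 𝒱 v q := by
  have : symContr 𝒱 v ∘ₗ LinearMap.mulRight 𝕜 q =
      LinearMap.mulRight 𝕜 q ∘ₗ symContr 𝒱 (evenPart (parity 𝒱) v) +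
      LinearMap.mulRight 𝕜 (symParity 𝒱 q) ∘ₗ symContr 𝒱 (oddPart (parity 𝒱) v) +
      LinearMap.mulRight 𝕜 (symContr 𝒱 v q) := by
    refine sym_linear_ext 𝒱 (by simp [symContr_one]) fun ξ p hp => ?_
    simp only [LinearMap.comp_apply, LinearMap.add_apply, LinearMap.mulRight_apply] at hp ⊢
    rcases hv with h | h
    · simp only [evenPart_of_even h, oddPart_of_even h, symContr_zero, symContr_gen_mul, LinearMap.zero_apply,
        zero_mul, add_zero, map_zero, zero_smul, mul_assoc] at hp ⊢
      rw [hp]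
      simp only [mul_add, add_mul, mul_assoc, smul_mul_assoc]
      abel
    · simp only [evenPart_of_odd h, oddPart_of_odd h, symContr_zero, symContr_gen_mul, LinearMap.zero_apply,
        zero_mul, zero_add, map_zero, zero_smul, mul_assoc] at hp ⊢
      rw [hp]
      simp only [mul_add, add_mul, mul_assoc, smul_mul_assoc, map_mul]
      abel
  exact DFunLike.congr_fun this p

/-- The Leibniz rule for the right contraction. -/
theorem symContr_mul (v : V) (p q : SymDual 𝒱) :
    symContr 𝒱 v (p * q) = symContr 𝒱 (evenPart (parity 𝒱) v) p * q +
      symContr 𝒱 (oddPart (parity 𝒱) v) p * symParity 𝒱 q + p * symContr 𝒱 v q := by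
  have : (symContrHom 𝒱).flip (p * q) =
      LinearMap.mulRight 𝕜 q ∘ₗ (symContrHom 𝒱).flip p ∘ₗ evenPart (parity 𝒱) +
      LinearMap.mulRight 𝕜 (symParity 𝒱 q) ∘ₗ (symContrHom 𝒱).flip p ∘ₗ oddPart (parity 𝒱) +
      LinearMap.mulLeft 𝕜 p ∘ₗ (symContrHom 𝒱).flip q :=
    linear_ext_parity (parity_parity 𝒱) fun v hv => symContr_mul_aux 𝒱 v hv p q
  exact DFunLike.congr_fun this v

/-- Contractions commute up to the Koszul sign. -/
theorem symContr_comm (u v : V) (hu : parity 𝒱 u = u ∨ parity 𝒱 u = -u)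
    (hv : parity 𝒱 v = v ∨ parity 𝒱 v = -v) (p : SymDual 𝒱) :
    symContr 𝒱 v (symContr 𝒱 u p) = symContr 𝒱 (evenPart (parity 𝒱) u) (symContr 𝒱 v p) +
      symContr 𝒱 (oddPart (parity 𝒱) u) (symContr 𝒱 (parity 𝒱 v) p) := by
  have : symContr 𝒱 v ∘ₗ symContr 𝒱 u = symContr 𝒱 (evenPart (parity 𝒱) u) ∘ₗ symContr 𝒱 v +
      symContr 𝒱 (oddPart (parity 𝒱) u) ∘ₗ symContr 𝒱 (parity 𝒱 v) := by
    refine sym_linear_ext 𝒱 (by simp [symContr_one]) fun ξ p hp => ?_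
    simp only [LinearMap.comp_apply, LinearMap.add_apply] at hp ⊢
    -- Contracting a product whose generator pairs with an odd vector produces `symParity` of the
    -- remaining factor; these facts move it past the second contraction.
    have hPu := symParity_symContr 𝒱 u p
    have hPv := symParity_symContr 𝒱 v p
    rcases hu with hu | hu <;> rcases hv with hv | hv <;>
    · simp only [evenPart_of_even, evenPart_of_odd, oddPart_of_even, oddPart_of_odd, hu, hv,
        symContr_gen_mul, symContr_zero, symContr_neg, LinearMap.zero_apply, LinearMap.neg_apply,
        zero_smul, smul_zero, add_zero, zero_add, neg_zero, map_add, map_smul, map_zero, map_neg]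
        at hp hPu hPv ⊢
      rw [hp]
      try simp only [hPu, hPv, mul_neg, smul_neg, neg_add]
      abel
  exact DFunLike.congr_fun this p

end Parity

section FiniteDim

variable [FiniteDimensional 𝕜 V]

/-- The index set of the sum depends neither on p nor on n. This uniformity allows the quotients in
all symmetric degrees to be assembled into formal series. -/
theorem exists_eq_sum_gen_mul (n : ℕ) (p : SymDual 𝒱) (hp : p ∈ symPow 𝒱 (n + 1)) :
    ∃ q : Fin (Module.finrank 𝕜 V) → SymDual 𝒱, (∀ i, q i ∈ symPow 𝒱 n) ∧
      p = ∑ i, gen 𝒱 ((Module.finBasis 𝕜 V).coord i) * q i := by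
  rw [symPow, pow_succ'] at hp
  induction hp using Submodule.mul_induction_on' with
  | mem_mul_mem a ha b hb =>
    obtain ⟨ξ, rfl⟩ := ha
    refine ⟨fun i => ξ (Module.finBasis 𝕜 V i) • b, fun i => Submodule.smul_mem _ _ hb, ?_⟩
    conv_lhs => rw [← sum_coord_smul ξ, map_sum, Finset.sum_mul]
    simp
  | add a _ b _ ha hb =>
    obtain ⟨q, hq, rfl⟩ := ha
    obtain ⟨r, hr, rfl⟩ := hb
    exact ⟨fun i => q i + r i, fun i => Submodule.add_mem _ (hq i) (hr i), by
      simp [mul_add, Finset.sum_add_distrib]⟩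

variable [DirectSum.Decomposition 𝒱] [CharZero 𝕜]

theorem gen_mul_gen_of_even {ξ : Module.Dual 𝕜 V} (hξ : dualParity 𝒱 ξ = ξ)
    (η : Module.Dual 𝕜 V) : gen 𝒱 ξ * gen 𝒱 η = gen 𝒱 η * gen 𝒱 ξ := by
  -- Inserting `evenPart` turns the hypothesis on ξ into an identity of bilinear maps, which can be
  -- tested on homogeneous functionals, where the defining relation applies.
  have : ((LinearMap.mul 𝕜 (SymDual 𝒱)).compl₁₂ (gen 𝒱 ∘ₗ evenPart (dualParity 𝒱)) (gen 𝒱)) =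
      (LinearMap.mul 𝕜 (SymDual 𝒱)).flip.compl₁₂ (gen 𝒱 ∘ₗ evenPart (dualParity 𝒱)) (gen 𝒱) := by
    refine dual_linear_ext 𝒱 fun i ξ hξ => dual_linear_ext 𝒱 fun j η hη => ?_
    simp only [LinearMap.compl₁₂_apply, LinearMap.comp_apply, LinearMap.mul_apply',
      LinearMap.flip_apply]
    have h := dualParity_of_mem 𝒱 hξ
    rcases Int.even_or_odd i with hi | hi
    · rw [Int.negOnePow_even _ hi, one_smul] at h
      rw [evenPart_of_even h, gen_swap 𝒱 hξ hη, Int.negOnePow_even _ (hi.mul_right j), one_smul]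
    · rw [Int.negOnePow_odd _ hi, Units.neg_smul, one_smul] at h
      simp [evenPart_of_odd h]
  have h := DFunLike.congr_fun (DFunLike.congr_fun this ξ) η
  simpa [evenPart_of_even hξ] using h

theorem gen_mul_gen_of_odd {ξ : Module.Dual 𝕜 V} (hξ : dualParity 𝒱 ξ = -ξ)
    (η : Module.Dual 𝕜 V) : gen 𝒱 ξ * gen 𝒱 η = gen 𝒱 (dualParity 𝒱 η) * gen 𝒱 ξ := by
  have : ((LinearMap.mul 𝕜 (SymDual 𝒱)).compl₁₂ (gen 𝒱 ∘ₗ oddPart (dualParity 𝒱)) (gen 𝒱)) =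
      (LinearMap.mul 𝕜 (SymDual 𝒱)).flip.compl₁₂ (gen 𝒱 ∘ₗ oddPart (dualParity 𝒱))
        (gen 𝒱 ∘ₗ dualParity 𝒱) := by
    refine dual_linear_ext 𝒱 fun i ξ hξ => dual_linear_ext 𝒱 fun j η hη => ?_
    simp only [LinearMap.compl₁₂_apply, LinearMap.comp_apply, LinearMap.mul_apply',
      LinearMap.flip_apply]
    have h := dualParity_of_mem 𝒱 hξ
    rcases Int.even_or_odd i with hi | hi
    · rw [Int.negOnePow_even _ hi, one_smul] at h
      simp [oddPart_of_even h]
    · rw [Int.negOnePow_odd _ hi, Units.neg_smul, one_smul] at h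
      rw [oddPart_of_odd h, gen_swap 𝒱 hξ hη, dualParity_of_mem 𝒱 hη]
      have : (i * j).negOnePow = j.negOnePow := by
        rw [Int.negOnePow_eq_iff]
        obtain ⟨k, rfl⟩ := hi
        exact ⟨k * j, by ring⟩
      rw [this]
      simp only [Units.smul_def, map_zsmul, smul_mul_assoc]
  have h := DFunLike.congr_fun (DFunLike.congr_fun this ξ) η
  simpa [oddPart_of_odd hξ] using h

theorem gen_mul_of_even {ξ : Module.Dual 𝕜 V} (hξ : dualParity 𝒱 ξ = ξ) (q : SymDual 𝒱) :
    gen 𝒱 ξ * q = q * gen 𝒱 ξ := by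
  have : LinearMap.mulLeft 𝕜 (gen 𝒱 ξ) = LinearMap.mulRight 𝕜 (gen 𝒱 ξ) := by
    refine sym_linear_ext 𝒱 (by simp) fun η q hq => ?_
    simp only [LinearMap.mulLeft_apply, LinearMap.mulRight_apply] at hq ⊢
    rw [← mul_assoc, gen_mul_gen_of_even 𝒱 hξ, mul_assoc, hq, mul_assoc]
  exact DFunLike.congr_fun this q

theorem gen_mul_of_odd {ξ : Module.Dual 𝕜 V} (hξ : dualParity 𝒱 ξ = -ξ) (q : SymDual 𝒱) :
    gen 𝒱 ξ * q = symParity 𝒱 q * gen 𝒱 ξ := by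
  have : LinearMap.mulLeft 𝕜 (gen 𝒱 ξ) =
      LinearMap.mulRight 𝕜 (gen 𝒱 ξ) ∘ₗ (symParity 𝒱).toLinearMap := by
    refine sym_linear_ext 𝒱 (by simp) fun η q hq => ?_
    simp only [LinearMap.mulLeft_apply, LinearMap.comp_apply, AlgHom.toLinearMap_apply,
      LinearMap.mulRight_apply] at hq ⊢
    rw [← mul_assoc, gen_mul_gen_of_odd 𝒱 hξ, mul_assoc, hq, map_mul, symParity_gen, mul_assoc]
  exact DFunLike.congr_fun this q

theorem gen_mul (ξ : Module.Dual 𝕜 V) (q : SymDual 𝒱) :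
    gen 𝒱 ξ * q = q * gen 𝒱 (evenPart (dualParity 𝒱) ξ) +
      symParity 𝒱 q * gen 𝒱 (oddPart (dualParity 𝒱) ξ) := by
  conv_lhs => rw [← evenPart_add_oddPart (dualParity 𝒱) ξ, map_add, add_mul]
  rw [gen_mul_of_even 𝒱 (apply_evenPart_self (dualParity_dualParity 𝒱) ξ),
    gen_mul_of_odd 𝒱 (apply_oddPart_self (dualParity_dualParity 𝒱) ξ)]

/-- The graded commutativity of `S(V^∨)`. -/
theorem sym_mul_comm (p q : SymDual 𝒱) :
    p * q = q * evenPart (symParity 𝒱).toLinearMap p +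
      symParity 𝒱 q * oddPart (symParity 𝒱).toLinearMap p := by
  set P := (symParity 𝒱).toLinearMap with hP
  have hPm : ∀ a b, P (a * b) = P a * P b := fun a b => map_mul (symParity 𝒱) a b
  have hPg : ∀ ξ, P (gen 𝒱 ξ) = gen 𝒱 (dualParity 𝒱 ξ) := symParity_gen 𝒱
  have : LinearMap.mulRight 𝕜 q = LinearMap.mulLeft 𝕜 q ∘ₗ evenPart P +
      LinearMap.mulLeft 𝕜 (symParity 𝒱 q) ∘ₗ oddPart P := by
    refine sym_linear_ext 𝒱 ?_ fun ξ p hp => ?_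
    · have h1 : P 1 = 1 := map_one (symParity 𝒱)
      simp [evenPart_of_even h1, oddPart_of_even h1]
    · simp only [LinearMap.mulRight_apply, LinearMap.add_apply, LinearMap.comp_apply,
        LinearMap.mulLeft_apply] at hp ⊢
      -- With p fixed, the inductive step is linear in ξ, so ξ may be taken even or odd. An odd ξ
      -- exchanges the even and odd parts of the product.
      have hl : LinearMap.mulRight 𝕜 q ∘ₗ LinearMap.mulRight 𝕜 p ∘ₗ gen 𝒱 =
          (LinearMap.mulLeft 𝕜 q ∘ₗ evenPart P +
          LinearMap.mulLeft 𝕜 (symParity 𝒱 q) ∘ₗ oddPart P) ∘ₗ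
            LinearMap.mulRight 𝕜 p ∘ₗ gen 𝒱 := by
        refine linear_ext_parity (dualParity_dualParity 𝒱) fun ξ hξ => ?_
        simp only [LinearMap.mulRight_apply, LinearMap.add_apply, LinearMap.comp_apply,
          LinearMap.mulLeft_apply]
        rcases hξ with h | h
        · have e1 : evenPart P (gen 𝒱 ξ * p) = gen 𝒱 ξ * evenPart P p := by
            simp [evenPart, hPm, hPg, h, mul_add]
          have e2 : oddPart P (gen 𝒱 ξ * p) = gen 𝒱 ξ * oddPart P p := by
            simp [oddPart, hPm, hPg, h, mul_sub]
          rw [e1, e2, mul_assoc, hp, mul_add, ← mul_assoc, ← mul_assoc,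
            gen_mul_of_even 𝒱 h, gen_mul_of_even 𝒱 h, mul_assoc, mul_assoc]
        · have e1 : evenPart P (gen 𝒱 ξ * p) = gen 𝒱 ξ * oddPart P p := by
            simp [evenPart, oddPart, hPm, hPg, h, mul_add, sub_eq_add_neg]
          have e2 : oddPart P (gen 𝒱 ξ * p) = gen 𝒱 ξ * evenPart P p := by
            simp [evenPart, oddPart, hPm, hPg, h, mul_add]
          rw [e1, e2, mul_assoc, hp, mul_add, ← mul_assoc, ← mul_assoc,
            gen_mul_of_odd 𝒱 h, gen_mul_of_odd 𝒱 h, mul_assoc, mul_assoc, symParity_symParity,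
            add_comm]
      exact DFunLike.congr_fun hl ξ
  exact DFunLike.congr_fun this p

/-- The Euler formula. -/
theorem sum_symContr_mul_gen (n : ℕ) (p : SymDual 𝒱) (hp : p ∈ symPow 𝒱 n) :
    ∑ i, symContr 𝒱 (Module.finBasis 𝕜 V i) p * gen 𝒱 ((Module.finBasis 𝕜 V).coord i) =
      (n : 𝕜) • p := by
  induction n generalizing p with
  | zero =>
    simp only [symPow, pow_zero, Submodule.mem_one] at hp
    obtain ⟨c, rfl⟩ := hp
    simp [symContr_algebraMap]
  | succ n ih =>
    rw [symPow, pow_succ'] at hp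
    induction hp using Submodule.mul_induction_on' with
    | mem_mul_mem a ha b hb =>
      obtain ⟨ξ, rfl⟩ := ha
      simp only [symContr_gen_mul, add_mul, Finset.sum_add_distrib, mul_assoc, ← Finset.mul_sum,
        ih b hb, smul_mul_assoc]
      simp only [← mul_smul_comm _ (symParity 𝒱 b), ← mul_smul_comm _ b, ← map_smul (gen 𝒱)]
      have h1 : ∑ i, ξ (evenPart (parity 𝒱) (Module.finBasis 𝕜 V i)) •
          (Module.finBasis 𝕜 V).coord i = evenPart (dualParity 𝒱) ξ := by
        rw [← sum_coord_smul (evenPart (dualParity 𝒱) ξ)]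
        simp [evenPart, dualParity_apply]
      have h2 : ∑ i, ξ (oddPart (parity 𝒱) (Module.finBasis 𝕜 V i)) •
          (Module.finBasis 𝕜 V).coord i = oddPart (dualParity 𝒱) ξ := by
        rw [← sum_coord_smul (oddPart (dualParity 𝒱) ξ)]
        simp [oddPart, dualParity_apply]
      -- The terms in which the contraction hits ξ reassemble, after moving the generator back to
      -- the left, into one more copy of the product: this is the 1 in n + 1.
      rw [← Finset.mul_sum, ← Finset.mul_sum, ← map_sum, ← map_sum, h1, h2, ← gen_mul,
        mul_smul_comm]
      push_cast
      rw [add_smul, one_smul]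
    | add a _ b _ ha hb =>
      simp only [map_add, add_mul, Finset.sum_add_distrib, ha, hb, smul_add]

end FiniteDim

section Degree

theorem gen_mul_mem_symPowGr {n : ℕ} {i d : ℤ} {ξ : Module.Dual 𝕜 V} (hξ : ξ ∈ dualGr 𝒱 i)
    {p : SymDual 𝒱} (hp : p ∈ symPowGr 𝒱 n d) :
    gen 𝒱 ξ * p ∈ symPowGr 𝒱 (n + 1) (i + d) := by
  induction hp using Submodule.span_induction with
  | mem p hp => exact Submodule.subset_span (.mul hξ hp)
  | zero => simp
  | add a b _ _ ha hb => rw [mul_add]; exact Submodule.add_mem _ ha hb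
  | smul c a _ ha => rw [mul_smul_comm]; exact Submodule.smul_mem _ _ ha

theorem mul_mem_symPowGr {n m : ℕ} {d e : ℤ} {p q : SymDual 𝒱} (hp : p ∈ symPowGr 𝒱 n d)
    (hq : q ∈ symPowGr 𝒱 m e) : p * q ∈ symPowGr 𝒱 (n + m) (d + e) := by
  induction hp using Submodule.span_induction with
  | mem p hp =>
    induction hp with
    | one => simpa using hq
    | @mul n i d ξ p hξ hp ih =>
      rw [mul_assoc, add_assoc i, Nat.add_right_comm]
      exact gen_mul_mem_symPowGr 𝒱 hξ ih
  | zero => simp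
  | add a b _ _ ha hb => rw [add_mul]; exact Submodule.add_mem _ ha hb
  | smul c a _ ha => rw [smul_mul_assoc]; exact Submodule.smul_mem _ _ ha

theorem gen_mem_symPowGr {d : ℤ} {ξ : Module.Dual 𝕜 V} (hξ : ξ ∈ dualGr 𝒱 d) :
    gen 𝒱 ξ ∈ symPowGr 𝒱 1 d := by
  have := IsMonomial.mul hξ (IsMonomial.one (𝒱 := 𝒱))
  rw [mul_one, add_zero] at this
  exact Submodule.subset_span this

theorem algHom_mem_symPowGr (𝒲 : ℤ → Submodule 𝕜 W) (f : SymDual 𝒱 →ₐ[𝕜] SymDual 𝒲)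
    (hf : ∀ i, ∀ ξ ∈ dualGr 𝒱 i, ∃ η ∈ dualGr 𝒲 i, f (gen 𝒱 ξ) = gen 𝒲 η) {n : ℕ} {d : ℤ}
    {p : SymDual 𝒱} (hp : p ∈ symPowGr 𝒱 n d) : f p ∈ symPowGr 𝒲 n d := by
  induction hp using Submodule.span_induction with
  | mem p hp =>
    induction hp with
    | one => rw [map_one]; exact Submodule.subset_span .one
    | mul hξ hp ih =>
      obtain ⟨η, hη, h⟩ := hf _ _ hξ
      rw [map_mul, h]
      exact gen_mul_mem_symPowGr 𝒲 hη ih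
  | zero => simp
  | add a b _ _ ha hb => rw [map_add]; exact Submodule.add_mem _ ha hb
  | smul c a _ ha => rw [map_smul]; exact Submodule.smul_mem _ _ ha

theorem symParity_of_mem [DirectSum.Decomposition 𝒱] {n : ℕ} {d : ℤ} {p : SymDual 𝒱}
    (hp : p ∈ symPowGr 𝒱 n d) : symParity 𝒱 p = d.negOnePow • p := by
  induction hp using Submodule.span_induction with
  | mem p hp =>
    induction hp with
    | one => simp
    | mul hξ hp ih =>
      rw [map_mul, ih, symParity_gen, dualParity_of_mem 𝒱 hξ, Int.negOnePow_add]
      simp only [Units.smul_def, map_zsmul, smul_mul_assoc, mul_smul_comm, smul_smul,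
        Units.val_mul]
      rw [mul_comm (Units.val _)]
  | zero => simp
  | add a b _ _ ha hb => rw [map_add, ha, hb, smul_add]
  | smul c a _ ha => rw [map_smul, ha, smul_comm]

theorem symContr_mem_symPowGr [DirectSum.Decomposition 𝒱] [CharZero 𝕜] {m : ℤ} {v : V}
    (hv : v ∈ 𝒱 m) {n : ℕ} {d : ℤ} {p : SymDual 𝒱} (hp : p ∈ symPowGr 𝒱 (n + 1) d) :
    symContr 𝒱 v p ∈ symPowGr 𝒱 n (d + m) := by
  -- The length is a variable k with a separate equation, as the induction on monomials passes
  -- through every length, including 0.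
  have key : ∀ (k : ℕ) (d : ℤ) (p : SymDual 𝒱), IsMonomial 𝒱 k d p →
      ∀ n, k = n + 1 → symContr 𝒱 v p ∈ symPowGr 𝒱 n (d + m) := by
    intro k d p hp
    induction hp with
    | one => intro n h; omega
    | @mul k i d ξ p hξ hp ih =>
      intro n hn
      obtain rfl : k = n := by omega
      rw [symContr_gen_mul]
      refine Submodule.add_mem _ ?_ ?_
      · cases k with
        | zero =>
          cases hp
          simp [symContr_one]
        | succ k =>
          rw [add_assoc]
          exact gen_mul_mem_symPowGr 𝒱 hξ (ih k rfl)
      · by_cases hm : m = -i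
        · have hd : i + d + m = d := by omega
          rw [hd]
          have hp' : p ∈ symPowGr 𝒱 k d := Submodule.subset_span hp
          refine Submodule.add_mem _ (Submodule.smul_mem _ _ hp') (Submodule.smul_mem _ _ ?_)
          rw [symParity_of_mem 𝒱 hp', Units.smul_def]
          exact zsmul_mem hp' _
        · have h0 : ξ v = 0 := hξ m hm v hv
          have h1 : ξ (parity 𝒱 v) = 0 := by
            rw [parity_of_mem 𝒱 hv, Units.smul_def, map_zsmul, h0, smul_zero]
          simp [evenPart, oddPart, h0, h1]
  induction hp using Submodule.span_induction with
  | mem p hp => exact key _ _ _ hp _ rfl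
  | zero => simp
  | add a b _ _ ha hb => rw [map_add]; exact Submodule.add_mem _ ha hb
  | smul c a _ ha => rw [map_smul]; exact Submodule.smul_mem _ _ ha

end Degree

end SymAlgebra

end SHLie

namespace SHLie

/-! ### Formal power series: contraction, pullback and derivations. -/

section SeriesAlgebra

variable {𝕜 : Type*} [Field 𝕜] {V : Type*} [AddCommGroup V] [Module 𝕜 V]
  {W : Type*} [AddCommGroup W] [Module 𝕜 W] (𝒱 : ℤ → Submodule 𝕜 V) (𝒲 : ℤ → Submodule 𝕜 W)

theorem coeff_mul (n : ℕ) (f g : Series 𝒱) :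
    coeff 𝒱 n (f * g) = ∑ p ∈ Finset.HasAntidiagonal.antidiagonal n, coeff 𝒱 p.1 f * coeff 𝒱 p.2 g :=
  PowerSeries.coeff_mul n f.1 g.1

theorem coeff_zero_one : coeff 𝒱 0 1 = 1 := PowerSeries.coeff_zero_one

theorem coeff_succ_one (n : ℕ) : coeff 𝒱 (n + 1) 1 = 0 :=
  (PowerSeries.coeff_one (n + 1)).trans (if_neg n.succ_ne_zero)

theorem coeff_seriesMap (f : SymDual 𝒱 →ₐ[𝕜] SymDual 𝒲)
    (hf : ∀ ξ, f (gen 𝒱 ξ) ∈ LinearMap.range (gen 𝒲)) (n : ℕ) (ω : Series 𝒱) :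
    coeff 𝒲 n (seriesMap 𝒱 𝒲 f hf ω) = f (coeff 𝒱 n ω) := by
  change PowerSeries.coeff n (PowerSeries.mapAlgHom f ω.1) = f (PowerSeries.coeff n ω.1)
  rw [PowerSeries.mapAlgHom_apply, PowerSeries.coeff_map]; rfl

theorem coeff_seriesGen (ξ : Module.Dual 𝕜 V) (n : ℕ) :
    coeff 𝒱 n (seriesGen 𝒱 ξ) = if n = 1 then gen 𝒱 ξ else 0 :=
  PowerSeries.coeff_mk n fun n => if n = 1 then gen 𝒱 ξ else 0

theorem coeff_zero_seriesGen_mul (ξ : Module.Dual 𝕜 V) (ω : Series 𝒱) :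
    coeff 𝒱 0 (seriesGen 𝒱 ξ * ω) = 0 := by
  rw [coeff_mul]
  simp [coeff_seriesGen]

theorem coeff_succ_seriesGen_mul (ξ : Module.Dual 𝕜 V) (ω : Series 𝒱) (n : ℕ) :
    coeff 𝒱 (n + 1) (seriesGen 𝒱 ξ * ω) = gen 𝒱 ξ * coeff 𝒱 n ω := by
  rw [coeff_mul, Finset.sum_eq_single (1, n)]
  · simp [coeff_seriesGen]
  · rintro ⟨a, b⟩ hab hne
    have : a ≠ 1 := by
      rintro rfl
      apply hne
      rw [Finset.HasAntidiagonal.mem_antidiagonal] at hab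
      have : b = n := by simp only at hab; omega
      rw [this]
    simp [coeff_seriesGen, this]
  · intro h
    exact absurd (Finset.HasAntidiagonal.mem_antidiagonal.2 (add_comm 1 n)) h

theorem coeff_zero_eq_algebraMap (ω : Series 𝒱) : ∃ c : 𝕜, coeff 𝒱 0 ω = c • 1 := by
  have h := coeff_mem 𝒱 0 ω
  rw [symPow, pow_zero, Submodule.mem_one] at h
  obtain ⟨c, hc⟩ := h
  exact ⟨c, by rw [← hc, Algebra.algebraMap_eq_smul_one]⟩

/-- A formal series is the sum of a constant and of multiples of the coordinates. -/
theorem exists_eq_const_add_sum_gen_mul [FiniteDimensional 𝕜 V] (ω : Series 𝒱) :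
    ∃ (c : 𝕜) (ω' : Fin (Module.finrank 𝕜 V) → Series 𝒱),
      ω = c • 1 + ∑ i, seriesGen 𝒱 ((Module.finBasis 𝕜 V).coord i) * ω' i := by
  obtain ⟨c, hc⟩ := coeff_zero_eq_algebraMap 𝒱 ω
  choose q hq hω using fun n => exists_eq_sum_gen_mul 𝒱 n _ (coeff_mem 𝒱 (n + 1) ω)
  refine ⟨c, fun i => mkSeries 𝒱 (fun n => q n i) fun n => hq n i, series_ext fun n => ?_⟩
  cases n with
  | zero =>
    rw [map_add, map_smul, map_sum, coeff_zero_one, hc,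
      Finset.sum_eq_zero fun i _ => coeff_zero_seriesGen_mul 𝒱 _ _, add_zero]
  | succ n =>
    rw [map_add, map_smul, map_sum, coeff_succ_one, smul_zero, zero_add]
    simp only [coeff_succ_seriesGen_mul, coeff_mkSeries]
    exact hω n

/-- A linear operator on formal series that vanishes on `1` and commutes with the multiplication
by coordinates up to operators which raise a separated filtration vanishes. -/
theorem eq_zero_of_gen_mul [FiniteDimensional 𝕜 V] {M : Type*} [AddCommGroup M] [Module 𝕜 M]
    {N : ℕ → Type*} [∀ n, AddCommGroup (N n)] [∀ n, Module 𝕜 (N n)] (c : ∀ n, M →ₗ[𝕜] N n)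
    (hc : ∀ x, (∀ n, c n x = 0) → x = 0) (T : Module.Dual 𝕜 V → M → M)
    (hT0 : ∀ ξ x, c 0 (T ξ x) = 0) (hTs : ∀ n ξ x, c n x = 0 → c (n + 1) (T ξ x) = 0)
    (Δ : Series 𝒱 →ₗ[𝕜] M) (h1 : Δ 1 = 0)
    (hm : ∀ ξ ω, Δ (seriesGen 𝒱 ξ * ω) = T ξ (Δ ω)) : Δ = 0 := by
  -- No continuity of Δ is needed. Every series is a constant plus a finite combination of
  -- coordinates with series coefficients, and the operators T raise the order by one, so the
  -- component of order n + 1 of Δ is controlled by that of order n for all series at once.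
  have key : ∀ n ω, c n (Δ ω) = 0 := by
    intro n
    induction n with
    | zero =>
      intro ω
      obtain ⟨r, ω', rfl⟩ := exists_eq_const_add_sum_gen_mul 𝒱 ω
      simp [h1, hm, hT0]
    | succ n ih =>
      intro ω
      obtain ⟨r, ω', rfl⟩ := exists_eq_const_add_sum_gen_mul 𝒱 ω
      simp [h1, hm, hTs n _ _ (ih _)]
  exact LinearMap.ext fun ω => hc _ fun n => key n ω

theorem mem_seriesGr {d : ℤ} {ω : Series 𝒱} :
    ω ∈ seriesGr 𝒱 d ↔ ∀ n, coeff 𝒱 n ω ∈ symPowGr 𝒱 n d := by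
  simp [seriesGr]

theorem mul_mem_seriesGr {d e : ℤ} {ω η : Series 𝒱} (hω : ω ∈ seriesGr 𝒱 d)
    (hη : η ∈ seriesGr 𝒱 e) : ω * η ∈ seriesGr 𝒱 (d + e) := by
  rw [mem_seriesGr] at *
  intro n
  rw [coeff_mul]
  refine Submodule.sum_mem _ fun p hp => ?_
  rw [← Finset.HasAntidiagonal.mem_antidiagonal.1 hp]
  exact mul_mem_symPowGr 𝒱 (hω _) (hη _)

theorem seriesGen_mem_seriesGr {d : ℤ} {ξ : Module.Dual 𝕜 V} (hξ : ξ ∈ dualGr 𝒱 d) :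
    seriesGen 𝒱 ξ ∈ seriesGr 𝒱 d := by
  rw [mem_seriesGr]
  intro n
  rw [coeff_seriesGen]
  split_ifs with h
  · subst h; exact gen_mem_symPowGr 𝒱 hξ
  · exact Submodule.zero_mem _

theorem one_mem_seriesGr : (1 : Series 𝒱) ∈ seriesGr 𝒱 0 := by
  rw [mem_seriesGr]
  rintro (_ | n)
  · rw [coeff_zero_one]; exact Submodule.subset_span .one
  · rw [coeff_succ_one]; exact Submodule.zero_mem _

theorem seriesMap_mem_seriesGr (f : SymDual 𝒱 →ₐ[𝕜] SymDual 𝒲)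
    (hf : ∀ ξ, f (gen 𝒱 ξ) ∈ LinearMap.range (gen 𝒲))
    (hd : ∀ i, ∀ ξ ∈ dualGr 𝒱 i, ∃ η ∈ dualGr 𝒲 i, f (gen 𝒱 ξ) = gen 𝒲 η)
    {d : ℤ} {ω : Series 𝒱} (hω : ω ∈ seriesGr 𝒱 d) :
    seriesMap 𝒱 𝒲 f hf ω ∈ seriesGr 𝒲 d := by
  rw [mem_seriesGr] at *
  intro n
  rw [coeff_seriesMap]
  exact algHom_mem_symPowGr 𝒱 𝒲 f hd (hω n)

section Parity

variable [DirectSum.Decomposition 𝒱]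

theorem coeff_seriesParity (n : ℕ) (ω : Series 𝒱) :
    coeff 𝒱 n (seriesParity 𝒱 ω) = symParity 𝒱 (coeff 𝒱 n ω) :=
  coeff_seriesMap 𝒱 𝒱 _ _ n ω

theorem coeff_seriesContr (v : V) (n : ℕ) (ω : Series 𝒱) :
    coeff 𝒱 n (seriesContr 𝒱 v ω) = symContr 𝒱 v (coeff 𝒱 (n + 1) ω) :=
  PowerSeries.coeff_mk n fun n => symContr 𝒱 v (coeff 𝒱 (n + 1) ω)

theorem seriesParity_seriesParity (ω : Series 𝒱) :
    seriesParity 𝒱 (seriesParity 𝒱 ω) = ω :=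
  series_ext fun n => by rw [coeff_seriesParity, coeff_seriesParity, symParity_symParity]

theorem seriesParity_seriesGen (ξ : Module.Dual 𝕜 V) :
    seriesParity 𝒱 (seriesGen 𝒱 ξ) = seriesGen 𝒱 (dualParity 𝒱 ξ) :=
  series_ext fun n => by
    rw [coeff_seriesParity, coeff_seriesGen, coeff_seriesGen]
    split_ifs
    · exact symParity_gen 𝒱 ξ
    · exact map_zero _

theorem seriesParity_of_mem {d : ℤ} {ω : Series 𝒱} (hω : ω ∈ seriesGr 𝒱 d) :
    seriesParity 𝒱 ω = d.negOnePow • ω :=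
  series_ext fun n => by
    rw [coeff_seriesParity, symParity_of_mem 𝒱 ((mem_seriesGr 𝒱).1 hω n), Units.smul_def,
      Units.smul_def, map_zsmul]

theorem seriesParity_mem {d : ℤ} {ω : Series 𝒱} (hω : ω ∈ seriesGr 𝒱 d) :
    seriesParity 𝒱 ω ∈ seriesGr 𝒱 d := by
  rw [seriesParity_of_mem 𝒱 hω, Units.smul_def]
  exact zsmul_mem hω _

theorem seriesContr_add (v w : V) :
    seriesContr 𝒱 (v + w) = seriesContr 𝒱 v + seriesContr 𝒱 w :=
  LinearMap.ext fun ω => series_ext fun n => by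
    rw [LinearMap.add_apply, map_add, coeff_seriesContr, coeff_seriesContr, coeff_seriesContr,
      symContr_add, LinearMap.add_apply]

theorem seriesContr_smul (c : 𝕜) (v : V) : seriesContr 𝒱 (c • v) = c • seriesContr 𝒱 v :=
  LinearMap.ext fun ω => series_ext fun n => by
    rw [LinearMap.smul_apply, map_smul, coeff_seriesContr, coeff_seriesContr, symContr_smul,
      LinearMap.smul_apply]

/-- The contraction as a linear map of the vector. -/
noncomputable def seriesContrHom : V →ₗ[𝕜] Series 𝒱 →ₗ[𝕜] Series 𝒱 where
  toFun := seriesContr 𝒱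
  map_add' := seriesContr_add 𝒱
  map_smul' := seriesContr_smul 𝒱

theorem seriesContrHom_apply (v : V) : seriesContrHom 𝒱 v = seriesContr 𝒱 v := rfl

theorem seriesContr_zero : seriesContr 𝒱 (0 : V) = 0 := (seriesContrHom 𝒱).map_zero

theorem seriesContr_neg (v : V) : seriesContr 𝒱 (-v) = -seriesContr 𝒱 v :=
  (seriesContrHom 𝒱).map_neg v

theorem seriesParity_seriesContr (v : V) (ω : Series 𝒱) :
    seriesParity 𝒱 (seriesContr 𝒱 v ω) = seriesContr 𝒱 (parity 𝒱 v) (seriesParity 𝒱 ω) :=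
  series_ext fun n => by
    rw [coeff_seriesParity, coeff_seriesContr, coeff_seriesContr, coeff_seriesParity,
      symParity_symContr]

theorem seriesContr_one (v : V) : seriesContr 𝒱 v 1 = 0 :=
  series_ext fun n => by rw [coeff_seriesContr, coeff_succ_one, map_zero, map_zero]

theorem seriesContr_seriesGen [CharZero 𝕜] (v : V) (ξ : Module.Dual 𝕜 V) :
    seriesContr 𝒱 v (seriesGen 𝒱 ξ) = ξ v • 1 :=
  series_ext fun n => by
    rw [coeff_seriesContr, coeff_seriesGen, map_smul]
    rcases n with _ | n
    · have := symContr_gen_mul 𝒱 v ξ 1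
      rw [symContr_one, mul_zero, zero_add, mul_one, map_one, ← add_smul, ← map_add,
        evenPart_add_oddPart] at this
      simpa [coeff_zero_one] using this
    · simp [coeff_succ_one]

theorem seriesContr_mem {m : ℤ} {v : V} [CharZero 𝕜] (hv : v ∈ 𝒱 m) {d : ℤ} {ω : Series 𝒱}
    (hω : ω ∈ seriesGr 𝒱 d) : seriesContr 𝒱 v ω ∈ seriesGr 𝒱 (d + m) := by
  rw [mem_seriesGr] at *
  intro n
  rw [coeff_seriesContr]
  exact symContr_mem_symPowGr 𝒱 hv (hω _)

theorem seriesContr_comm [CharZero 𝕜] (u v : V) (hu : parity 𝒱 u = u ∨ parity 𝒱 u = -u)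
    (hv : parity 𝒱 v = v ∨ parity 𝒱 v = -v) (ω : Series 𝒱) :
    seriesContr 𝒱 v (seriesContr 𝒱 u ω) =
      seriesContr 𝒱 (evenPart (parity 𝒱) u) (seriesContr 𝒱 v ω) +
      seriesContr 𝒱 (oddPart (parity 𝒱) u) (seriesContr 𝒱 (parity 𝒱 v) ω) :=
  series_ext fun n => by
    simp only [map_add, coeff_seriesContr]
    exact symContr_comm 𝒱 u v hu hv _

/-- The Leibniz rule for the right contraction. -/
theorem seriesContr_mul [CharZero 𝕜] (v : V) (ω η : Series 𝒱) :
    seriesContr 𝒱 v (ω * η) = seriesContr 𝒱 (evenPart (parity 𝒱) v) ω * η +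
      seriesContr 𝒱 (oddPart (parity 𝒱) v) ω * seriesParity 𝒱 η + ω * seriesContr 𝒱 v η := by
  refine series_ext fun n => ?_
  -- Component n of a contraction comes from component n + 1, so the antidiagonal of n + 1 has one
  -- pair more than that of n. In the extra pair a constant is contracted.
  have h0 : ∀ (v : V) (ω : Series 𝒱), symContr 𝒱 v (coeff 𝒱 0 ω) = 0 := by
    intro v ω
    obtain ⟨c, hc⟩ := coeff_zero_eq_algebraMap 𝒱 ω
    rw [hc, map_smul, symContr_one, smul_zero]
  simp only [map_add, coeff_seriesContr, coeff_mul, map_sum, symContr_mul, coeff_seriesParity,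
    Finset.sum_add_distrib]
  congr 1
  · congr 1
    · rw [Finset.Nat.sum_antidiagonal_succ (f := fun p : ℕ × ℕ =>
        symContr 𝒱 (evenPart (parity 𝒱) v) (coeff 𝒱 p.1 ω) * coeff 𝒱 p.2 η), h0, zero_mul,
        zero_add]
    · rw [Finset.Nat.sum_antidiagonal_succ (f := fun p : ℕ × ℕ =>
        symContr 𝒱 (oddPart (parity 𝒱) v) (coeff 𝒱 p.1 ω) * symParity 𝒱 (coeff 𝒱 p.2 η)), h0,
        zero_mul, zero_add]
  · rw [Finset.Nat.sum_antidiagonal_succ' (f := fun p : ℕ × ℕ =>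
      coeff 𝒱 p.1 ω * symContr 𝒱 v (coeff 𝒱 p.2 η)), h0, mul_zero, zero_add]

/-- The graded commutativity of `O(V)`. -/
theorem series_mul_comm [CharZero 𝕜] [FiniteDimensional 𝕜 V] (ω η : Series 𝒱) :
    ω * η = η * evenPart (seriesParity 𝒱).toLinearMap ω +
      seriesParity 𝒱 η * oddPart (seriesParity 𝒱).toLinearMap ω := by
  refine series_ext fun n => ?_
  have he : ∀ n, coeff 𝒱 n (evenPart (seriesParity 𝒱).toLinearMap ω) =
      evenPart (symParity 𝒱).toLinearMap (coeff 𝒱 n ω) := fun n => by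
    simp [evenPart, coeff_seriesParity]
  have ho : ∀ n, coeff 𝒱 n (oddPart (seriesParity 𝒱).toLinearMap ω) =
      oddPart (symParity 𝒱).toLinearMap (coeff 𝒱 n ω) := fun n => by
    simp [oddPart, coeff_seriesParity]
  rw [map_add, coeff_mul, coeff_mul, coeff_mul, ← Finset.sum_add_distrib,
    ← Finset.Nat.sum_antidiagonal_swap]
  refine Finset.sum_congr rfl fun p _ => ?_
  rw [he, ho, coeff_seriesParity]
  exact sym_mul_comm 𝒱 _ _

end Parity

section Pullback

variable {𝒱 𝒲}

theorem dualMap_mem_dualGr {f : V →ₗ[𝕜] W} (hf : ∀ n, ∀ v ∈ 𝒱 n, f v ∈ 𝒲 n) {i : ℤ}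
    {ξ : Module.Dual 𝕜 W} (hξ : ξ ∈ dualGr 𝒲 i) : f.dualMap ξ ∈ dualGr 𝒱 i :=
  fun m hm v hv => hξ m hm _ (hf m v hv)

/-- The morphism `S(W^∨) → S(V^∨)` induced by a linear map `V → W` of degree `0`. -/
noncomputable def symPullback (f : V →ₗ[𝕜] W) (hf : ∀ n, ∀ v ∈ 𝒱 n, f v ∈ 𝒲 n) :
    SymDual 𝒲 →ₐ[𝕜] SymDual 𝒱 :=
  symLift 𝒲 (gen 𝒱 ∘ₗ f.dualMap) fun _ _ _ _ hξ hη =>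
    gen_swap 𝒱 (dualMap_mem_dualGr hf hξ) (dualMap_mem_dualGr hf hη)

theorem symPullback_gen (f : V →ₗ[𝕜] W) (hf : ∀ n, ∀ v ∈ 𝒱 n, f v ∈ 𝒲 n)
    (ξ : Module.Dual 𝕜 W) : symPullback f hf (gen 𝒲 ξ) = gen 𝒱 (f.dualMap ξ) := by
  rw [symPullback, symLift_gen]; rfl

/-- The morphism `O(W) → O(V)` induced by a linear map `V → W` of degree `0`. -/
noncomputable def pullback (f : V →ₗ[𝕜] W) (hf : ∀ n, ∀ v ∈ 𝒱 n, f v ∈ 𝒲 n) :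
    Series 𝒲 →ₐ[𝕜] Series 𝒱 :=
  seriesMap 𝒲 𝒱 (symPullback f hf) fun ξ => ⟨f.dualMap ξ, (symPullback_gen f hf ξ).symm⟩

theorem coeff_pullback (f : V →ₗ[𝕜] W) (hf : ∀ n, ∀ v ∈ 𝒱 n, f v ∈ 𝒲 n) (n : ℕ)
    (ω : Series 𝒲) : coeff 𝒱 n (pullback f hf ω) = symPullback f hf (coeff 𝒲 n ω) :=
  coeff_seriesMap 𝒲 𝒱 _ _ n ω

theorem pullback_seriesGen (f : V →ₗ[𝕜] W) (hf : ∀ n, ∀ v ∈ 𝒱 n, f v ∈ 𝒲 n)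
    (ξ : Module.Dual 𝕜 W) : pullback f hf (seriesGen 𝒲 ξ) = seriesGen 𝒱 (f.dualMap ξ) :=
  series_ext fun n => by
    rw [coeff_pullback, coeff_seriesGen, coeff_seriesGen]
    split_ifs
    · exact symPullback_gen f hf ξ
    · exact map_zero _

theorem pullback_mem_seriesGr (f : V →ₗ[𝕜] W) (hf : ∀ n, ∀ v ∈ 𝒱 n, f v ∈ 𝒲 n) {d : ℤ}
    {ω : Series 𝒲} (hω : ω ∈ seriesGr 𝒲 d) : pullback f hf ω ∈ seriesGr 𝒱 d :=
  seriesMap_mem_seriesGr 𝒲 𝒱 _ _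
    (fun _ ξ hξ => ⟨f.dualMap ξ, dualMap_mem_dualGr hf hξ, symPullback_gen f hf ξ⟩) hω

theorem pullback_pullback_of_leftInverse (f : V →ₗ[𝕜] W) (hf : ∀ n, ∀ v ∈ 𝒱 n, f v ∈ 𝒲 n)
    (g : W →ₗ[𝕜] V) (hg : ∀ n, ∀ w ∈ 𝒲 n, g w ∈ 𝒱 n) (h : ∀ v, g (f v) = v) (ω : Series 𝒱) :
    pullback f hf (pullback g hg ω) = ω := by
  have : (symPullback f hf).toLinearMap ∘ₗ (symPullback g hg).toLinearMap = LinearMap.id := by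
    refine sym_linear_ext 𝒱 (by simp) fun ξ p hp => ?_
    simp only [LinearMap.comp_apply, AlgHom.toLinearMap_apply, LinearMap.id_apply] at hp ⊢
    have hξ : f.dualMap (g.dualMap ξ) = ξ := by ext v; simp [h]
    rw [map_mul, map_mul, hp, symPullback_gen, symPullback_gen, hξ]
  exact series_ext fun n => by
    rw [coeff_pullback, coeff_pullback]; exact DFunLike.congr_fun this _

section Parity

variable [DirectSum.Decomposition 𝒱] [DirectSum.Decomposition 𝒲]

theorem map_parity (f : V →ₗ[𝕜] W) (hf : ∀ n, ∀ v ∈ 𝒱 n, f v ∈ 𝒲 n) (v : V) :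
    f (parity 𝒱 v) = parity 𝒲 (f v) := by
  have : f ∘ₗ parity 𝒱 = parity 𝒲 ∘ₗ f := graded_linear_ext 𝒱 fun n v hv => by
    rw [LinearMap.comp_apply, LinearMap.comp_apply, parity_of_mem 𝒱 hv,
      parity_of_mem 𝒲 (hf n v hv), Units.smul_def, map_zsmul, Units.smul_def]
  exact DFunLike.congr_fun this v

theorem symPullback_symParity (f : V →ₗ[𝕜] W) (hf : ∀ n, ∀ v ∈ 𝒱 n, f v ∈ 𝒲 n)
    (p : SymDual 𝒲) : symPullback f hf (symParity 𝒲 p) = symParity 𝒱 (symPullback f hf p) := by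
  have : (symPullback f hf).toLinearMap ∘ₗ (symParity 𝒲).toLinearMap =
      (symParity 𝒱).toLinearMap ∘ₗ (symPullback f hf).toLinearMap := by
    refine sym_linear_ext 𝒲 (by simp) fun ξ p hp => ?_
    simp only [LinearMap.comp_apply, AlgHom.toLinearMap_apply] at hp ⊢
    have hξ : f.dualMap (dualParity 𝒲 ξ) = dualParity 𝒱 (f.dualMap ξ) := by
      ext v; simp [dualParity_apply, map_parity f hf]
    rw [map_mul, map_mul, map_mul, map_mul, hp, symPullback_gen, symParity_gen, symParity_gen,
      symPullback_gen, hξ]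
  exact DFunLike.congr_fun this p

theorem pullback_seriesParity (f : V →ₗ[𝕜] W) (hf : ∀ n, ∀ v ∈ 𝒱 n, f v ∈ 𝒲 n)
    (ω : Series 𝒲) :
    pullback f hf (seriesParity 𝒲 ω) = seriesParity 𝒱 (pullback f hf ω) :=
  series_ext fun n => by
    rw [coeff_pullback, coeff_seriesParity, coeff_seriesParity, coeff_pullback,
      symPullback_symParity]

theorem pullback_seriesContr (f : V →ₗ[𝕜] W) (hf : ∀ n, ∀ v ∈ 𝒱 n, f v ∈ 𝒲 n) (v : V)
    (ω : Series 𝒲) :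
    pullback f hf (seriesContr 𝒲 (f v) ω) = seriesContr 𝒱 v (pullback f hf ω) := by
  have : (symPullback f hf).toLinearMap ∘ₗ symContr 𝒲 (f v) =
      symContr 𝒱 v ∘ₗ (symPullback f hf).toLinearMap := by
    refine sym_linear_ext 𝒲 (by simp [symContr_one]) fun ξ p hp => ?_
    simp only [LinearMap.comp_apply, AlgHom.toLinearMap_apply] at hp ⊢
    have he : f (evenPart (parity 𝒱) v) = evenPart (parity 𝒲) (f v) := by
      simp [evenPart, map_parity f hf]
    have ho : f (oddPart (parity 𝒱) v) = oddPart (parity 𝒲) (f v) := by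
      simp [oddPart, map_parity f hf]
    rw [symContr_gen_mul, map_add, map_mul, map_add, map_smul, map_smul, hp, map_mul,
      symPullback_gen, symContr_gen_mul, LinearMap.dualMap_apply, LinearMap.dualMap_apply, he, ho,
      symPullback_symParity]
  exact series_ext fun n => by
    rw [coeff_pullback, coeff_seriesContr, coeff_seriesContr, coeff_pullback]
    exact DFunLike.congr_fun this _

end Parity

end Pullback

section Derivation

variable {𝒱} [DirectSum.Decomposition 𝒱] (G : SHLieAlgebra 𝒱)

theorem SHLieAlgebra.Q_one : G.Q 1 = 0 := by
  have := G.leibniz 1 1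
  rw [mul_one, mul_one, map_one (seriesParity 𝒱), one_mul] at this
  simpa using this

/-- Q is odd. The degree condition shows this only for homogeneous series, and a formal series need
not be a finite sum of those. The anticommutator of Q and the involution vanishes on coordinates,
and the Leibniz rule makes it commute with multiplication by them, so it vanishes by
`eq_zero_of_gen_mul`. -/
theorem SHLieAlgebra.seriesParity_Q [FiniteDimensional 𝕜 V] (ω : Series 𝒱) :
    seriesParity 𝒱 (G.Q ω) = -G.Q (seriesParity 𝒱 ω) := by
  set P := seriesParity 𝒱 with hP
  have hgen : P.toLinearMap ∘ₗ G.Q ∘ₗ seriesGen 𝒱 = -(G.Q ∘ₗ P.toLinearMap ∘ₗ seriesGen 𝒱) := by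
    refine dual_linear_ext 𝒱 fun n ξ hξ => ?_
    have h := seriesGen_mem_seriesGr 𝒱 hξ
    simp only [LinearMap.comp_apply, LinearMap.neg_apply, AlgHom.toLinearMap_apply, hP]
    rw [seriesParity_of_mem 𝒱 h, seriesParity_of_mem 𝒱 (G.degree _ _ h), Int.negOnePow_succ,
      Units.smul_def, Units.smul_def, map_zsmul]
    simp
  have hgen' : ∀ ξ, P (G.Q (seriesGen 𝒱 ξ)) + G.Q (P (seriesGen 𝒱 ξ)) = 0 := fun ξ =>
    eq_neg_iff_add_eq_zero.1 (DFunLike.congr_fun hgen ξ)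
  have : P.toLinearMap ∘ₗ G.Q + G.Q ∘ₗ P.toLinearMap = 0 := by
    refine eq_zero_of_gen_mul 𝒱 (coeff 𝒱) (fun x hx => series_ext fun n => by simp [hx])
      (fun ξ x => seriesGen 𝒱 ξ * x) (fun ξ x => coeff_zero_seriesGen_mul 𝒱 ξ x)
      (fun n ξ x hx => by rw [coeff_succ_seriesGen_mul, hx, mul_zero]) _ ?_ fun ξ ω => ?_
    · simp [G.Q_one]
    · simp only [LinearMap.add_apply, LinearMap.comp_apply, AlgHom.toLinearMap_apply]
      have e : P (P (seriesGen 𝒱 ξ)) = seriesGen 𝒱 ξ := seriesParity_seriesParity 𝒱 _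
      rw [G.leibniz, map_add, map_mul P, map_mul P, map_mul P, G.leibniz, ← hP, e]
      have h := congrArg (· * P ω) (hgen' ξ)
      simp only [add_mul, zero_mul] at h
      rw [mul_add, add_add_add_comm, h, zero_add]
  exact eq_neg_iff_add_eq_zero.2 (DFunLike.congr_fun this ω)

end Derivation

end SeriesAlgebra

end SHLie

namespace SHLie

/-! ### The modules O(V) ⊗ X: Koszul products and right multiplication. -/

section Coefficients

variable {𝕜 : Type*} [Field 𝕜] {V : Type*} [AddCommGroup V] [Module 𝕜 V]
  (𝒱 : ℤ → Submodule 𝕜 V)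
  {X : Type*} [AddCommGroup X] [Module 𝕜 X] {Y : Type*} [AddCommGroup Y] [Module 𝕜 Y]
  {Z : Type*} [AddCommGroup Z] [Module 𝕜 Z]

theorem smul_tmul_series (ω η : Series 𝒱) (x : X) : ω • (η ⊗ₜ[𝕜] x) = (ω * η) ⊗ₜ[𝕜] x := by
  rw [TensorProduct.smul_tmul', smul_eq_mul]

variable [DirectSum.Decomposition 𝒱]

theorem koszul_tmul (σ : X →ₗ[𝕜] X) (b : X →ₗ[𝕜] Y →ₗ[𝕜] Z) (ω η : Series 𝒱) (x : X) (y : Y) :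
    koszul 𝒱 σ b (ω ⊗ₜ x) (η ⊗ₜ y) = (ω * η) ⊗ₜ b (evenPart σ x) y +
      (ω * seriesParity 𝒱 η) ⊗ₜ b (oddPart σ x) y := by
  simp [koszul]

theorem koszul_smul (σ : X →ₗ[𝕜] X) (b : X →ₗ[𝕜] Y →ₗ[𝕜] Z) (ω : Series 𝒱) (x : Series 𝒱 ⊗[𝕜] X)
    (y : Series 𝒱 ⊗[𝕜] Y) : koszul 𝒱 σ b (ω • x) y = ω • koszul 𝒱 σ b x y := by
  induction x using TensorProduct.induction_on with
  | zero => simp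
  | add a c ha hc => simp only [smul_add, map_add, LinearMap.add_apply, ha, hc]
  | tmul η x =>
    induction y using TensorProduct.induction_on with
    | zero => simp
    | add a c ha hc => simp only [map_add, smul_add, ha, hc]
    | tmul θ y =>
      rw [smul_tmul_series, koszul_tmul, koszul_tmul, smul_add, smul_tmul_series,
        smul_tmul_series, mul_assoc, mul_assoc]

theorem connOp_tmul (Q : Series 𝒱 →ₗ[𝕜] Series 𝒱) (D : X →ₗ[𝕜] Series 𝒱 ⊗[𝕜] X) (ω : Series 𝒱)
    (x : X) : connOp 𝒱 Q D (ω ⊗ₜ x) = Q ω ⊗ₜ x + seriesParity 𝒱 ω • D x := by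
  have h (η : Series 𝒱) (t : Series 𝒱 ⊗[𝕜] X) :
      LinearMap.rTensor X (LinearMap.mul' 𝕜 (Series 𝒱))
        ((TensorProduct.assoc 𝕜 (Series 𝒱) (Series 𝒱) X).symm (η ⊗ₜ t)) = η • t := by
    induction t using TensorProduct.induction_on with
    | zero => simp
    | add a c ha hc => simp only [TensorProduct.tmul_add, map_add, smul_add, ha, hc]
    | tmul θ y => simp [smul_tmul_series]
  simp [connOp, h]

/-- The right multiplication `(ω ⊗ x) η = (-1)^{|x||η|} ωη ⊗ x`. -/
noncomputable def rmul (σ : X →ₗ[𝕜] X) :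
    Series 𝒱 ⊗[𝕜] X →ₗ[𝕜] Series 𝒱 →ₗ[𝕜] Series 𝒱 ⊗[𝕜] X :=
  (koszul 𝒱 σ (LinearMap.lsmul 𝕜 X).flip).compl₂
    (TensorProduct.rid 𝕜 (Series 𝒱)).symm.toLinearMap

theorem rmul_tmul (σ : X →ₗ[𝕜] X) (ω η : Series 𝒱) (x : X) :
    rmul 𝒱 σ (ω ⊗ₜ x) η = (ω * η) ⊗ₜ evenPart σ x + (ω * seriesParity 𝒱 η) ⊗ₜ oddPart σ x := by
  simp [rmul, koszul_tmul]

theorem rmul_smul (σ : X →ₗ[𝕜] X) (ω : Series 𝒱) (x : Series 𝒱 ⊗[𝕜] X) (η : Series 𝒱) :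
    rmul 𝒱 σ (ω • x) η = ω • rmul 𝒱 σ x η :=
  koszul_smul 𝒱 σ _ ω x _

/-- The grading involution of `O(V) ⊗ X`. -/
noncomputable def totalParity (σ : X →ₗ[𝕜] X) : Series 𝒱 ⊗[𝕜] X →ₗ[𝕜] Series 𝒱 ⊗[𝕜] X :=
  TensorProduct.map (seriesParity 𝒱).toLinearMap σ

theorem totalParity_tmul (σ : X →ₗ[𝕜] X) (ω : Series 𝒱) (x : X) :
    totalParity 𝒱 σ (ω ⊗ₜ x) = seriesParity 𝒱 ω ⊗ₜ σ x := rfl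

section

variable [CharZero 𝕜]

theorem koszul_of_even {σ : X →ₗ[𝕜] X} {x : X} (hx : σ x = x) (b : X →ₗ[𝕜] Y →ₗ[𝕜] Z)
    (ω η : Series 𝒱) (y : Y) : koszul 𝒱 σ b (ω ⊗ₜ x) (η ⊗ₜ y) = (ω * η) ⊗ₜ b x y := by
  simp [koszul_tmul, evenPart_of_even hx, oddPart_of_even hx]

theorem koszul_of_odd {σ : X →ₗ[𝕜] X} {x : X} (hx : σ x = -x) (b : X →ₗ[𝕜] Y →ₗ[𝕜] Z)
    (ω η : Series 𝒱) (y : Y) :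
    koszul 𝒱 σ b (ω ⊗ₜ x) (η ⊗ₜ y) = (ω * seriesParity 𝒱 η) ⊗ₜ b x y := by
  simp [koszul_tmul, evenPart_of_odd hx, oddPart_of_odd hx]

theorem koszul_one_tmul (σ : X →ₗ[𝕜] X) (b : X →ₗ[𝕜] Y →ₗ[𝕜] Z) (ω : Series 𝒱) (x : X) (y : Y) :
    koszul 𝒱 σ b (ω ⊗ₜ x) (1 ⊗ₜ y) = ω ⊗ₜ b x y := by
  rw [koszul_tmul, map_one, mul_one, ← TensorProduct.tmul_add, ← LinearMap.add_apply, ← map_add,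
    evenPart_add_oddPart]

end

variable [CharZero 𝕜] [FiniteDimensional 𝕜 V]

theorem mul_of_even_left {ω : Series 𝒱} (hω : seriesParity 𝒱 ω = ω) (η : Series 𝒱) :
    ω * η = η * ω := by
  have h : (seriesParity 𝒱).toLinearMap ω = ω := hω
  rw [series_mul_comm, evenPart_of_even h, oddPart_of_even h, mul_zero, add_zero]

theorem mul_of_odd_left {ω : Series 𝒱} (hω : seriesParity 𝒱 ω = -ω) (η : Series 𝒱) :
    ω * η = seriesParity 𝒱 η * ω := by
  have h : (seriesParity 𝒱).toLinearMap ω = -ω := hω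
  rw [series_mul_comm, evenPart_of_odd h, oddPart_of_odd h, mul_zero, zero_add]

/-- Moving η to the left past both tensor factors costs the sign of |η| times the total degree: the
definition accounts for the factor in X, graded commutativity for the series. -/
theorem rmul_eq {σ : X →ₗ[𝕜] X} (hσ : ∀ x, σ (σ x) = x) (x : Series 𝒱 ⊗[𝕜] X) (η : Series 𝒱) :
    rmul 𝒱 σ x η = evenPart (seriesParity 𝒱).toLinearMap η • x +
      oddPart (seriesParity 𝒱).toLinearMap η • totalParity 𝒱 σ x := by
  set P := (seriesParity 𝒱).toLinearMap with hP
  have hPP : ∀ ω, P (P ω) = ω := seriesParity_seriesParity 𝒱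
  induction x using TensorProduct.induction_on with
  | zero => simp
  | add a c ha hc => simp only [map_add, LinearMap.add_apply, smul_add, ha, hc]; abel
  | tmul ω x =>
    have hη : ∀ ω η : Series 𝒱, ω * η = evenPart P η * ω + oddPart P η * P ω := by
      intro ω η
      conv_lhs => rw [← evenPart_add_oddPart P η, mul_add]
      rw [mul_of_even_left 𝒱 (apply_evenPart_self hPP η) ω]
      congr 1
      rw [mul_of_odd_left 𝒱 (apply_oddPart_self hPP η) (P ω)]
      congr 1
      exact (hPP ω).symm
    have he : evenPart P (P η) = evenPart P η := by simp [evenPart, hPP, add_comm]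
    have ho : oddPart P (P η) = -oddPart P η := by
      simp [oddPart, hPP, ← smul_neg]
    have hs : σ x = evenPart σ x - oddPart σ x := by
      conv_lhs => rw [← evenPart_add_oddPart σ x, map_add, apply_evenPart_self hσ,
        apply_oddPart_self hσ, ← sub_eq_add_neg]
    have hx : ∀ θ : Series 𝒱, θ ⊗ₜ[𝕜] x = θ ⊗ₜ[𝕜] evenPart σ x + θ ⊗ₜ[𝕜] oddPart σ x := by
      intro θ
      rw [← TensorProduct.tmul_add, evenPart_add_oddPart]
    have e1 : seriesParity 𝒱 η = P η := rfl
    have e2 : seriesParity 𝒱 ω = P ω := rfl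
    rw [rmul_tmul, totalParity_tmul, smul_tmul_series, smul_tmul_series, e1, e2, hη ω η,
      hη ω (P η), he, ho, hs, hx]
    simp only [TensorProduct.add_tmul, TensorProduct.tmul_sub, neg_mul, TensorProduct.neg_tmul]
    abel

theorem rmul_of_even {σ : X →ₗ[𝕜] X} (hσ : ∀ x, σ (σ x) = x) {x : Series 𝒱 ⊗[𝕜] X}
    (hx : totalParity 𝒱 σ x = x) (η : Series 𝒱) : rmul 𝒱 σ x η = η • x := by
  rw [rmul_eq 𝒱 hσ, hx, ← add_smul, evenPart_add_oddPart]

theorem rmul_of_odd {σ : X →ₗ[𝕜] X} (hσ : ∀ x, σ (σ x) = x) {x : Series 𝒱 ⊗[𝕜] X}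
    (hx : totalParity 𝒱 σ x = -x) (η : Series 𝒱) : rmul 𝒱 σ x η = seriesParity 𝒱 η • x := by
  have hPP : ∀ ω, (seriesParity 𝒱).toLinearMap ((seriesParity 𝒱).toLinearMap ω) = ω :=
    seriesParity_seriesParity 𝒱
  rw [rmul_eq 𝒱 hσ, hx, smul_neg, ← neg_smul, ← add_smul, ← sub_eq_add_neg]
  congr 1
  have := congrArg (seriesParity 𝒱).toLinearMap
    (evenPart_add_oddPart (seriesParity 𝒱).toLinearMap η)
  rw [map_add, apply_evenPart_self hPP, apply_oddPart_self hPP, ← sub_eq_add_neg] at this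
  exact this

end Coefficients

/-! ### Leibniz rules for operators of the form Q + D. -/

section Connection

variable {𝕜 : Type*} [Field 𝕜] {V : Type*} [AddCommGroup V] [Module 𝕜 V]
  {𝒱 : ℤ → Submodule 𝕜 V} [DirectSum.Decomposition 𝒱]
  {X : Type*} [AddCommGroup X] [Module 𝕜 X]
  (G : SHLieAlgebra 𝒱)

theorem connOp_smul (D : X →ₗ[𝕜] Series 𝒱 ⊗[𝕜] X) (ω : Series 𝒱) (x : Series 𝒱 ⊗[𝕜] X) :
    connOp 𝒱 G.Q D (ω • x) = G.Q ω • x + seriesParity 𝒱 ω • connOp 𝒱 G.Q D x := by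
  induction x using TensorProduct.induction_on with
  | zero => simp
  | add a c ha hc => simp only [smul_add, map_add, ha, hc]; abel
  | tmul η x =>
    rw [smul_tmul_series, connOp_tmul, connOp_tmul, G.leibniz, smul_add, smul_tmul_series,
      smul_tmul_series, map_mul, TensorProduct.add_tmul, mul_smul, add_assoc]

theorem connOp_one_tmul (D : X →ₗ[𝕜] Series 𝒱 ⊗[𝕜] X) (x : X) :
    connOp 𝒱 G.Q D (1 ⊗ₜ x) = D x := by
  rw [connOp_tmul, G.Q_one, TensorProduct.zero_tmul, zero_add, map_one, one_smul]

/-- The hypothesis `hD` says that D is odd for the total grading; then D(x) and x have opposite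
parities, and the right Leibniz rule has the expected sign. It serves to differentiate the term of
`J_mul` that carries a right multiplication. -/
theorem connOp_rmul [CharZero 𝕜] [FiniteDimensional 𝕜 V] {σ : X →ₗ[𝕜] X}
    (hσ : ∀ x, σ (σ x) = x) {D : X →ₗ[𝕜] Series 𝒱 ⊗[𝕜] X}
    (hD : ∀ x, totalParity 𝒱 σ (D x) = -D (σ x)) (x : Series 𝒱 ⊗[𝕜] X) (η : Series 𝒱) :
    connOp 𝒱 G.Q D (rmul 𝒱 σ x η) = rmul 𝒱 σ (connOp 𝒱 G.Q D x) η +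
      rmul 𝒱 σ (totalParity 𝒱 σ x) (G.Q η) := by
  have : connOp 𝒱 G.Q D ∘ₗ (rmul 𝒱 σ).flip η = (rmul 𝒱 σ).flip η ∘ₗ connOp 𝒱 G.Q D +
      (rmul 𝒱 σ).flip (G.Q η) ∘ₗ totalParity 𝒱 σ := by
    refine TensorProduct.ext ?_
    refine LinearMap.ext fun ω => linear_ext_parity hσ fun y hy => ?_
    simp only [LinearMap.compr₂ₛₗ_apply, TensorProduct.mk_apply,
      LinearMap.comp_apply, LinearMap.flip_apply, LinearMap.add_apply]
    rw [connOp_tmul, totalParity_tmul, map_add, LinearMap.add_apply, rmul_smul]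
    rcases hy with hy | hy
    · have h := hD y
      rw [hy] at h
      rw [rmul_of_odd 𝒱 hσ h, hy]
      simp only [rmul_tmul, evenPart_of_even hy, oddPart_of_even hy, TensorProduct.tmul_zero,
        add_zero]
      rw [connOp_tmul, G.leibniz, map_mul, mul_smul, TensorProduct.add_tmul]
      abel
    · have h := hD y
      rw [hy, map_neg, neg_neg] at h
      rw [rmul_of_even 𝒱 hσ h, hy, TensorProduct.tmul_neg, map_neg, LinearMap.neg_apply]
      simp only [rmul_tmul, evenPart_of_odd hy, oddPart_of_odd hy, TensorProduct.tmul_zero,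
        zero_add]
      rw [connOp_tmul, G.leibniz, map_mul, mul_smul, TensorProduct.add_tmul, G.seriesParity_Q,
        seriesParity_seriesParity, mul_neg, TensorProduct.neg_tmul, neg_neg]
      abel
  exact DFunLike.congr_fun this x

end Connection

/-! ### The operator J as a derivation and as a chain map. -/

section DeRham

variable {𝕜 : Type*} [Field 𝕜] {L : Type*} [AddCommGroup L] [Module 𝕜 L]
  {ℒ : ℤ → Submodule 𝕜 L}
  {A : Submodule 𝕜 L}

theorem evalAt_tmul (l : L) (ω : Series (subGr ℒ A)) (ξ : Module.Dual 𝕜 L) :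
    evalAt A l (ω ⊗ₜ ξ) = ξ l • ω := by
  simp [evalAt]

theorem evalAt_smul (c : 𝕜) (l : L) : evalAt (ℒ := ℒ) A (c • l) = c • evalAt A l :=
  TensorProduct.ext' fun ω ξ => by simp [evalAt_tmul, mul_smul]

theorem evalAt_module_smul (l : L) (ω : Series (subGr ℒ A))
    (x : Series (subGr ℒ A) ⊗[𝕜] Module.Dual 𝕜 L) : evalAt A l (ω • x) = ω * evalAt A l x := by
  induction x using TensorProduct.induction_on with
  | zero => simp
  | add a c ha hc => simp only [smul_add, map_add, ha, hc, mul_add]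
  | tmul η ξ => rw [TensorProduct.smul_tmul', smul_eq_mul, evalAt_tmul, evalAt_tmul, mul_smul_comm]

theorem sum_evalAt_tmul [FiniteDimensional 𝕜 L] (x : Series (subGr ℒ A) ⊗[𝕜] Module.Dual 𝕜 L) :
    ∑ i, evalAt A (Module.finBasis 𝕜 L i) x ⊗ₜ[𝕜] (Module.finBasis 𝕜 L).coord i = x := by
  induction x using TensorProduct.induction_on with
  | zero => simp
  | add a c ha hc =>
    simp only [map_add, TensorProduct.add_tmul, Finset.sum_add_distrib, ha, hc]
  | tmul η ξ =>
    simp only [evalAt_tmul, TensorProduct.smul_tmul, ← TensorProduct.tmul_sum, sum_coord_smul]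

theorem evalAt_ext [FiniteDimensional 𝕜 L] {x y : Series (subGr ℒ A) ⊗[𝕜] Module.Dual 𝕜 L}
    (h : ∀ l, evalAt A l x = evalAt A l y) : x = y := by
  rw [← sum_evalAt_tmul x, ← sum_evalAt_tmul y]
  simp only [h]

variable [DirectSum.Decomposition ℒ]

/-- This removes the basis from the definition of J: pairing with l is contraction with l followed
by restriction. Together with `evalAt_ext`, it reduces identities for J to identities for
contractions. -/
theorem evalAt_J [FiniteDimensional 𝕜 L] (l : L) (ω : Series ℒ) :
    evalAt A l (J ℒ A ω) = restr ℒ A (seriesContr ℒ l ω) := by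
  simp only [J, deRham, LinearMap.comp_apply, LinearMap.sum_apply, LinearMap.flip_apply,
    TensorProduct.mk_apply, map_sum, LinearMap.rTensor_tmul, evalAt_tmul,
    AlgHom.toLinearMap_apply, ← map_smul (restr ℒ A)]
  rw [← map_sum]
  congr 1
  exact sum_coord_apply ((seriesContrHom ℒ).flip ω) l

theorem J_seriesGen [FiniteDimensional 𝕜 L] [CharZero 𝕜] (ξ : Module.Dual 𝕜 L) : J ℒ A (seriesGen ℒ ξ) = 1 ⊗ₜ ξ :=
  evalAt_ext fun l => by
    rw [evalAt_J, seriesContr_seriesGen, map_smul, map_one, evalAt_tmul]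

variable [DirectSum.Decomposition (subGr ℒ A)]

theorem evalAt_rmul (l : L) (x : Series (subGr ℒ A) ⊗[𝕜] Module.Dual 𝕜 L)
    (η : Series (subGr ℒ A)) : evalAt A l (rmul (subGr ℒ A) (dualParity ℒ) x η) =
      evalAt A (evenPart (parity ℒ) l) x * η +
        evalAt A (oddPart (parity ℒ) l) x * seriesParity (subGr ℒ A) η := by
  induction x using TensorProduct.induction_on with
  | zero => simp
  | add a c ha hc => simp only [map_add, LinearMap.add_apply, ha, hc, add_mul]; abel
  | tmul ω ξ =>
    have he : evenPart (dualParity ℒ) ξ l = ξ (evenPart (parity ℒ) l) := by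
      simp [evenPart, dualParity_apply]
    have ho : oddPart (dualParity ℒ) ξ l = ξ (oddPart (parity ℒ) l) := by
      simp [oddPart, dualParity_apply]
    rw [rmul_tmul, map_add]
    simp only [evalAt_tmul, he, ho, smul_mul_assoc]

theorem evalAt_totalParity (l : L) (x : Series (subGr ℒ A) ⊗[𝕜] Module.Dual 𝕜 L) :
    evalAt A l (totalParity (subGr ℒ A) (dualParity ℒ) x) =
      seriesParity (subGr ℒ A) (evalAt A (parity ℒ l) x) := by
  induction x using TensorProduct.induction_on with
  | zero => simp
  | add a c ha hc => simp only [map_add, ha, hc]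
  | tmul ω ξ => simp only [totalParity_tmul, evalAt_tmul, map_smul, dualParity_apply]

/-- The restriction unfolds to the pullback along the inclusion of A, so naturality of pullbacks
applies to it directly. -/
theorem restr_seriesParity (ω : Series ℒ) :
    restr ℒ A (seriesParity ℒ ω) = seriesParity (subGr ℒ A) (restr ℒ A ω) :=
  pullback_seriesParity (𝒱 := subGr ℒ A) A.subtype (fun _ _ h => h) ω

variable [FiniteDimensional 𝕜 L]

theorem J_seriesParity (ω : Series ℒ) :
    J ℒ A (seriesParity ℒ ω) = totalParity (subGr ℒ A) (dualParity ℒ) (J ℒ A ω) :=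
  evalAt_ext fun l => by
    rw [evalAt_totalParity, evalAt_J, evalAt_J, ← restr_seriesParity, seriesParity_seriesContr,
      parity_parity]

variable (P : SHLiePair ℒ A)

theorem SHLiePair.totalParity_coadD (ξ : Module.Dual 𝕜 L) :
    totalParity (subGr ℒ A) (dualParity ℒ) (P.coadD ξ) = -P.coadD (dualParity ℒ ξ) := by
  simp only [SHLiePair.coadD, LinearMap.comp_apply]
  rw [← J_seriesParity, P.toL.seriesParity_Q, map_neg, seriesParity_seriesGen]

variable [CharZero 𝕜]

/-- `J` is a derivation along the restriction. -/
theorem J_mul (ω η : Series ℒ) : J ℒ A (ω * η) = restr ℒ A ω • J ℒ A η +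
    rmul (subGr ℒ A) (dualParity ℒ) (J ℒ A ω) (restr ℒ A η) :=
  evalAt_ext fun l => by
    rw [map_add, evalAt_module_smul, evalAt_rmul]
    simp only [evalAt_J]
    rw [seriesContr_mul, map_add, map_add, map_mul, map_mul, map_mul, restr_seriesParity]
    abel

/-- `J` is a morphism of complexes. -/
theorem SHLiePair.J_Q (ω : Series ℒ) :
    J ℒ A (P.toL.Q ω) = connOp (subGr ℒ A) P.toA.Q P.coadD (J ℒ A ω) := by
  have hr : ∀ ω, restr ℒ A (P.toL.Q ω) = P.toA.Q (restr ℒ A ω) := fun ω =>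
    DFunLike.congr_fun P.restr_comp ω
  -- On ξω all terms of the two Leibniz expansions cancel except the restriction of ±ξ times the
  -- difference at ω. That factor has no constant term, so the order-by-order argument applies, with
  -- the coefficients along a basis of L as filtration.
  have : J ℒ A ∘ₗ P.toL.Q - connOp (subGr ℒ A) P.toA.Q P.coadD ∘ₗ J ℒ A = 0 := by
    refine eq_zero_of_gen_mul ℒ
      (fun n => LinearMap.pi fun i =>
        coeff (subGr ℒ A) n ∘ₗ evalAt A (Module.finBasis 𝕜 L i)) (fun x hx => ?_)
      (fun ξ x => seriesGen (subGr ℒ A) (A.subtype.dualMap (dualParity ℒ ξ)) • x)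
      (fun ξ x => ?_) (fun n ξ x hx => ?_) _ ?_ fun ξ ω => ?_
    · rw [← sum_evalAt_tmul x]
      refine Finset.sum_eq_zero fun i _ => ?_
      rw [series_ext (f := evalAt A (Module.finBasis 𝕜 L i) x) (g := 0) fun n => ?_,
        TensorProduct.zero_tmul]
      rw [map_zero]
      exact congrFun (hx n) i
    · funext i
      simp only [LinearMap.pi_apply, LinearMap.comp_apply, evalAt_module_smul,
        coeff_zero_seriesGen_mul]
      rfl
    · funext i
      have hi : coeff (subGr ℒ A) n (evalAt A (Module.finBasis 𝕜 L i) x) = 0 := congrFun (hx) i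
      simp only [LinearMap.pi_apply, LinearMap.comp_apply, evalAt_module_smul,
        coeff_succ_seriesGen_mul, hi, mul_zero]
      rfl
    · have : J ℒ A 1 = 0 := evalAt_ext fun l => by
        rw [evalAt_J, seriesContr_one, map_zero, map_zero]
      simp [P.toL.Q_one, this]
    · simp only [LinearMap.sub_apply, LinearMap.comp_apply]
      have hg : restr ℒ A (seriesParity ℒ (seriesGen ℒ ξ)) =
          seriesGen (subGr ℒ A) (A.subtype.dualMap (dualParity ℒ ξ)) := by
        rw [seriesParity_seriesGen]
        exact pullback_seriesGen (𝒱 := subGr ℒ A) A.subtype (fun _ _ h => h) _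
      -- Agreement on coordinates is the definition of the coadjoint structure, since J(ξ) = 1 ⊗ ξ.
      have h1 : connOp (subGr ℒ A) P.toA.Q P.coadD (J ℒ A (seriesGen ℒ ξ)) =
          J ℒ A (P.toL.Q (seriesGen ℒ ξ)) := by
        rw [J_seriesGen, connOp_one_tmul]; rfl
      rw [P.toL.leibniz, map_add, J_mul, J_mul, J_mul, map_add, connOp_smul,
        connOp_rmul P.toA (dualParity_dualParity ℒ) P.totalParity_coadD, h1, hr, hr,
        ← J_seriesParity, ← restr_seriesParity, hg, smul_sub]
      abel
  exact sub_eq_zero.1 (DFunLike.congr_fun this ω)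

end DeRham

end SHLie

namespace SHLie

/-! ### Gradings of tensor products. -/

section TensorGrading

variable {𝕜 : Type*} [Field 𝕜] {V : Type*} [AddCommGroup V] [Module 𝕜 V]
  {W : Type*} [AddCommGroup W] [Module 𝕜 W] {U : Type*} [AddCommGroup U] [Module 𝕜 U]

theorem tensorGr_le {𝒱 : ℤ → Submodule 𝕜 V} {𝒲 : ℤ → Submodule 𝕜 W} {n : ℤ}
    {S : Submodule 𝕜 (V ⊗[𝕜] W)}
    (h : ∀ i j, i + j = n → ∀ v ∈ 𝒱 i, ∀ w ∈ 𝒲 j, v ⊗ₜ[𝕜] w ∈ S) : tensorGr 𝒱 𝒲 n ≤ S :=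
  iSup_le fun i => Submodule.map₂_le.2 fun v hv w hw => h i (n - i) (by ring) v hv w hw

theorem tmul_mem_tensorGr {𝒱 : ℤ → Submodule 𝕜 V} {𝒲 : ℤ → Submodule 𝕜 W} {i j n : ℤ}
    (hn : i + j = n) {v : V} (hv : v ∈ 𝒱 i) {w : W} (hw : w ∈ 𝒲 j) :
    v ⊗ₜ[𝕜] w ∈ tensorGr 𝒱 𝒲 n := by
  obtain rfl : j = n - i := by omega
  exact Submodule.mem_iSup_of_mem i (Submodule.apply_mem_map₂ _ hv hw)

theorem exists_sum_of_mem_tensorGr {𝒱 : ℤ → Submodule 𝕜 V} {𝒲 : ℤ → Submodule 𝕜 W} {n : ℤ}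
    {x : V ⊗[𝕜] W} (hx : x ∈ tensorGr 𝒱 𝒲 n) :
    ∃ (k : ℕ) (v : Fin k → V) (w : Fin k → W) (i j : Fin k → ℤ), x = ∑ a, v a ⊗ₜ w a ∧
      ∀ a, i a + j a = n ∧ v a ∈ 𝒱 (i a) ∧ w a ∈ 𝒲 (j a) := by
  let S : Submodule 𝕜 (V ⊗[𝕜] W) :=
    { carrier := {x | ∃ (k : ℕ) (v : Fin k → V) (w : Fin k → W) (i j : Fin k → ℤ),
        x = ∑ a, v a ⊗ₜ w a ∧ ∀ a, i a + j a = n ∧ v a ∈ 𝒱 (i a) ∧ w a ∈ 𝒲 (j a)}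
      zero_mem' := ⟨0, Fin.elim0, Fin.elim0, Fin.elim0, Fin.elim0, by simp, fun a => a.elim0⟩
      add_mem' := by
        rintro _ _ ⟨k, v, w, i, j, rfl, h⟩ ⟨k', v', w', i', j', rfl, h'⟩
        refine ⟨k + k', Fin.append v v', Fin.append w w', Fin.append i i', Fin.append j j',
          by simp [Fin.sum_univ_add], fun a => ?_⟩
        refine Fin.addCases (fun a => ?_) (fun a => ?_) a
        · simpa using h a
        · simpa using h' a
      smul_mem' := by
        rintro c _ ⟨k, v, w, i, j, rfl, h⟩
        exact ⟨k, fun a => c • v a, w, i, j, by simp [Finset.smul_sum, TensorProduct.smul_tmul'],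
          fun a => ⟨(h a).1, Submodule.smul_mem _ _ (h a).2.1, (h a).2.2⟩⟩ }
  have : tensorGr 𝒱 𝒲 n ≤ S := tensorGr_le fun i j hij v hv w hw =>
    ⟨1, fun _ => v, fun _ => w, fun _ => i, fun _ => j, by simp, fun _ => ⟨hij, hv, hw⟩⟩
  exact this hx

/-- Both sums represent the map f ∘ g as an element of U ⊗ W^∨. Used with g a projection to one
degree, it compensates for the chosen basis not being homogeneous; with g the inclusion of A, it
compares bases of L and A. -/
theorem sum_tmul_comp [FiniteDimensional 𝕜 V] [FiniteDimensional 𝕜 W] (f : V →ₗ[𝕜] U)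
    (g : W →ₗ[𝕜] V) :
    ∑ i, f (Module.finBasis 𝕜 V i) ⊗ₜ[𝕜] ((Module.finBasis 𝕜 V).coord i ∘ₗ g) =
      ∑ i, f (g (Module.finBasis 𝕜 W i)) ⊗ₜ[𝕜] (Module.finBasis 𝕜 W).coord i := by
  have h : ∀ i, ((Module.finBasis 𝕜 V).coord i ∘ₗ g) =
      ∑ k, (Module.finBasis 𝕜 V).coord i (g (Module.finBasis 𝕜 W k)) •
        (Module.finBasis 𝕜 W).coord k := fun i =>
    (sum_coord_smul ((Module.finBasis 𝕜 V).coord i ∘ₗ g)).symm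
  simp only [h, TensorProduct.tmul_sum]
  rw [Finset.sum_comm]
  refine Finset.sum_congr rfl fun k _ => ?_
  simp only [← TensorProduct.smul_tmul, ← TensorProduct.sum_tmul]
  rw [sum_coord_apply f]

end TensorGrading

/-! ### Cochains with values in L^∨ ⊗ End(E), and the curvature formula. -/

section Cochains

variable {𝕜 : Type*} [Field 𝕜] {L : Type*} [AddCommGroup L] [Module 𝕜 L]
  {ℒ : ℤ → Submodule 𝕜 L} {A : Submodule 𝕜 L}
  {E : Type*} [AddCommGroup E] [Module 𝕜 E] {ℰ : ℤ → Submodule 𝕜 E}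

/-- The maps r and s split X → Y → Z at Y, and the splitting identity survives tensoring: an element
killed by g is f applied to r of it. -/
theorem mem_range_lTensor_rTensor {X Y Z M N : Type*} [AddCommMonoid X] [Module 𝕜 X]
    [AddCommMonoid Y] [Module 𝕜 Y] [AddCommMonoid Z] [Module 𝕜 Z] [AddCommMonoid M] [Module 𝕜 M]
    [AddCommMonoid N] [Module 𝕜 N] {f : X →ₗ[𝕜] Y} {g : Y →ₗ[𝕜] Z} (r : Y →ₗ[𝕜] X)
    (s : Z →ₗ[𝕜] Y) (h : ∀ y, f (r y) + s (g y) = y) {x : M ⊗[𝕜] (Y ⊗[𝕜] N)}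
    (hx : LinearMap.lTensor M (LinearMap.rTensor N g) x = 0) :
    x ∈ LinearMap.range (LinearMap.lTensor M (LinearMap.rTensor N f)) := by
  have key : ∀ x : M ⊗[𝕜] (Y ⊗[𝕜] N), LinearMap.lTensor M (LinearMap.rTensor N f)
        (LinearMap.lTensor M (LinearMap.rTensor N r) x) +
      LinearMap.lTensor M (LinearMap.rTensor N s)
        (LinearMap.lTensor M (LinearMap.rTensor N g) x) = x := by
    intro x
    induction x using TensorProduct.induction_on with
    | zero => simp
    | add a c ha hc =>
      simp only [map_add]
      rw [add_add_add_comm, ha, hc]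
    | tmul m t =>
      induction t using TensorProduct.induction_on with
      | zero => simp
      | add a c ha hc =>
        simp only [TensorProduct.tmul_add, map_add]
        rw [add_add_add_comm, ha, hc]
      | tmul y n =>
        simp only [LinearMap.lTensor_tmul, LinearMap.rTensor_tmul]
        rw [← TensorProduct.tmul_add, ← TensorProduct.add_tmul, h]
  have := key x
  rw [hx, map_zero, add_zero] at this
  exact ⟨_, this⟩

theorem mem_perpCochain {x : LCochain ℒ A E} (hx : restrictCochain ℒ A E x = 0) :
    x ∈ perpCochain ℒ A E := by
  -- An ungraded retraction is enough here, since membership in the subspace involves no degree.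
  obtain ⟨π, hπ⟩ := A.subtype.exists_leftInverse_of_injective A.ker_subtype
  have hπ' : ∀ a : A, π a = a := fun a => DFunLike.congr_fun hπ a
  let r : Module.Dual 𝕜 L →ₗ[𝕜] A.dualAnnihilator :=
    (LinearMap.id - π.dualMap ∘ₗ A.subtype.dualMap).codRestrict A.dualAnnihilator fun ξ => by
      rw [Submodule.mem_dualAnnihilator]
      intro a ha
      have := congrArg Subtype.val (hπ' ⟨a, ha⟩)
      simp only at this
      simp [this]
  refine mem_range_lTensor_rTensor r π.dualMap (fun ξ => ?_) hx
  ext l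
  simp [r]

theorem restrictCochain_of_mem {x : LCochain ℒ A E} (hx : x ∈ perpCochain ℒ A E) :
    restrictCochain ℒ A E x = 0 := by
  obtain ⟨y, rfl⟩ := hx
  rw [restrictCochain, ← LinearMap.comp_apply, ← LinearMap.lTensor_comp, ← LinearMap.rTensor_comp]
  have : A.subtype.dualMap ∘ₗ A.dualAnnihilator.subtype = 0 := by
    ext ξ a
    exact (Submodule.mem_dualAnnihilator _).1 ξ.2 a a.2
  rw [this]
  simp

theorem assoc_mem_cochainGr {d e n : ℤ} (hn : d + e = n)
    {x : Series (subGr ℒ A) ⊗[𝕜] Module.Dual 𝕜 L}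
    (hx : x ∈ tensorGr (seriesGr (subGr ℒ A)) (dualGr ℒ) d) {ψ : Module.End 𝕜 E}
    (hψ : ψ ∈ endGr ℰ e) :
    TensorProduct.assoc 𝕜 (Series (subGr ℒ A)) (Module.Dual 𝕜 L) (Module.End 𝕜 E) (x ⊗ₜ ψ) ∈
      cochainGr ℒ A ℰ n := by
  have : tensorGr (seriesGr (subGr ℒ A)) (dualGr ℒ) d ≤
      (cochainGr ℒ A ℰ n).comap ((TensorProduct.assoc 𝕜 (Series (subGr ℒ A)) (Module.Dual 𝕜 L)
        (Module.End 𝕜 E)).toLinearMap ∘ₗ (TensorProduct.mk 𝕜 _ _).flip ψ) := by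
    refine tensorGr_le fun i j hij ω hω ξ hξ => ?_
    simp only [Submodule.mem_comap, LinearMap.comp_apply, LinearMap.flip_apply,
      TensorProduct.mk_apply, LinearEquiv.coe_coe, TensorProduct.assoc_tmul]
    exact tmul_mem_tensorGr (i := i) (j := j + e) (by omega) hω (tmul_mem_tensorGr rfl hξ hψ)
  exact this hx

theorem restr_mem_seriesGr {d : ℤ} {ω : Series ℒ} (hω : ω ∈ seriesGr ℒ d) :
    restr ℒ A ω ∈ seriesGr (subGr ℒ A) d :=
  pullback_mem_seriesGr (𝒱 := subGr ℒ A) A.subtype (fun _ _ h => h) hω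

theorem assoc_smul (ω : Series (subGr ℒ A)) (x : Series (subGr ℒ A) ⊗[𝕜] Module.Dual 𝕜 L)
    (ψ : Module.End 𝕜 E) :
    ω • TensorProduct.assoc 𝕜 _ _ _ (x ⊗ₜ[𝕜] ψ) = TensorProduct.assoc 𝕜 _ _ _ ((ω • x) ⊗ₜ ψ) := by
  induction x using TensorProduct.induction_on with
  | zero => simp
  | add a c ha hc => simp only [TensorProduct.add_tmul, map_add, smul_add, ha, hc]
  | tmul η ξ => simp only [TensorProduct.assoc_tmul, TensorProduct.smul_tmul', smul_eq_mul]

theorem neg_smul_series (ω : Series (subGr ℒ A)) (x : Series (subGr ℒ A) ⊗[𝕜] Module.Dual 𝕜 L) :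
    (-ω) • x = -(ω • x) :=
  neg_smul ω x

variable [DirectSum.Decomposition ℒ]

section Product

variable [DirectSum.Decomposition (subGr ℒ A)]

/-- The product `(ω ⊗ ξ, η ⊗ ψ) ↦ (-1)^{|ξ||η|} ωη ⊗ ξ ⊗ ψ`. -/
noncomputable def koszulMk (ℒ : ℤ → Submodule 𝕜 L) [DirectSum.Decomposition ℒ]
    (A : Submodule 𝕜 L) [DirectSum.Decomposition (subGr ℒ A)] (E : Type*) [AddCommGroup E]
    [Module 𝕜 E] : Series (subGr ℒ A) ⊗[𝕜] Module.Dual 𝕜 L →ₗ[𝕜]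
      Series (subGr ℒ A) ⊗[𝕜] Module.End 𝕜 E →ₗ[𝕜] LCochain ℒ A E :=
  koszul (Z := Module.Dual 𝕜 L ⊗[𝕜] Module.End 𝕜 E) (subGr ℒ A) (dualParity ℒ)
    (TensorProduct.mk 𝕜 (Module.Dual 𝕜 L) (Module.End 𝕜 E))

theorem koszulMk_tmul (x : Series (subGr ℒ A) ⊗[𝕜] Module.Dual 𝕜 L) (η : Series (subGr ℒ A))
    (ψ : Module.End 𝕜 E) :
    koszulMk ℒ A E x (η ⊗ₜ ψ) =
      TensorProduct.assoc 𝕜 _ _ _ (rmul (subGr ℒ A) (dualParity ℒ) x η ⊗ₜ ψ) := by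
  induction x using TensorProduct.induction_on with
  | zero => simp
  | add a c ha hc =>
    simp only [map_add, LinearMap.add_apply, TensorProduct.add_tmul, ha, hc]
  | tmul ω ξ =>
    rw [koszulMk, koszul_tmul, rmul_tmul]
    simp [TensorProduct.add_tmul]

end Product

variable [FiniteDimensional 𝕜 L]

theorem J_apply (ω : Series ℒ) : J ℒ A ω =
    ∑ i, restr ℒ A (seriesContr ℒ (Module.finBasis 𝕜 L i) ω) ⊗ₜ
      (Module.finBasis 𝕜 L).coord i := by
  simp [J, deRham]

/-- The operator `x ↦ (J ⊗ 1)(x)` from `O(L) ⊗ End(E)` to `O(A) ⊗ L^∨ ⊗ End(E)`. -/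
noncomputable def JEnd (ℒ : ℤ → Submodule 𝕜 L) [DirectSum.Decomposition ℒ] (A : Submodule 𝕜 L)
    (E : Type*) [AddCommGroup E] [Module 𝕜 E] :
    Series ℒ ⊗[𝕜] Module.End 𝕜 E →ₗ[𝕜] LCochain ℒ A E :=
  (TensorProduct.assoc 𝕜 (Series (subGr ℒ A)) (Module.Dual 𝕜 L) (Module.End 𝕜 E)).toLinearMap ∘ₗ
    LinearMap.rTensor (Module.End 𝕜 E) (J ℒ A)

theorem JEnd_tmul (ω : Series ℒ) (ψ : Module.End 𝕜 E) : JEnd ℒ A E (ω ⊗ₜ ψ) =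
    TensorProduct.assoc 𝕜 (Series (subGr ℒ A)) (Module.Dual 𝕜 L) (Module.End 𝕜 E)
      (J ℒ A ω ⊗ₜ ψ) := rfl

section Degree

variable [CharZero 𝕜]

theorem J_mem {d : ℤ} {ω : Series ℒ} (hω : ω ∈ seriesGr ℒ d) :
    J ℒ A ω ∈ tensorGr (seriesGr (subGr ℒ A)) (dualGr ℒ) d := by
  obtain ⟨s, hs⟩ := exists_sum_proj ℒ
  let f : L →ₗ[𝕜] Series (subGr ℒ A) :=
    (restr ℒ A).toLinearMap ∘ₗ (seriesContrHom ℒ).flip ω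
  -- The projection is idempotent, so one copy can be moved to the dual factor. Every tensor then
  -- has homogeneous factors, of degrees d + n and -n.
  have h1 : ∀ n, ∑ i, f (proj ℒ n (Module.finBasis 𝕜 L i)) ⊗ₜ[𝕜] (Module.finBasis 𝕜 L).coord i =
      ∑ i, f (proj ℒ n (Module.finBasis 𝕜 L i)) ⊗ₜ[𝕜]
        ((Module.finBasis 𝕜 L).coord i ∘ₗ proj ℒ n) := by
    intro n
    have h := sum_tmul_comp (f ∘ₗ proj ℒ n) (proj ℒ n)
    simp only [LinearMap.comp_apply, proj_proj] at h
    exact h.symm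
  have h2 : J ℒ A ω = ∑ n ∈ s, ∑ i, f (proj ℒ n (Module.finBasis 𝕜 L i)) ⊗ₜ[𝕜]
        ((Module.finBasis 𝕜 L).coord i ∘ₗ proj ℒ n) := by
    rw [J_apply, ← Finset.sum_congr rfl fun n _ => h1 n, Finset.sum_comm]
    refine Finset.sum_congr rfl fun i _ => ?_
    rw [← TensorProduct.sum_tmul, ← map_sum, hs]
    rfl
  rw [h2]
  refine Submodule.sum_mem _ fun n _ => Submodule.sum_mem _ fun i _ => ?_
  exact tmul_mem_tensorGr (i := d + n) (j := -n) (by ring)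
    (restr_mem_seriesGr (seriesContr_mem ℒ (proj_mem ℒ n _) hω)) (comp_proj_mem_dualGr ℒ n _)

theorem JEnd_mem {d : ℤ} {x : Series ℒ ⊗[𝕜] Module.End 𝕜 E} (hx : x ∈ serEndGr ℒ ℰ d) :
    JEnd ℒ A E x ∈ cochainGr ℒ A ℰ d := by
  have : serEndGr ℒ ℰ d ≤ (cochainGr ℒ A ℰ d).comap (JEnd ℒ A E) :=
    tensorGr_le fun i j hij ω hω ψ hψ => assoc_mem_cochainGr hij (J_mem hω) hψ
  exact this hx

end Degree

variable [DirectSum.Decomposition (subGr ℒ A)]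

theorem lTensor_dualMap_J (ω : Series ℒ) :
    LinearMap.lTensor (Series (subGr ℒ A)) A.subtype.dualMap (J ℒ A ω) =
      deRham (subGr ℒ A) (restr ℒ A ω) := by
  have h := sum_tmul_comp ((restr ℒ A).toLinearMap ∘ₗ (seriesContrHom ℒ).flip ω) A.subtype
  have h2 : ∀ a : A, restr ℒ A (seriesContr ℒ (a : L) ω) =
      seriesContr (subGr ℒ A) a (restr ℒ A ω) := fun a =>
    pullback_seriesContr (𝒱 := subGr ℒ A) A.subtype (fun _ _ h => h) a ω
  simp only [J_apply, deRham, map_sum, LinearMap.lTensor_tmul, LinearMap.sum_apply,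
    LinearMap.comp_apply, LinearMap.flip_apply, TensorProduct.mk_apply, ← h2]
  exact h

variable [DirectSum.Decomposition ℰ]

theorem restrictCochain_JEnd {P : SHLiePair ℒ A} {M : SHModule P.toA ℰ}
    {N : Connection P.toL ℰ} (hN : Extends N M) :
    restrictCochain ℒ A E (JEnd ℒ A E N.D) = deRhamD M := by
  have h : ∀ (x : Series (subGr ℒ A) ⊗[𝕜] Module.Dual 𝕜 L) (ψ : Module.End 𝕜 E),
      restrictCochain ℒ A E (TensorProduct.assoc 𝕜 _ _ _ (x ⊗ₜ ψ)) =
        TensorProduct.assoc 𝕜 _ _ _ (LinearMap.lTensor (Series (subGr ℒ A))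
          A.subtype.dualMap x ⊗ₜ ψ) := by
    intro x ψ
    induction x using TensorProduct.induction_on with
    | zero => simp
    | add a c ha hc => simp only [TensorProduct.add_tmul, map_add, ha, hc]
    | tmul η ξ => simp [restrictCochain]
  rw [deRhamD, ← hN]
  generalize N.D = D
  induction D using TensorProduct.induction_on with
  | zero => simp
  | add a c ha hc => simp only [map_add, ha, hc]
  | tmul ω ψ =>
    rw [JEnd_tmul, h, lTensor_dualMap_J]
    simp

theorem mem_serEndGr_parity [CharZero 𝕜] {V : Type*} [AddCommGroup V] [Module 𝕜 V]
    {𝒱 : ℤ → Submodule 𝕜 V} [DirectSum.Decomposition 𝒱]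
    {i j : ℤ} (hij : i + j = 1) {ω : Series 𝒱} (hω : ω ∈ seriesGr 𝒱 i)
    {ψ : Module.End 𝕜 E} (hψ : ψ ∈ endGr ℰ j) :
    (seriesParity 𝒱 ω = ω ∧ endParity ℰ ψ = -ψ) ∨
      (seriesParity 𝒱 ω = -ω ∧ endParity ℰ ψ = ψ) := by
  rw [seriesParity_of_mem 𝒱 hω, endParity_of_mem ℰ hψ]
  rcases Int.even_or_odd i with hi | hi
  · left
    rw [Int.negOnePow_even _ hi, Int.negOnePow_odd j (by
      obtain ⟨k, rfl⟩ := hi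
      exact ⟨-k, by omega⟩)]
    simp
  · right
    rw [Int.negOnePow_odd _ hi, Int.negOnePow_even j (by
      obtain ⟨k, rfl⟩ := hi
      exact ⟨-k, by omega⟩)]
    simp

variable [CharZero 𝕜]

/-- This matches the first term of the bracket [D^{A,E}, φ] with the part of D ∘ D in which J acts
on the second factor. The hypothesis on (η, ψ) is total degree 1: opposite parities make the sign of
passing ω beyond ψ agree with that of exchanging the two series. -/
theorem koszulMk_J_restr {ω η : Series ℒ} {φ ψ : Module.End 𝕜 E}
    (hω : seriesParity ℒ ω = ω ∨ seriesParity ℒ ω = -ω)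
    (hη : (seriesParity ℒ η = η ∧ endParity ℰ ψ = -ψ) ∨
      (seriesParity ℒ η = -η ∧ endParity ℰ ψ = ψ)) :
    koszulMk ℒ A E (totalParity (subGr ℒ A) (dualParity ℒ) (J ℒ A ω))
      (restr ℒ A η ⊗ₜ (ψ * φ)) =
      TensorProduct.assoc 𝕜 _ _ _
          ((restr ℒ A η • J ℒ A ω) ⊗ₜ (evenPart (endParity ℰ) ψ * φ)) +
        TensorProduct.assoc 𝕜 _ _ _
          ((restr ℒ A η • J ℒ A (seriesParity ℒ ω)) ⊗ₜ (oddPart (endParity ℰ) ψ * φ)) := by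
  rw [koszulMk_tmul, ← J_seriesParity]
  have hJ := J_seriesParity (A := A) ω
  have hr := restr_seriesParity (A := A) η
  have key : rmul (subGr ℒ A) (dualParity ℒ) (J ℒ A (seriesParity ℒ ω)) (restr ℒ A η) =
      restr ℒ A η • J ℒ A ω ∧ endParity ℰ ψ = ψ ∨
      rmul (subGr ℒ A) (dualParity ℒ) (J ℒ A (seriesParity ℒ ω)) (restr ℒ A η) =
      restr ℒ A η • J ℒ A (seriesParity ℒ ω) ∧ endParity ℰ ψ = -ψ := by
    rcases hω with h | h <;> rw [h] at hJ ⊢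
    · rw [rmul_of_even _ (dualParity_dualParity ℒ) hJ.symm]
      rcases hη with h | h
      · exact .inr ⟨rfl, h.2⟩
      · exact .inl ⟨rfl, h.2⟩
    · rw [map_neg] at hJ ⊢
      rw [map_neg, LinearMap.neg_apply, rmul_of_odd _ (dualParity_dualParity ℒ) hJ.symm, ← hr]
      rcases hη with h | h
      · exact .inr ⟨by rw [h.1, smul_neg], h.2⟩
      · exact .inl ⟨by rw [h.1, map_neg, neg_smul_series, neg_neg], h.2⟩
  rcases key with ⟨h1, h2⟩ | ⟨h1, h2⟩
  · rw [h1, evenPart_of_even h2, oddPart_of_even h2, zero_mul, TensorProduct.tmul_zero,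
      map_zero, add_zero]
  · rw [h1, evenPart_of_odd h2, oddPart_of_odd h2, zero_mul, TensorProduct.tmul_zero,
      map_zero, zero_add]

/-- The second term of the bracket gives the part of D ∘ D in which J acts on the first factor. The
sign -(-1)^|φ| of the bracket cancels the sign (-1)^|ω| of the tensor differential, because |ω| +
|φ| is odd. -/
theorem neg_koszulMk_J_comp {ω η : Series ℒ} {φ ψ : Module.End 𝕜 E}
    (hω : (seriesParity ℒ ω = ω ∧ endParity ℰ φ = -φ) ∨
      (seriesParity ℒ ω = -ω ∧ endParity ℰ φ = φ)) :
    -koszulMk ℒ A E (totalParity (subGr ℒ A) (dualParity ℒ) (J ℒ A ω))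
      (comp (subGr ℒ A) ℰ (1 ⊗ₜ endParity ℰ φ) (restr ℒ A η ⊗ₜ ψ)) =
      TensorProduct.assoc 𝕜 _ _ _
          (rmul (subGr ℒ A) (dualParity ℒ) (J ℒ A ω) (restr ℒ A η) ⊗ₜ
            (evenPart (endParity ℰ) φ * ψ)) +
        TensorProduct.assoc 𝕜 _ _ _
          (rmul (subGr ℒ A) (dualParity ℒ) (J ℒ A ω) (restr ℒ A (seriesParity ℒ η)) ⊗ₜ
            (oddPart (endParity ℰ) φ * ψ)) := by
  rw [← J_seriesParity, comp]
  rcases hω with ⟨h1, h2⟩ | ⟨h1, h2⟩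
  · rw [h1, evenPart_of_odd h2, oddPart_of_odd h2, h2, TensorProduct.tmul_neg, map_neg,
      LinearMap.neg_apply, map_neg, neg_neg, koszul_of_odd _ h2, one_mul, koszulMk_tmul,
      restr_seriesParity, zero_mul, TensorProduct.tmul_zero, map_zero, zero_add]
    rfl
  · rw [h1, evenPart_of_even h2, oddPart_of_even h2, h2, map_neg, map_neg, LinearMap.neg_apply,
      neg_neg, koszul_of_even _ h2, one_mul, koszulMk_tmul, zero_mul, TensorProduct.tmul_zero,
      map_zero, add_zero]
    rfl

variable (P : SHLiePair ℒ A) (M : SHModule P.toA ℰ)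

/-- This regroups the differential so that all of O(A) ⊗ L^∨ forms one factor x, to which
`SHLiePair.J_Q` applies when x = J(ω). -/
theorem cochainD_assoc (x : Series (subGr ℒ A) ⊗[𝕜] Module.Dual 𝕜 L) (ψ : Module.End 𝕜 E) :
    cochainD P M (TensorProduct.assoc 𝕜 _ _ _ (x ⊗ₜ ψ)) =
      TensorProduct.assoc 𝕜 _ _ _ (connOp (subGr ℒ A) P.toA.Q P.coadD x ⊗ₜ ψ) +
        koszulMk ℒ A E (totalParity (subGr ℒ A) (dualParity ℒ) x) (M.endD ψ) := by
  induction x using TensorProduct.induction_on with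
  | zero => simp
  | add a c ha hc =>
    simp only [TensorProduct.add_tmul, map_add, LinearMap.add_apply, ha, hc]; abel
  | tmul ω ξ =>
    have h1 : rmul (subGr ℒ A) (dualParity ℒ) (P.coadD ξ) 1 = P.coadD ξ := by
      have h1 : (seriesParity (subGr ℒ A)).toLinearMap 1 = 1 := map_one (seriesParity _)
      rw [rmul_eq _ (dualParity_dualParity ℒ), evenPart_of_even h1, oddPart_of_even h1, one_smul,
        zero_smul, add_zero]
    rw [TensorProduct.assoc_tmul, cochainD, connOp_tmul, connOp_tmul, totalParity_tmul]
    simp only [tensorD, TensorProduct.lift.tmul, LinearMap.add_apply, LinearMap.compl₁₂_apply,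
      LinearMap.comp_apply, one, TensorProduct.mk_apply]
    have h2 : koszulMk ℒ A E (seriesParity (subGr ℒ A) ω ⊗ₜ dualParity ℒ ξ) (M.endD ψ) =
        seriesParity (subGr ℒ A) ω • koszulMk ℒ A E (1 ⊗ₜ dualParity ℒ ξ) (M.endD ψ) := by
      rw [koszulMk, ← koszul_smul, smul_tmul_series, mul_one]
    have h3 := koszulMk_tmul (ℒ := ℒ) (A := A) (P.coadD ξ) 1 ψ
    rw [h1] at h3
    rw [TensorProduct.add_tmul, map_add, TensorProduct.assoc_tmul, ← assoc_smul, ← h3, h2,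
      add_assoc, ← smul_add]
    rfl

theorem JEnd_comp (ω η : Series ℒ) (φ ψ : Module.End 𝕜 E) :
    JEnd ℒ A E (comp ℒ ℰ (ω ⊗ₜ φ) (η ⊗ₜ ψ)) =
      (TensorProduct.assoc 𝕜 _ _ _
          ((restr ℒ A ω • J ℒ A η) ⊗ₜ (evenPart (endParity ℰ) φ * ψ)) +
        TensorProduct.assoc 𝕜 _ _ _
          ((restr ℒ A ω • J ℒ A (seriesParity ℒ η)) ⊗ₜ (oddPart (endParity ℰ) φ * ψ))) +
      (TensorProduct.assoc 𝕜 _ _ _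
          (rmul (subGr ℒ A) (dualParity ℒ) (J ℒ A ω) (restr ℒ A η) ⊗ₜ
            (evenPart (endParity ℰ) φ * ψ)) +
        TensorProduct.assoc 𝕜 _ _ _
          (rmul (subGr ℒ A) (dualParity ℒ) (J ℒ A ω) (restr ℒ A (seriesParity ℒ η)) ⊗ₜ
            (oddPart (endParity ℰ) φ * ψ))) := by
  rw [comp, koszul_tmul, map_add, JEnd_tmul, JEnd_tmul, J_mul, J_mul]
  simp only [TensorProduct.add_tmul, map_add, LinearMap.mul_apply']
  abel

/-- The curvature is mapped by `J` to the differential of the image of the connection form. -/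
theorem atiyahCocycle_eq (N : Connection P.toL ℰ) (hN : Extends N M) :
    atiyahCocycle N = cochainD P M (JEnd ℒ A E N.D) := by
  obtain ⟨k, ω, ψ, i, j, hD, hij⟩ := exists_sum_of_mem_tensorGr N.degree
  have hpar := fun a => mem_serEndGr_parity (hij a).1 (hij a).2.1 (hij a).2.2
  have hM : M.D = ∑ a, restr ℒ A (ω a) ⊗ₜ ψ a := by
    rw [← hN, hD, map_sum]; rfl
  have hα : atiyahCocycle N = JEnd ℒ A E N.curvature := rfl
  have hJ : JEnd ℒ A E N.D = ∑ a, TensorProduct.assoc 𝕜 _ _ _ (J ℒ A (ω a) ⊗ₜ ψ a) := by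
    rw [hD, map_sum]; rfl
  have hQ : JEnd ℒ A E (LinearMap.rTensor (Module.End 𝕜 E) P.toL.Q N.D) =
      ∑ a, TensorProduct.assoc 𝕜 _ _ _
        (connOp (subGr ℒ A) P.toA.Q P.coadD (J ℒ A (ω a)) ⊗ₜ ψ a) := by
    rw [hD, map_sum, map_sum]
    refine Finset.sum_congr rfl fun a _ => ?_
    rw [LinearMap.rTensor_tmul, JEnd_tmul, P.J_Q]
  rw [hα, Connection.curvature, map_add, hQ, hJ, map_sum]
  simp only [cochainD_assoc, Finset.sum_add_distrib]
  -- The terms in Q_L(D) agree by `SHLiePair.J_Q`; what remains is D ∘ D against the commutator with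
  -- D^{A,E}.
  congr 1
  have hend : ∀ a, M.endD (ψ a) = ∑ b, (restr ℒ A (ω b) ⊗ₜ (ψ b * ψ a) -
      comp (subGr ℒ A) ℰ (1 ⊗ₜ endParity ℰ (ψ a)) (restr ℒ A (ω b) ⊗ₜ ψ b)) := by
    intro a
    simp only [Connection.endD, hM, LinearMap.sub_apply, LinearMap.comp_apply,
      LinearMap.flip_apply, map_sum, LinearMap.sum_apply, one, TensorProduct.mk_apply,
      Finset.sum_sub_distrib]
    simp only [comp, koszul_one_tmul, LinearMap.mul_apply']
  let Y := fun a b => TensorProduct.assoc 𝕜 (Series (subGr ℒ A)) _ _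
          ((restr ℒ A (ω a) • J ℒ A (ω b)) ⊗ₜ (evenPart (endParity ℰ) (ψ a) * ψ b)) +
        TensorProduct.assoc 𝕜 _ _ _ ((restr ℒ A (ω a) • J ℒ A (seriesParity ℒ (ω b))) ⊗ₜ
          (oddPart (endParity ℰ) (ψ a) * ψ b))
  let Z := fun a b => TensorProduct.assoc 𝕜 (Series (subGr ℒ A)) _ _
          (rmul (subGr ℒ A) (dualParity ℒ) (J ℒ A (ω a)) (restr ℒ A (ω b)) ⊗ₜ
            (evenPart (endParity ℰ) (ψ a) * ψ b)) +
        TensorProduct.assoc 𝕜 _ _ _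
          (rmul (subGr ℒ A) (dualParity ℒ) (J ℒ A (ω a)) (restr ℒ A (seriesParity ℒ (ω b))) ⊗ₜ
            (oddPart (endParity ℰ) (ψ a) * ψ b))
  have hYZ : JEnd ℒ A E (comp ℒ ℰ N.D N.D) = ∑ a, ∑ b, (Y a b + Z a b) := by
    simp only [hD, map_sum, LinearMap.sum_apply, JEnd_comp]
    rw [Finset.sum_comm]
  have hY : ∀ a b, koszulMk ℒ A E (totalParity (subGr ℒ A) (dualParity ℒ) (J ℒ A (ω a)))
      (restr ℒ A (ω b) ⊗ₜ (ψ b * ψ a)) = Y b a := fun a b =>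
    koszulMk_J_restr (by rcases hpar a with h | h <;> simp [h.1]) (hpar b)
  have hZ : ∀ a b, -koszulMk ℒ A E (totalParity (subGr ℒ A) (dualParity ℒ) (J ℒ A (ω a)))
      (comp (subGr ℒ A) ℰ (1 ⊗ₜ endParity ℰ (ψ a)) (restr ℒ A (ω b) ⊗ₜ ψ b)) = Z a b :=
    fun a b => neg_koszulMk_J_comp (hpar a)
  have hK : ∀ a, koszulMk ℒ A E (totalParity (subGr ℒ A) (dualParity ℒ) (J ℒ A (ω a)))
      (M.endD (ψ a)) = ∑ b, (Y b a + Z a b) := by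
    intro a
    rw [hend, map_sum]
    refine Finset.sum_congr rfl fun b _ => ?_
    rw [map_sub, hY, sub_eq_add_neg, hZ]
  rw [hYZ, Finset.sum_congr rfl fun a _ => hK a]
  simp only [Finset.sum_add_distrib]
  -- The bracket yields the terms Y with indices exchanged, as there J acts on the second factor of
  -- the product; the double sum over both indices is the same.
  rw [Finset.sum_comm]

end Cochains

end SHLie

namespace SHLie

/-! ### A right inverse of J on cochains with values in A^⊥. -/

section Integration

variable {𝕜 : Type*} [Field 𝕜] {L : Type*} [AddCommGroup L] [Module 𝕜 L]
  {ℒ : ℤ → Submodule 𝕜 L} {A : Submodule 𝕜 L} {E : Type*} [AddCommGroup E] [Module 𝕜 E]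
  {ℰ : ℤ → Submodule 𝕜 E}

/-- The map `ω ⊗ ξ ⊗ ψ ↦ p^∨(ω) ⊙ ξ ⊗ ψ` for a retraction `p`. -/
noncomputable def integrate (p : L →ₗ[𝕜] A) (hp : ∀ n, ∀ v ∈ ℒ n, p v ∈ subGr ℒ A n) :
    LCochain ℒ A E →ₗ[𝕜] Series ℒ ⊗[𝕜] Module.End 𝕜 E :=
  LinearMap.rTensor (Module.End 𝕜 E) (LinearMap.mul' 𝕜 (Series ℒ) ∘ₗ
    TensorProduct.map (pullback p hp).toLinearMap (seriesGen ℒ)) ∘ₗ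
      (TensorProduct.assoc 𝕜 _ _ _).symm.toLinearMap

theorem integrate_tmul (p : L →ₗ[𝕜] A) (hp : ∀ n, ∀ v ∈ ℒ n, p v ∈ subGr ℒ A n)
    (ω : Series (subGr ℒ A)) (ξ : Module.Dual 𝕜 L) (ψ : Module.End 𝕜 E) :
    integrate p hp (ω ⊗ₜ (ξ ⊗ₜ ψ)) = (pullback p hp ω * seriesGen ℒ ξ) ⊗ₜ ψ := by
  simp [integrate]

theorem integrate_mem (p : L →ₗ[𝕜] A) (hp : ∀ n, ∀ v ∈ ℒ n, p v ∈ subGr ℒ A n) {d : ℤ}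
    {x : LCochain ℒ A E} (hx : x ∈ cochainGr ℒ A ℰ d) : integrate p hp x ∈ serEndGr ℒ ℰ d := by
  have : cochainGr ℒ A ℰ d ≤ (serEndGr ℒ ℰ d).comap (integrate p hp) := by
    refine tensorGr_le fun i j hij ω hω t ht => ?_
    have : tensorGr (dualGr ℒ) (endGr ℰ) j ≤ (serEndGr ℒ ℰ d).comap
        (integrate p hp ∘ₗ TensorProduct.mk 𝕜 _ _ ω) := by
      refine tensorGr_le fun k l hkl ξ hξ ψ hψ => ?_
      simp only [Submodule.mem_comap, LinearMap.comp_apply, TensorProduct.mk_apply,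
        integrate_tmul]
      exact tmul_mem_tensorGr (i := i + k) (j := l) (by omega)
        (mul_mem_seriesGr ℒ (pullback_mem_seriesGr p hp hω) (seriesGen_mem_seriesGr ℒ hξ)) hψ
    exact this ht
  exact this hx

end Integration

/-! ### Construction of extending connections; conditions 1, 2 and 4. -/

section Extension

variable {𝕜 : Type*} [Field 𝕜] {L : Type*} [AddCommGroup L] [Module 𝕜 L]
  [FiniteDimensional 𝕜 L] {ℒ : ℤ → Submodule 𝕜 L} [DirectSum.Decomposition ℒ]
  {A : Submodule 𝕜 L} [DirectSum.Decomposition (subGr ℒ A)]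
  {E : Type*} [AddCommGroup E] [Module 𝕜 E] {ℰ : ℤ → Submodule 𝕜 E}

/-- A graded subspace has a retraction of degree `0`. -/
theorem exists_graded_retraction (ℒ : ℤ → Submodule 𝕜 L) [DirectSum.Decomposition ℒ]
    (A : Submodule 𝕜 L) [DirectSum.Decomposition (subGr ℒ A)] :
    ∃ p : L →ₗ[𝕜] A, (∀ n, ∀ v ∈ ℒ n, p v ∈ subGr ℒ A n) ∧ ∀ a : A, p a = a := by
  obtain ⟨r, hr⟩ := A.subtype.exists_leftInverse_of_injective A.ker_subtype
  have hr' : ∀ a : A, r a = a := fun a => DFunLike.congr_fun hr a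
  obtain ⟨s, hs⟩ := exists_sum_proj ℒ
  have hproj : ∀ n (a : A), proj ℒ n a = (proj (subGr ℒ A) n a : L) := by
    intro n
    have : proj ℒ n ∘ₗ A.subtype = A.subtype ∘ₗ proj (subGr ℒ A) n := by
      refine graded_linear_ext (subGr ℒ A) fun m a ha => ?_
      have ha' : (a : L) ∈ ℒ m := ha
      by_cases h : m = n
      · subst h
        simp [proj_of_mem _ ha, proj_of_mem _ ha']
      · simp [proj_of_mem_ne _ ha h, proj_of_mem_ne _ ha' h]
    exact fun a => DFunLike.congr_fun this a
  -- The degree-0 component of an arbitrary retraction is still a retraction, because the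
  -- projections of L restrict to those of A.
  refine ⟨∑ n ∈ s, proj (subGr ℒ A) n ∘ₗ r ∘ₗ proj ℒ n, fun m v hv => ?_, fun a => ?_⟩
  · rw [LinearMap.sum_apply]
    refine Submodule.sum_mem _ fun n _ => ?_
    by_cases h : m = n
    · subst h
      exact proj_mem _ _ _
    · simp [proj_of_mem_ne _ hv h]
  · simp only [LinearMap.sum_apply, LinearMap.comp_apply, hproj, hr', proj_proj]
    apply Subtype.ext
    rw [← Submodule.subtype_apply, map_sum]
    simp only [Submodule.subtype_apply, ← hproj, hs]

variable [CharZero 𝕜]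

/-- For ξ in A^⊥ the product p^∨(ω) ξ restricts to 0 on A. In `J_mul` the term containing the
restriction of ξ disappears and the other one is ω ⊗ ξ, so no combinatorial factor has to be divided
out. -/
theorem integrate_perp (p : L →ₗ[𝕜] A) (hp : ∀ n, ∀ v ∈ ℒ n, p v ∈ subGr ℒ A n)
    (hpA : ∀ a : A, p a = a) {x : LCochain ℒ A E} (hx : x ∈ perpCochain ℒ A E) :
    LinearMap.rTensor (Module.End 𝕜 E) (restr ℒ A).toLinearMap (integrate p hp x) = 0 ∧
      JEnd ℒ A E (integrate p hp x) = x := by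
  have hrp : ∀ ω, restr ℒ A (pullback p hp ω) = ω :=
    pullback_pullback_of_leftInverse (𝒱 := subGr ℒ A) A.subtype (fun _ _ h => h) p hp hpA
  have hgen : ∀ ξ : A.dualAnnihilator, restr ℒ A (seriesGen ℒ ξ.1) = 0 := by
    intro ξ
    have h : A.subtype.dualMap ξ.1 = 0 := by
      ext a
      exact (Submodule.mem_dualAnnihilator _).1 ξ.2 a a.2
    have := pullback_seriesGen (𝒱 := subGr ℒ A) A.subtype (fun _ _ h => h) ξ.1
    rw [h, map_zero] at this
    exact this
  obtain ⟨y, rfl⟩ := hx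
  induction y using TensorProduct.induction_on with
  | zero => simp
  | add a c ha hc =>
    simp only [map_add, ha.1, ha.2, hc.1, hc.2, add_zero, and_self]
  | tmul ω t =>
    induction t using TensorProduct.induction_on with
    | zero => simp
    | add a c ha hc =>
      simp only [TensorProduct.tmul_add, map_add, ha.1, ha.2, hc.1, hc.2, add_zero, and_self]
    | tmul ξ ψ =>
      rw [LinearMap.lTensor_tmul, LinearMap.rTensor_tmul, integrate_tmul]
      constructor
      · rw [LinearMap.rTensor_tmul, AlgHom.toLinearMap_apply, map_mul]
        simp only [Submodule.subtype_apply]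
        rw [hgen, mul_zero, TensorProduct.zero_tmul]
      · rw [JEnd_tmul, J_mul]
        simp only [Submodule.subtype_apply]
        rw [hgen, map_zero, add_zero, hrp, J_seriesGen, smul_tmul_series, mul_one,
          TensorProduct.assoc_tmul]

variable [DirectSum.Decomposition ℰ] {P : SHLiePair ℒ A} (M : SHModule P.toA ℰ)

/-- An element of `O(A) ⊗ L^∨ ⊗ End(E)` that restricts to `(I^A ⊗ 1)(D^{A,E})` is the image of a
connection form that extends `(A, E)`. -/
theorem exists_connection (φ : LCochain ℒ A E) (hφ : φ ∈ cochainGr ℒ A ℰ 1)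
    (hr : restrictCochain ℒ A E φ = deRhamD M) :
    ∃ N : Connection P.toL ℰ, Extends N M ∧ JEnd ℒ A E N.D = φ := by
  obtain ⟨p, hp, hpA⟩ := exists_graded_retraction ℒ A
  have hrp : ∀ ω, restr ℒ A (pullback p hp ω) = ω :=
    pullback_pullback_of_leftInverse (𝒱 := subGr ℒ A) A.subtype (fun _ _ h => h) p hp hpA
  -- The pullback of D^{A,E} along the retraction is a first extension, with no control yet over its
  -- image under J.
  let D₀ := LinearMap.rTensor (Module.End 𝕜 E) (pullback p hp).toLinearMap M.D
  have hD₀ : D₀ ∈ serEndGr ℒ ℰ 1 := by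
    have : serEndGr (subGr ℒ A) ℰ 1 ≤ (serEndGr ℒ ℰ 1).comap
        (LinearMap.rTensor (Module.End 𝕜 E) (pullback p hp).toLinearMap) :=
      tensorGr_le fun i j hij ω hω ψ hψ =>
        tmul_mem_tensorGr hij (pullback_mem_seriesGr p hp hω) hψ
    exact this M.degree
  have hext : LinearMap.rTensor (Module.End 𝕜 E) (restr ℒ A).toLinearMap D₀ = M.D := by
    have : (restr ℒ A).toLinearMap ∘ₗ (pullback p hp).toLinearMap = LinearMap.id :=
      LinearMap.ext hrp
    rw [← LinearMap.comp_apply, ← LinearMap.rTensor_comp, this, LinearMap.rTensor_id]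
    rfl
  let N₀ : Connection P.toL ℰ := ⟨D₀, hD₀⟩
  have hN₀ : restrictCochain ℒ A E (JEnd ℒ A E D₀) = deRhamD M :=
    restrictCochain_JEnd (N := N₀) hext
  -- Both terms have the same restriction to A, so their difference can be integrated to a
  -- correction of D₀ that vanishes on A.
  have hperp : φ - JEnd ℒ A E D₀ ∈ perpCochain ℒ A E :=
    mem_perpCochain (by rw [map_sub, hr, hN₀, sub_self])
  obtain ⟨h1, h2⟩ := integrate_perp p hp hpA hperp
  refine ⟨⟨D₀ + integrate p hp (φ - JEnd ℒ A E D₀), Submodule.add_mem _ hD₀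
    (integrate_mem p hp (Submodule.sub_mem _ hφ (JEnd_mem hD₀)))⟩, ?_, ?_⟩
  · change LinearMap.rTensor (Module.End 𝕜 E) (restr ℒ A).toLinearMap (_ + _) = _
    rw [map_add, hext, h1, add_zero]
  · change JEnd ℒ A E (_ + _) = _
    rw [map_add, h2, add_sub_cancel]

/-- As D runs through the extending connections, J(D) runs through all cochains of degree 1 with the
prescribed restriction, and the Atiyah cocycle is the differential of J(D). -/
theorem exists_flat_iff :
    (∃ φ ∈ cochainGr ℒ A ℰ 1, cochainD P M φ = 0 ∧ restrictCochain ℒ A E φ = deRhamD M) ↔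
      ∃ N : Connection P.toL ℰ, Extends N M ∧ atiyahCocycle N = 0 := by
  constructor
  · rintro ⟨φ, hφ, hd, hr⟩
    obtain ⟨N, hN, hJ⟩ := exists_connection M φ hφ hr
    exact ⟨N, hN, by rw [atiyahCocycle_eq P M N hN, hJ, hd]⟩
  · rintro ⟨N, hN, hα⟩
    exact ⟨JEnd ℒ A E N.D, JEnd_mem N.degree, by rw [← atiyahCocycle_eq P M N hN, hα],
      restrictCochain_JEnd hN⟩

/-- The class of the Atiyah cocycle does not depend on the connection. -/
theorem atiyahCocycle_sub_mem {N N' : Connection P.toL ℰ} (hN : Extends N M)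
    (hN' : Extends N' M) : atiyahCocycle N - atiyahCocycle N' ∈ coboundaries P M := by
  rw [atiyahCocycle_eq P M N hN, atiyahCocycle_eq P M N' hN', ← map_sub]
  refine Submodule.mem_map_of_mem ⟨mem_perpCochain ?_,
    Submodule.sub_mem _ (JEnd_mem N.degree) (JEnd_mem N'.degree)⟩
  rw [map_sub, restrictCochain_JEnd hN, restrictCochain_JEnd hN', sub_self]

/-- A primitive with values in A^⊥ restricts to zero, so it may be subtracted from J(D) without
changing the restriction. Conversely, equality with the singleton needs two things: a connection
with zero cocycle shows that 0 occurs, and independence of the connection shows that nothing else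
does. -/
theorem atiyahClasses_eq_iff :
    atiyahClasses M = {0} ↔
      ∃ φ ∈ cochainGr ℒ A ℰ 1, cochainD P M φ = 0 ∧ restrictCochain ℒ A E φ = deRhamD M := by
  constructor
  · intro h
    have h0 : (0 : LCochain ℒ A E ⧸ coboundaries P M) ∈ atiyahClasses M := by rw [h]; rfl
    obtain ⟨-, N, hN, hα⟩ := h0
    have hα' : atiyahCocycle N ∈ coboundaries P M := by
      rwa [Submodule.mkQ_apply, Submodule.Quotient.mk_eq_zero] at hα
    obtain ⟨ψ, ⟨hψ, hψ1⟩, hd⟩ := hα'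
    refine ⟨JEnd ℒ A E N.D - ψ, Submodule.sub_mem _ (JEnd_mem N.degree) hψ1, ?_, ?_⟩
    · rw [map_sub, hd, atiyahCocycle_eq P M N hN, sub_self]
    · rw [map_sub, restrictCochain_JEnd hN, restrictCochain_of_mem hψ, sub_zero]
  · rw [exists_flat_iff]
    rintro ⟨N, hN, hα⟩
    refine Set.eq_singleton_iff_unique_mem.2 ⟨⟨Submodule.zero_mem _, N, hN, ?_⟩, ?_⟩
    · rw [hα, map_zero]
    · rintro c ⟨-, N', hN', rfl⟩
      have := atiyahCocycle_sub_mem M hN' hN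
      rw [hα, sub_zero] at this
      rwa [Submodule.mkQ_apply, Submodule.Quotient.mk_eq_zero]

end Extension

end SHLie

namespace SHLie

/-! ### Iterated contractions and their signs. -/

section Separation

variable {𝕜 : Type*} [Field 𝕜] {V : Type*} [AddCommGroup V] [Module 𝕜 V]
  (𝒱 : ℤ → Submodule 𝕜 V) {X : Type*} [AddCommGroup X] [Module 𝕜 X]

/-- The elements of `O(V) ⊗ X` are determined by their components in `Sⁿ(V^∨) ⊗ X`. -/
theorem eq_zero_of_coeff_eq_zero {t : Series 𝒱 ⊗[𝕜] X}
    (h : ∀ n, LinearMap.rTensor X (coeff 𝒱 n) t = 0) : t = 0 := by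
  classical
  -- X may be infinite-dimensional, but an element of the algebraic tensor product has finitely many
  -- nonzero coordinates in O(V) along a basis of X, and each of these is determined by its
  -- components.
  let b := Module.Basis.ofVectorSpace 𝕜 X
  have key : ∀ n i (t : Series 𝒱 ⊗[𝕜] X),
      coeff 𝒱 n (TensorProduct.equivFinsuppOfBasisRight b t i) =
        TensorProduct.equivFinsuppOfBasisRight b (LinearMap.rTensor X (coeff 𝒱 n) t) i := by
    intro n i t
    induction t using TensorProduct.induction_on with
    | zero => simp
    | add a c ha hc => simp only [map_add, Finsupp.add_apply, ha, hc]
    | tmul ω x => simp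
  apply (TensorProduct.equivFinsuppOfBasisRight b).injective
  rw [map_zero]
  ext i
  refine series_ext fun n => ?_
  rw [key, h n]
  simp

theorem coeff_zero_eq_seriesConst (ω : Series 𝒱) : coeff 𝒱 0 ω = seriesConst 𝒱 ω • 1 := by
  obtain ⟨c, hc⟩ := coeff_zero_eq_algebraMap 𝒱 ω
  simp [seriesConst, hc]

variable [DirectSum.Decomposition 𝒱]

theorem contr_tmul (σ : X →ₗ[𝕜] X) (v : V) (ω : Series 𝒱) (x : X) :
    contr 𝒱 σ v (ω ⊗ₜ x) = seriesContr 𝒱 (evenPart (parity 𝒱) v) ω ⊗ₜ x +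
      seriesContr 𝒱 (oddPart (parity 𝒱) v) ω ⊗ₜ σ x := rfl

theorem parity_cases {n : ℤ} {v : V} (hv : v ∈ 𝒱 n) :
    (Even n ∧ parity 𝒱 v = v) ∨ (Odd n ∧ parity 𝒱 v = -v) := by
  rw [parity_of_mem 𝒱 hv]
  rcases Int.even_or_odd n with h | h
  · exact .inl ⟨h, by rw [Int.negOnePow_even _ h, one_smul]⟩
  · exact .inr ⟨h, by rw [Int.negOnePow_odd _ h, Units.neg_smul, one_smul]⟩

theorem evalList_cons (σ : X →ₗ[𝕜] X) (t : Series 𝒱 ⊗[𝕜] X) (v : V) (vs : List V) :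
    evalList 𝒱 σ t (v :: vs) = evalList 𝒱 σ (contr 𝒱 σ v t) vs := rfl

/-- The value on a list as a linear map. -/
noncomputable def evalListHom (σ : X →ₗ[𝕜] X) (vs : List V) : Series 𝒱 ⊗[𝕜] X →ₗ[𝕜] X where
  toFun t := evalList 𝒱 σ t vs
  map_add' t t' := by
    induction vs generalizing t t' with
    | nil => simp [evalList]
    | cons v vs ih => rw [evalList_cons, map_add, ih]; rfl
  map_smul' c t := by
    induction vs generalizing t with
    | nil => simp [evalList]
    | cons v vs ih => rw [evalList_cons, map_smul, ih]; rfl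

theorem evalListHom_apply (σ : X →ₗ[𝕜] X) (vs : List V) (t : Series 𝒱 ⊗[𝕜] X) :
    evalListHom 𝒱 σ vs t = evalList 𝒱 σ t vs := rfl

/-- The iterated contraction. -/
noncomputable def contrList (vs : List V) (ω : Series 𝒱) : Series 𝒱 :=
  vs.foldl (fun s v => seriesContr 𝒱 v s) ω

theorem contrList_nil (ω : Series 𝒱) : contrList 𝒱 [] ω = ω := rfl

theorem contrList_cons (v : V) (vs : List V) (ω : Series 𝒱) :
    contrList 𝒱 (v :: vs) ω = contrList 𝒱 vs (seriesContr 𝒱 v ω) := rfl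

theorem contrList_smul (vs : List V) (c : ℤˣ) (ω : Series 𝒱) :
    contrList 𝒱 vs (c • ω) = c • contrList 𝒱 vs ω := by
  induction vs generalizing ω with
  | nil => rfl
  | cons v vs ih =>
    rw [contrList_cons, contrList_cons, ← ih, Units.smul_def, Units.smul_def, map_zsmul]

theorem seriesConst_seriesParity (ω : Series 𝒱) :
    seriesConst 𝒱 (seriesParity 𝒱 ω) = seriesConst 𝒱 ω := by
  obtain ⟨c, hc⟩ := coeff_zero_eq_algebraMap 𝒱 ω
  simp [seriesConst, coeff_seriesParity, hc]

/-- Each contraction shifts the parity by that of its vector. As constants are even, the constant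
term of an iterated contraction vanishes unless the parity of ω is that of the sum of the degrees.
-/
theorem seriesParity_contrList {k : ℕ} {n : Fin k → ℤ} {v : Fin k → V}
    (hv : ∀ i, v i ∈ 𝒱 (n i)) (ω : Series 𝒱) :
    seriesParity 𝒱 (contrList 𝒱 (List.ofFn v) ω) =
      (∑ i, n i).negOnePow • contrList 𝒱 (List.ofFn v) (seriesParity 𝒱 ω) := by
  induction k generalizing ω with
  | zero => simp [contrList_nil]
  | succ k ih =>
    rw [List.ofFn_succ, Fin.sum_univ_succ, Int.negOnePow_add, contrList_cons, contrList_cons]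
    have h : seriesContr 𝒱 (parity 𝒱 (v 0)) (seriesParity 𝒱 ω) =
        (n 0).negOnePow • seriesContr 𝒱 (v 0) (seriesParity 𝒱 ω) := by
      rw [parity_of_mem 𝒱 (hv 0), ← seriesContrHom_apply, Units.smul_def, map_zsmul]
      rfl
    rw [ih fun i => hv i.succ, seriesParity_seriesContr, h, contrList_smul, smul_smul, mul_comm]

variable [CharZero 𝕜]

theorem contr_of_even (σ : X →ₗ[𝕜] X) {v : V} (hv : parity 𝒱 v = v) :
    contr 𝒱 σ v = LinearMap.rTensor X (seriesContr 𝒱 v) :=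
  TensorProduct.ext' fun ω x => by
    rw [contr_tmul, evenPart_of_even hv, oddPart_of_even hv, seriesContr_zero,
      LinearMap.zero_apply, TensorProduct.zero_tmul, add_zero, LinearMap.rTensor_tmul]

theorem contr_of_odd (σ : X →ₗ[𝕜] X) {v : V} (hv : parity 𝒱 v = -v) :
    contr 𝒱 σ v = LinearMap.lTensor (Series 𝒱) σ ∘ₗ LinearMap.rTensor X (seriesContr 𝒱 v) :=
  TensorProduct.ext' fun ω x => by
    rw [contr_tmul, evenPart_of_odd hv, oddPart_of_odd hv, seriesContr_zero,
      LinearMap.zero_apply, TensorProduct.zero_tmul, zero_add]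
    rfl

/-- An element of `O(V) ⊗ X` is determined by its values on lists of homogeneous vectors. -/
theorem eq_zero_of_evalList_eq_zero [FiniteDimensional 𝕜 V] {σ : X →ₗ[𝕜] X}
    (hσ : ∀ x, σ (σ x) = x) {t : Series 𝒱 ⊗[𝕜] X}
    (h : ∀ vs : List V, (∀ v ∈ vs, ∃ n, v ∈ 𝒱 n) → evalList 𝒱 σ t vs = 0) : t = 0 := by
  refine eq_zero_of_coeff_eq_zero 𝒱 fun n => ?_
  induction n generalizing t with
  | zero =>
    have h0 := h [] (by simp)
    have h1 : LinearMap.rTensor X (seriesConst 𝒱) t = 0 := by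
      simpa [evalList] using h0
    have h2 : coeff 𝒱 0 = LinearMap.toSpanSingleton 𝕜 (SymDual 𝒱) 1 ∘ₗ seriesConst 𝒱 :=
      LinearMap.ext fun ω => by simp [coeff_zero_eq_seriesConst]
    rw [h2, LinearMap.rTensor_comp, LinearMap.comp_apply, h1, map_zero]
  | succ n ih =>
    -- The contraction of t with a homogeneous v again has only zero values, so its component of
    -- order n vanishes by induction. Linearity in v gives the rest.
    have hv : ∀ v, LinearMap.rTensor X (symContr 𝒱 v ∘ₗ coeff 𝒱 (n + 1)) t = 0 := by
      let F : V →ₗ[𝕜] SymDual 𝒱 ⊗[𝕜] X :=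
        { toFun := fun v => LinearMap.rTensor X (symContr 𝒱 v ∘ₗ coeff 𝒱 (n + 1)) t
          map_add' := fun v w => by
            rw [symContr_add, LinearMap.add_comp, LinearMap.rTensor_add, LinearMap.add_apply]
          map_smul' := fun c v => by
            rw [symContr_smul, LinearMap.smul_comp, LinearMap.rTensor_smul, LinearMap.smul_apply]
            rfl }
      have hF : F = 0 := by
        refine graded_linear_ext 𝒱 fun m v hm => ?_
        have h1 := ih (t := contr 𝒱 σ v t) fun vs hvs => by
          rw [← evalList_cons]
          refine h (v :: vs) fun w hw => ?_
          rcases List.mem_cons.1 hw with rfl | hw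
          · exact ⟨m, hm⟩
          · exact hvs w hw
        have h2 : coeff 𝒱 n ∘ₗ seriesContr 𝒱 v = symContr 𝒱 v ∘ₗ coeff 𝒱 (n + 1) :=
          LinearMap.ext fun ω => coeff_seriesContr 𝒱 v n ω
        change LinearMap.rTensor X (symContr 𝒱 v ∘ₗ coeff 𝒱 (n + 1)) t = 0
        rw [← h2, LinearMap.rTensor_comp, LinearMap.comp_apply]
        rcases parity_cases 𝒱 hm with ⟨-, hp⟩ | ⟨-, hp⟩
        · rwa [contr_of_even 𝒱 σ hp] at h1
        · rw [contr_of_odd 𝒱 σ hp, LinearMap.comp_apply, ← LinearMap.comp_apply,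
            LinearMap.rTensor_comp_lTensor, ← LinearMap.lTensor_comp_rTensor,
            LinearMap.comp_apply] at h1
          -- Contraction with an odd vector also applies σ to X; applying the involution again
          -- removes it.
          have h3 := congrArg (LinearMap.lTensor (SymDual 𝒱) σ) h1
          have h4 : σ ∘ₗ σ = LinearMap.id := LinearMap.ext hσ
          rwa [← LinearMap.comp_apply, ← LinearMap.lTensor_comp, h4, LinearMap.lTensor_id,
            map_zero] at h3
      exact fun v => DFunLike.congr_fun hF v
    -- Euler's formula recovers n + 1 times a component from its first contractions, and n + 1 is
    -- invertible in characteristic 0.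
    have he : ((n + 1 : ℕ) : 𝕜) • coeff 𝒱 (n + 1) =
        ∑ i, LinearMap.mulRight 𝕜 (gen 𝒱 ((Module.finBasis 𝕜 V).coord i)) ∘ₗ
          symContr 𝒱 (Module.finBasis 𝕜 V i) ∘ₗ coeff 𝒱 (n + 1) := by
      refine LinearMap.ext fun ω => ?_
      rw [LinearMap.smul_apply, ← sum_symContr_mul_gen 𝒱 (n + 1) _ (coeff_mem 𝒱 (n + 1) ω)]
      simp
    have he2 : ((n + 1 : ℕ) : 𝕜) • LinearMap.rTensor X (coeff 𝒱 (n + 1)) t = 0 := by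
      rw [← LinearMap.smul_apply, ← LinearMap.rTensor_smul, he]
      have : ∀ i, LinearMap.rTensor X (LinearMap.mulRight 𝕜
          (gen 𝒱 ((Module.finBasis 𝕜 V).coord i)) ∘ₗ
          symContr 𝒱 (Module.finBasis 𝕜 V i) ∘ₗ coeff 𝒱 (n + 1)) t = 0 := fun i => by
        rw [LinearMap.rTensor_comp, LinearMap.comp_apply, hv, map_zero]
      have hs := map_sum (LinearMap.rTensorHom X) (fun i => LinearMap.mulRight 𝕜
          (gen 𝒱 ((Module.finBasis 𝕜 V).coord i)) ∘ₗ
          symContr 𝒱 (Module.finBasis 𝕜 V i) ∘ₗ coeff 𝒱 (n + 1)) Finset.univ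
      simp only [LinearMap.coe_rTensorHom] at hs
      rw [hs, LinearMap.sum_apply, Finset.sum_eq_zero fun i _ => this i]
    exact (smul_eq_zero.1 he2).resolve_left (Nat.cast_ne_zero.2 n.succ_ne_zero)

theorem evalList_of_even {σ : X →ₗ[𝕜] X} {x : X} (hx : σ x = x) (vs : List V) (ω : Series 𝒱) :
    evalList 𝒱 σ (ω ⊗ₜ x) vs = seriesConst 𝒱 (contrList 𝒱 vs ω) • x := by
  induction vs generalizing ω with
  | nil => simp [evalList, contrList_nil]
  | cons v vs ih =>
    rw [evalList_cons, contr_tmul, hx, ← TensorProduct.add_tmul, ← LinearMap.add_apply,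
      ← seriesContr_add, evenPart_add_oddPart, ih]
    rfl

theorem evalList_of_odd {σ : X →ₗ[𝕜] X} {x : X} (hx : σ x = -x) {k : ℕ} {n : Fin k → ℤ}
    {v : Fin k → V} (hv : ∀ i, v i ∈ 𝒱 (n i)) (ω : Series 𝒱) :
    evalList 𝒱 σ (ω ⊗ₜ x) (List.ofFn v) =
      (∑ i, n i).negOnePow • (seriesConst 𝒱 (contrList 𝒱 (List.ofFn v) ω) • x) := by
  induction k generalizing ω with
  | zero => simp [evalList, contrList_nil]
  | succ k ih =>
    rw [List.ofFn_succ, evalList_cons, Fin.sum_univ_succ, Int.negOnePow_add]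
    have h1 : contr 𝒱 σ (v 0) (ω ⊗ₜ x) =
        (n 0).negOnePow • (seriesContr 𝒱 (v 0) ω ⊗ₜ[𝕜] x) := by
      rcases parity_cases 𝒱 (hv 0) with ⟨hn, hp⟩ | ⟨hn, hp⟩
      · rw [contr_of_even 𝒱 σ hp, Int.negOnePow_even _ hn, one_smul]
        rfl
      · rw [contr_of_odd 𝒱 σ hp, Int.negOnePow_odd _ hn]
        rw [LinearMap.comp_apply, LinearMap.rTensor_tmul, LinearMap.lTensor_tmul, hx,
          TensorProduct.tmul_neg, Units.neg_smul, one_smul]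
    rw [h1, ← evalListHom_apply, Units.smul_def, map_zsmul, evalListHom_apply,
      ih fun i => hv i.succ, ← Units.smul_def, smul_smul, contrList_cons]

theorem seriesContr_seriesContr {m n : ℤ} {u v : V} (hu : u ∈ 𝒱 m) (hv : v ∈ 𝒱 n)
    (ω : Series 𝒱) : seriesContr 𝒱 v (seriesContr 𝒱 u ω) =
      (m * n).negOnePow • seriesContr 𝒱 u (seriesContr 𝒱 v ω) := by
  rcases parity_cases 𝒱 hu with ⟨hm, hpu⟩ | ⟨hm, hpu⟩
  · rw [seriesContr_comm 𝒱 u v (.inl hpu) ((parity_cases 𝒱 hv).imp And.right And.right),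
      evenPart_of_even hpu, oddPart_of_even hpu, seriesContr_zero, LinearMap.zero_apply, add_zero,
      Int.negOnePow_even _ (hm.mul_right n), one_smul]
  · rw [seriesContr_comm 𝒱 u v (.inr hpu) ((parity_cases 𝒱 hv).imp And.right And.right),
      evenPart_of_odd hpu, oddPart_of_odd hpu, seriesContr_zero, LinearMap.zero_apply, zero_add]
    rcases parity_cases 𝒱 hv with ⟨hn, hpv⟩ | ⟨hn, hpv⟩
    · rw [hpv, Int.negOnePow_even _ (hn.mul_left m), one_smul]
    · rw [hpv, Int.negOnePow_odd _ (hm.mul hn), seriesContr_neg, LinearMap.neg_apply, map_neg,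
        Units.neg_smul, one_smul]

/-- In f_{k+1} the distinguished vector is contracted last, whereas the de Rham operator contracts
it first. Moving it to the front produces the Koszul sign. -/
theorem contrList_append {m : ℤ} {u : V} (hu : u ∈ 𝒱 m) {k : ℕ} {n : Fin k → ℤ}
    {v : Fin k → V} (hv : ∀ i, v i ∈ 𝒱 (n i)) (ω : Series 𝒱) :
    contrList 𝒱 (List.ofFn v ++ [u]) ω =
      (m * ∑ i, n i).negOnePow • contrList 𝒱 (List.ofFn v) (seriesContr 𝒱 u ω) := by
  induction k generalizing ω with
  | zero => simp [contrList_nil, contrList_cons]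
  | succ k ih =>
    rw [List.ofFn_succ, Fin.sum_univ_succ, mul_add, Int.negOnePow_add, List.cons_append,
      contrList_cons, contrList_cons, ih fun i => hv i.succ, seriesContr_seriesContr 𝒱 hu (hv 0), contrList_smul, smul_smul,
      mul_right_comm, Int.units_mul_self, one_mul]

end Separation

end SHLie

namespace SHLie

/-! ### Elements of S ⊗ U^∨ ⊗ Y as linear maps U → S ⊗ Y, and their O(V)-linear extension. -/

section Evaluation

variable {𝕜 : Type*} [Field 𝕜] {S : Type*} [AddCommGroup S] [Module 𝕜 S]
  {U : Type*} [AddCommGroup U] [Module 𝕜 U] {Y : Type*} [AddCommGroup Y] [Module 𝕜 Y]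

/-- The map `U → S ⊗ Y` that corresponds to an element of `S ⊗ U^∨ ⊗ Y`. -/
noncomputable def evalFactor (x : S ⊗[𝕜] (Module.Dual 𝕜 U ⊗[𝕜] Y)) : U →ₗ[𝕜] S ⊗[𝕜] Y where
  toFun u := LinearMap.lTensor S ((TensorProduct.lid 𝕜 Y).toLinearMap ∘ₗ
    LinearMap.rTensor Y (Module.Dual.eval 𝕜 U u)) x
  map_add' u v := by
    rw [map_add, LinearMap.rTensor_add, LinearMap.comp_add, LinearMap.lTensor_add,
      LinearMap.add_apply]
  map_smul' c u := by
    rw [map_smul, LinearMap.rTensor_smul, LinearMap.comp_smul, LinearMap.lTensor_smul,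
      LinearMap.smul_apply, RingHom.id_apply]

theorem evalFactor_tmul (s : S) (ξ : Module.Dual 𝕜 U) (y : Y) (u : U) :
    evalFactor (s ⊗ₜ (ξ ⊗ₜ y)) u = ξ u • (s ⊗ₜ[𝕜] y) := by
  simp [evalFactor]

theorem evalFactor_add (x x' : S ⊗[𝕜] (Module.Dual 𝕜 U ⊗[𝕜] Y)) :
    evalFactor (x + x') = evalFactor x + evalFactor x' :=
  LinearMap.ext fun u => (LinearMap.lTensor S ((TensorProduct.lid 𝕜 Y).toLinearMap ∘ₗ
    LinearMap.rTensor Y (Module.Dual.eval 𝕜 U u))).map_add x x'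

theorem evalFactor_zero : evalFactor (0 : S ⊗[𝕜] (Module.Dual 𝕜 U ⊗[𝕜] Y)) = 0 :=
  LinearMap.ext fun u => (LinearMap.lTensor S ((TensorProduct.lid 𝕜 Y).toLinearMap ∘ₗ
    LinearMap.rTensor Y (Module.Dual.eval 𝕜 U u))).map_zero

/-- The reordering `s ⊗ y ⊗ ξ ↦ s ⊗ ξ ⊗ y`. -/
noncomputable def insertFactor :
    (S ⊗[𝕜] Y) ⊗[𝕜] Module.Dual 𝕜 U →ₗ[𝕜] S ⊗[𝕜] (Module.Dual 𝕜 U ⊗[𝕜] Y) :=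
  LinearMap.lTensor S (TensorProduct.comm 𝕜 Y (Module.Dual 𝕜 U)).toLinearMap ∘ₗ
    (TensorProduct.assoc 𝕜 S Y (Module.Dual 𝕜 U)).toLinearMap

theorem insertFactor_tmul (s : S) (y : Y) (ξ : Module.Dual 𝕜 U) :
    insertFactor ((s ⊗ₜ[𝕜] y) ⊗ₜ[𝕜] ξ) = s ⊗ₜ (ξ ⊗ₜ y) := rfl

theorem evalFactor_insertFactor (x : S ⊗[𝕜] Y) (ξ : Module.Dual 𝕜 U) (u : U) :
    evalFactor (insertFactor (x ⊗ₜ ξ)) u = ξ u • x := by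
  induction x using TensorProduct.induction_on with
  | zero => simp [evalFactor_zero]
  | add a b ha hb =>
    rw [TensorProduct.add_tmul, map_add, evalFactor_add, LinearMap.add_apply, ha, hb, smul_add]
  | tmul s y => rw [insertFactor_tmul, evalFactor_tmul]

variable [FiniteDimensional 𝕜 U]

/-- The element of `S ⊗ U^∨ ⊗ Y` that corresponds to a map `U → S ⊗ Y`. -/
noncomputable def ofHom (T : U →ₗ[𝕜] S ⊗[𝕜] Y) : S ⊗[𝕜] (Module.Dual 𝕜 U ⊗[𝕜] Y) :=
  insertFactor (∑ i, T (Module.finBasis 𝕜 U i) ⊗ₜ (Module.finBasis 𝕜 U).coord i)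

theorem evalFactor_ofHom (T : U →ₗ[𝕜] S ⊗[𝕜] Y) : evalFactor (ofHom T) = T := by
  refine LinearMap.ext fun u => ?_
  let F : S ⊗[𝕜] (Module.Dual 𝕜 U ⊗[𝕜] Y) →ₗ[𝕜] S ⊗[𝕜] Y :=
    LinearMap.lTensor S ((TensorProduct.lid 𝕜 Y).toLinearMap ∘ₗ
      LinearMap.rTensor Y (Module.Dual.eval 𝕜 U u))
  have hF : ∀ x, evalFactor x u = F x := fun _ => rfl
  rw [hF, ofHom, map_sum, map_sum]
  simp only [← hF, evalFactor_insertFactor]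
  exact sum_coord_apply T u

theorem ofHom_evalFactor (x : S ⊗[𝕜] (Module.Dual 𝕜 U ⊗[𝕜] Y)) : ofHom (evalFactor x) = x := by
  rw [ofHom]
  induction x using TensorProduct.induction_on with
  | zero => simp [evalFactor_zero]
  | add a b ha hb =>
    simp only [evalFactor_add, LinearMap.add_apply, TensorProduct.add_tmul,
      Finset.sum_add_distrib, map_add]
    rw [ha, hb]
  | tmul s z =>
    induction z using TensorProduct.induction_on with
    | zero => simp [evalFactor_zero]
    | add a b ha hb =>
      simp only [TensorProduct.tmul_add, evalFactor_add, LinearMap.add_apply,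
        TensorProduct.add_tmul, Finset.sum_add_distrib, map_add]
      rw [ha, hb]
    | tmul ξ y =>
      simp only [evalFactor_tmul, TensorProduct.smul_tmul, ← TensorProduct.tmul_sum]
      rw [sum_coord_smul, insertFactor_tmul]

theorem evalFactor_injective :
    Function.Injective (evalFactor : S ⊗[𝕜] (Module.Dual 𝕜 U ⊗[𝕜] Y) → U →ₗ[𝕜] S ⊗[𝕜] Y) :=
  Function.LeftInverse.injective ofHom_evalFactor

end Evaluation

section Extend

variable {𝕜 : Type*} [Field 𝕜] {V : Type*} [AddCommGroup V] [Module 𝕜 V]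
  (𝒱 : ℤ → Submodule 𝕜 V) {U : Type*} [AddCommGroup U] [Module 𝕜 U]
  {Y : Type*} [AddCommGroup Y] [Module 𝕜 Y]

/-- The `O(V)`-linear extension `ω ⊗ u ↦ ω • T(u)`. -/
noncomputable def extendHom (T : U →ₗ[𝕜] Series 𝒱 ⊗[𝕜] Y) :
    Series 𝒱 ⊗[𝕜] U →ₗ[𝕜] Series 𝒱 ⊗[𝕜] Y :=
  TensorProduct.lift (LinearMap.mk₂ 𝕜 (fun ω u => ω • T u) (fun _ _ _ => add_smul _ _ _)
    (fun c ω u => smul_assoc c ω (T u)) (fun ω u v => by rw [map_add, smul_add])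
    (fun c ω u => by rw [map_smul, smul_comm]))

theorem extendHom_tmul (T : U →ₗ[𝕜] Series 𝒱 ⊗[𝕜] Y) (ω : Series 𝒱) (u : U) :
    extendHom 𝒱 T (ω ⊗ₜ u) = ω • T u := rfl

theorem extendHom_add (T T' : U →ₗ[𝕜] Series 𝒱 ⊗[𝕜] Y) (x : Series 𝒱 ⊗[𝕜] U) :
    extendHom 𝒱 (T + T') x = extendHom 𝒱 T x + extendHom 𝒱 T' x := by
  induction x using TensorProduct.induction_on with
  | zero => simp
  | add a b ha hb => rw [map_add, map_add, map_add, ha, hb]; abel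
  | tmul ω l => simp only [extendHom_tmul, LinearMap.add_apply, smul_add]

theorem extendHom_zero (x : Series 𝒱 ⊗[𝕜] U) :
    extendHom 𝒱 (0 : U →ₗ[𝕜] Series 𝒱 ⊗[𝕜] Y) x = 0 := by
  induction x using TensorProduct.induction_on with
  | zero => rw [map_zero]
  | add a b ha hb => rw [map_add, ha, hb, add_zero]
  | tmul ω l => rw [extendHom_tmul, LinearMap.zero_apply, smul_zero]

theorem extendHom_smul (T : U →ₗ[𝕜] Series 𝒱 ⊗[𝕜] Y) (ω : Series 𝒱) (x : Series 𝒱 ⊗[𝕜] U) :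
    extendHom 𝒱 T (ω • x) = ω • extendHom 𝒱 T x := by
  induction x using TensorProduct.induction_on with
  | zero => simp
  | add a b ha hb => rw [smul_add, map_add, map_add, ha, hb, smul_add]
  | tmul η u => rw [smul_tmul_series, extendHom_tmul, extendHom_tmul, smul_smul]

end Extend

/-! ### The sign twist between degree 1 maps and degree 0 maps into the shift. -/

section Shift

variable {𝕜 : Type*} [Field 𝕜] {V : Type*} [AddCommGroup V] [Module 𝕜 V]
  (𝒱 : ℤ → Submodule 𝕜 V) [DirectSum.Decomposition 𝒱]
  {U : Type*} [AddCommGroup U] [Module 𝕜 U] (𝒰 : ℤ → Submodule 𝕜 U) [DirectSum.Decomposition 𝒰]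
  {Y : Type*} [AddCommGroup Y] [Module 𝕜 Y]

/-- The involution `ω ⊗ y ↦ (-1)^|ω| ω ⊗ y`. -/
noncomputable def leftParity (Y : Type*) [AddCommGroup Y] [Module 𝕜 Y] :
    Series 𝒱 ⊗[𝕜] Y →ₗ[𝕜] Series 𝒱 ⊗[𝕜] Y :=
  LinearMap.rTensor Y (seriesParity 𝒱).toLinearMap

theorem leftParity_tmul (ω : Series 𝒱) (y : Y) :
    leftParity 𝒱 Y (ω ⊗ₜ y) = seriesParity 𝒱 ω ⊗ₜ y := rfl

theorem leftParity_leftParity (x : Series 𝒱 ⊗[𝕜] Y) :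
    leftParity 𝒱 Y (leftParity 𝒱 Y x) = x := by
  induction x using TensorProduct.induction_on with
  | zero => simp
  | add a b ha hb => rw [map_add, map_add, ha, hb]
  | tmul ω y => rw [leftParity_tmul, leftParity_tmul, seriesParity_seriesParity]

theorem leftParity_smul (ω : Series 𝒱) (x : Series 𝒱 ⊗[𝕜] Y) :
    leftParity 𝒱 Y (ω • x) = seriesParity 𝒱 ω • leftParity 𝒱 Y x := by
  induction x using TensorProduct.induction_on with
  | zero => simp
  | add a b ha hb => rw [smul_add, map_add, map_add, ha, hb, smul_add]
  | tmul η y =>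
    rw [smul_tmul_series, leftParity_tmul, leftParity_tmul, smul_tmul_series, map_mul]

/-- The isomorphism between maps `U → O(V) ⊗ Y` of degree `1` and maps `U → O(V) ⊗ Y[1]` of
degree `0`, with the signs of the action on the right of the former. -/
noncomputable def shiftHom (T : U →ₗ[𝕜] Series 𝒱 ⊗[𝕜] Y) : U →ₗ[𝕜] Series 𝒱 ⊗[𝕜] Y :=
  -(T ∘ₗ oddPart (parity 𝒰) + leftParity 𝒱 Y ∘ₗ T ∘ₗ evenPart (parity 𝒰))

theorem shiftHom_add (T T' : U →ₗ[𝕜] Series 𝒱 ⊗[𝕜] Y) :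
    shiftHom 𝒱 𝒰 (T + T') = shiftHom 𝒱 𝒰 T + shiftHom 𝒱 𝒰 T' := by
  simp only [shiftHom, LinearMap.add_comp, LinearMap.comp_add]
  abel

theorem shiftHom_zero : shiftHom 𝒱 𝒰 (0 : U →ₗ[𝕜] Series 𝒱 ⊗[𝕜] Y) = 0 := by
  refine LinearMap.ext fun u => ?_
  simp only [shiftHom, LinearMap.neg_apply, LinearMap.add_apply, LinearMap.comp_apply,
    LinearMap.zero_apply, map_zero, add_zero]
  exact neg_zero

theorem shiftHom_comp {W : Type*} [AddCommGroup W] [Module 𝕜 W] (𝒲 : ℤ → Submodule 𝕜 W)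
    [DirectSum.Decomposition 𝒲] (f : W →ₗ[𝕜] U) (hf : ∀ n, ∀ w ∈ 𝒲 n, f w ∈ 𝒰 n)
    (T : U →ₗ[𝕜] Series 𝒱 ⊗[𝕜] Y) : shiftHom 𝒱 𝒲 (T ∘ₗ f) = shiftHom 𝒱 𝒰 T ∘ₗ f := by
  have h : ∀ w, parity 𝒰 (f w) = f (parity 𝒲 w) := fun w => (map_parity (𝒱 := 𝒲) (𝒲 := 𝒰) f hf w).symm
  refine LinearMap.ext fun w => ?_
  simp [shiftHom, evenPart, oddPart, h]

variable [CharZero 𝕜]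

theorem shiftHom_of_even (T : U →ₗ[𝕜] Series 𝒱 ⊗[𝕜] Y) {u : U} (hu : parity 𝒰 u = u) :
    shiftHom 𝒱 𝒰 T u = -leftParity 𝒱 Y (T u) := by
  simp [shiftHom, evenPart_of_even hu, oddPart_of_even hu]

theorem shiftHom_of_odd (T : U →ₗ[𝕜] Series 𝒱 ⊗[𝕜] Y) {u : U} (hu : parity 𝒰 u = -u) :
    shiftHom 𝒱 𝒰 T u = -T u := by
  simp [shiftHom, evenPart_of_odd hu, oddPart_of_odd hu]

/-- The twist is its own inverse, so passing between cochains and morphisms loses nothing in either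
direction. -/
theorem shiftHom_shiftHom (T : U →ₗ[𝕜] Series 𝒱 ⊗[𝕜] Y) :
    shiftHom 𝒱 𝒰 (shiftHom 𝒱 𝒰 T) = T := by
  refine linear_ext_parity (parity_parity 𝒰) fun u hu => ?_
  rcases hu with hu | hu
  · rw [shiftHom_of_even 𝒱 𝒰 _ hu, shiftHom_of_even 𝒱 𝒰 _ hu, map_neg, leftParity_leftParity,
      neg_neg]
  · rw [shiftHom_of_odd 𝒱 𝒰 _ hu, shiftHom_of_odd 𝒱 𝒰 _ hu, neg_neg]

end Shift

end SHLie

namespace SHLie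

section Negation

variable {𝕜 : Type*} [Field 𝕜] {V : Type*} [AddCommGroup V] [Module 𝕜 V]
  {𝒱 : ℤ → Submodule 𝕜 V} {E : Type*} [AddCommGroup E] [Module 𝕜 E]

theorem neg_smul_serEnd (ω : Series 𝒱) (x : Series 𝒱 ⊗[𝕜] Module.End 𝕜 E) :
    (-ω) • x = -(ω • x) :=
  neg_smul ω x

theorem neg_scalar_smul_serEnd (c : 𝕜) (x : Series 𝒱 ⊗[𝕜] Module.End 𝕜 E) :
    (-c) • x = -(c • x) :=
  neg_smul c x

theorem smul_neg_serEnd (ω : Series 𝒱) (x : Series 𝒱 ⊗[𝕜] Module.End 𝕜 E) :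
    ω • -x = -(ω • x) :=
  smul_neg ω x

end Negation

/-! ### The differential on End(E)[1] and the pairing of cochains with vectors. -/

section Chain

variable {𝕜 : Type*} [Field 𝕜] {L : Type*} [AddCommGroup L] [Module 𝕜 L]
  {ℒ : ℤ → Submodule 𝕜 L} [DirectSum.Decomposition ℒ]
  {E : Type*} [AddCommGroup E] [Module 𝕜 E] {ℰ : ℤ → Submodule 𝕜 E} [DirectSum.Decomposition ℰ]

/-- Conjugating the odd operator Q by the parity changes its sign, which cancels the sign of the
shift. The shifted connection therefore satisfies the same Leibniz rule. -/
theorem Connection.endShiftOp_smul [CharZero 𝕜] [FiniteDimensional 𝕜 L] {G : SHLieAlgebra ℒ}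
    (N : Connection G ℰ) (ω : Series ℒ) (x : Series ℒ ⊗[𝕜] Module.End 𝕜 E) :
    N.endShiftOp (ω • x) = G.Q ω • x + seriesParity ℒ ω • N.endShiftOp x := by
  have h : ∀ y, N.endShiftOp y =
      -leftParity ℒ (Module.End 𝕜 E) (N.endOp (leftParity ℒ (Module.End 𝕜 E) y)) := fun _ => rfl
  have hQ : seriesParity ℒ (G.Q (seriesParity ℒ ω)) = -G.Q ω := by
    rw [G.seriesParity_Q, seriesParity_seriesParity]
  rw [h, h, leftParity_smul, endOp, connOp_smul, map_add, leftParity_smul, leftParity_smul, hQ,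
    leftParity_leftParity, seriesParity_seriesParity, neg_add, neg_smul_serEnd,
    neg_neg, smul_neg_serEnd]

theorem Connection.endShiftOp_one_tmul {G : SHLieAlgebra ℒ} (N : Connection G ℰ)
    (ψ : Module.End 𝕜 E) :
    N.endShiftOp (1 ⊗ₜ ψ) = -leftParity ℒ (Module.End 𝕜 E) (N.endD ψ) := by
  have h : ∀ y, N.endShiftOp y =
      -leftParity ℒ (Module.End 𝕜 E) (N.endOp (leftParity ℒ (Module.End 𝕜 E) y)) := fun _ => rfl
  rw [h, leftParity_tmul, map_one, endOp, connOp_one_tmul]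

end Chain

section Assoc

variable {𝕜 : Type*} [Field 𝕜] {L : Type*} [AddCommGroup L] [Module 𝕜 L]
  {ℒ : ℤ → Submodule 𝕜 L} {A : Submodule 𝕜 L} {E : Type*} [AddCommGroup E] [Module 𝕜 E]

theorem evalFactor_assoc (x : Series (subGr ℒ A) ⊗[𝕜] Module.Dual 𝕜 L) (ψ : Module.End 𝕜 E)
    (l : L) : evalFactor (TensorProduct.assoc 𝕜 _ _ _ (x ⊗ₜ[𝕜] ψ)) l = evalAt A l x ⊗ₜ ψ := by
  induction x using TensorProduct.induction_on with
  | zero => simp [evalFactor_zero]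
  | add a c ha hc =>
    rw [TensorProduct.add_tmul, map_add, evalFactor_add, LinearMap.add_apply, ha, hc, map_add,
      TensorProduct.add_tmul]
  | tmul ω ξ =>
    rw [TensorProduct.assoc_tmul, evalFactor_tmul, evalAt_tmul, TensorProduct.smul_tmul']

theorem lcochain_induction {p : LCochain ℒ A E → Prop} (h0 : p 0)
    (ha : ∀ x y, p x → p y → p (x + y)) (ht : ∀ ω ξ ψ, p (ω ⊗ₜ (ξ ⊗ₜ ψ))) (x : LCochain ℒ A E) :
    p x := by
  induction x using TensorProduct.induction_on with
  | zero => exact h0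
  | add a b h h' => exact ha _ _ h h'
  | tmul ω z =>
    induction z using TensorProduct.induction_on with
    | zero => rw [TensorProduct.tmul_zero]; exact h0
    | add a b h h' => rw [TensorProduct.tmul_add]; exact ha _ _ h h'
    | tmul ξ ψ => exact ht ω ξ ψ

end Assoc

section Product

variable {𝕜 : Type*} [Field 𝕜] [CharZero 𝕜] {L : Type*} [AddCommGroup L] [Module 𝕜 L]
  {ℒ : ℤ → Submodule 𝕜 L} [DirectSum.Decomposition ℒ]
  {A : Submodule 𝕜 L} [DirectSum.Decomposition (subGr ℒ A)]
  {E : Type*} [AddCommGroup E] [Module 𝕜 E]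

theorem evalFactor_koszulMk_of_even (ω : Series (subGr ℒ A)) (ξ : Module.Dual 𝕜 L)
    (z : Series (subGr ℒ A) ⊗[𝕜] Module.End 𝕜 E) {l : L} (hl : parity ℒ l = l) :
    evalFactor (koszulMk ℒ A E (ω ⊗ₜ ξ) z) l = ξ l • ω • z := by
  induction z using TensorProduct.induction_on with
  | zero => simp [evalFactor_zero]
  | add a c ha hc => rw [map_add, evalFactor_add, LinearMap.add_apply, ha, hc, smul_add, smul_add]
  | tmul η ψ =>
    rw [koszulMk_tmul, evalFactor_assoc, evalAt_rmul, evenPart_of_even hl, oddPart_of_even hl,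
      smul_tmul_series, evalAt_tmul, evalAt_tmul, map_zero, zero_smul, zero_mul, add_zero,
      TensorProduct.smul_tmul', smul_mul_assoc]

theorem evalFactor_koszulMk_of_odd (ω : Series (subGr ℒ A)) (ξ : Module.Dual 𝕜 L)
    (z : Series (subGr ℒ A) ⊗[𝕜] Module.End 𝕜 E) {l : L} (hl : parity ℒ l = -l) :
    evalFactor (koszulMk ℒ A E (ω ⊗ₜ ξ) z) l =
      ξ l • ω • leftParity (subGr ℒ A) (Module.End 𝕜 E) z := by
  induction z using TensorProduct.induction_on with
  | zero => simp [evalFactor_zero]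
  | add a c ha hc =>
    rw [map_add, evalFactor_add, LinearMap.add_apply, ha, hc, map_add, smul_add, smul_add]
  | tmul η ψ =>
    rw [koszulMk_tmul, evalFactor_assoc, evalAt_rmul, evenPart_of_odd hl, oddPart_of_odd hl,
      leftParity_tmul, smul_tmul_series, evalAt_tmul, evalAt_tmul, map_zero, zero_smul, zero_mul,
      zero_add, TensorProduct.smul_tmul', smul_mul_assoc]

end Product

/-! ### Cocycles correspond to morphisms of A-modules. -/

section Dictionary

variable {𝕜 : Type*} [Field 𝕜] {L : Type*} [AddCommGroup L] [Module 𝕜 L] [FiniteDimensional 𝕜 L]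
  {ℒ : ℤ → Submodule 𝕜 L} [DirectSum.Decomposition ℒ]
  {A : Submodule 𝕜 L} [DirectSum.Decomposition (subGr ℒ A)]
  {E : Type*} [AddCommGroup E] [Module 𝕜 E] {ℰ : ℤ → Submodule 𝕜 E} [DirectSum.Decomposition ℰ]
  (P : SHLiePair ℒ A) (M : SHModule P.toA ℰ)

/-- The coefficient of D^{L^∨}(ξ) at l has parity |ξ| + |l| + 1. This decides how it commutes with
series in the computations below. -/
theorem seriesParity_evalAt_coadD (l : L) (ξ : Module.Dual 𝕜 L) :
    seriesParity (subGr ℒ A) (evalAt A (parity ℒ l) (P.coadD ξ)) =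
      -evalAt A l (P.coadD (dualParity ℒ ξ)) := by
  rw [← evalAt_totalParity, P.totalParity_coadD, map_neg]

variable [CharZero 𝕜]

theorem evalFactor_cochainD_of_even (ω : Series (subGr ℒ A)) (ξ : Module.Dual 𝕜 L)
    (ψ : Module.End 𝕜 E) {l : L} (hl : parity ℒ l = l) :
    evalFactor (cochainD P M (ω ⊗ₜ (ξ ⊗ₜ ψ))) l =
      (ξ l • P.toA.Q ω + seriesParity (subGr ℒ A) ω * evalAt A l (P.coadD ξ)) ⊗ₜ ψ +
        ξ l • seriesParity (subGr ℒ A) ω • M.endD ψ := by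
  have h := cochainD_assoc P M (ω ⊗ₜ ξ) ψ
  rw [TensorProduct.assoc_tmul] at h
  rw [h, evalFactor_add, LinearMap.add_apply, evalFactor_assoc, totalParity_tmul,
    evalFactor_koszulMk_of_even _ _ _ hl, connOp_tmul, map_add, evalAt_tmul, evalAt_module_smul,
    dualParity_apply, hl]

theorem evalFactor_cochainD_of_odd (ω : Series (subGr ℒ A)) (ξ : Module.Dual 𝕜 L)
    (ψ : Module.End 𝕜 E) {l : L} (hl : parity ℒ l = -l) :
    evalFactor (cochainD P M (ω ⊗ₜ (ξ ⊗ₜ ψ))) l =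
      (ξ l • P.toA.Q ω + seriesParity (subGr ℒ A) ω * evalAt A l (P.coadD ξ)) ⊗ₜ ψ -
        ξ l • seriesParity (subGr ℒ A) ω • leftParity (subGr ℒ A) (Module.End 𝕜 E) (M.endD ψ) := by
  have h := cochainD_assoc P M (ω ⊗ₜ ξ) ψ
  rw [TensorProduct.assoc_tmul] at h
  rw [h, evalFactor_add, LinearMap.add_apply, evalFactor_assoc, totalParity_tmul,
    evalFactor_koszulMk_of_odd _ _ _ hl, connOp_tmul, map_add, evalAt_tmul, evalAt_module_smul,
    dualParity_apply, hl, map_neg, neg_scalar_smul_serEnd, ← sub_eq_add_neg]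

theorem extendHom_shiftHom_adD (ω : Series (subGr ℒ A)) (ξ : Module.Dual 𝕜 L)
    (ψ : Module.End 𝕜 E) (l : L) :
    extendHom (subGr ℒ A) (shiftHom (subGr ℒ A) ℒ
      (evalFactor (ω ⊗ₜ[𝕜] (ξ ⊗ₜ[𝕜] ψ)))) (P.adD l) =
      (evalAt A l (P.coadD (evenPart (dualParity ℒ) ξ)) * seriesParity (subGr ℒ A) ω -
        evalAt A (parity ℒ l) (P.coadD (oddPart (dualParity ℒ) ξ)) * ω) ⊗ₜ ψ := by
  -- C(η) is the coefficient of D^L(l) along η. It is linear in η, so the sum over the basis of L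
  -- collapses to the values of C on the even and odd parts of ξ.
  let C : Module.Dual 𝕜 L →ₗ[𝕜] Series (subGr ℒ A) :=
    evalAt A (parity ℒ l) ∘ₗ P.coadD ∘ₗ oddPart (dualParity ℒ) -
      evalAt A l ∘ₗ P.coadD ∘ₗ evenPart (dualParity ℒ)
  have hC : ∀ η, C η = evalAt A (parity ℒ l) (P.coadD (oddPart (dualParity ℒ) η)) -
      evalAt A l (P.coadD (evenPart (dualParity ℒ) η)) := fun _ => rfl
  have hsum : ∀ η : Module.Dual 𝕜 L, ∑ i, η (Module.finBasis 𝕜 L i) •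
      C ((Module.finBasis 𝕜 L).coord i) = C η := fun η => by
    simp only [← map_smul]
    rw [← map_sum, sum_coord_smul]
  have hT : ∀ b, shiftHom (subGr ℒ A) ℒ (evalFactor (ω ⊗ₜ[𝕜] (ξ ⊗ₜ[𝕜] ψ))) b =
      -((oddPart (dualParity ℒ) ξ b • ω +
        evenPart (dualParity ℒ) ξ b • seriesParity (subGr ℒ A) ω) ⊗ₜ ψ) := fun b => by
    have ho : ξ (oddPart (parity ℒ) b) = oddPart (dualParity ℒ) ξ b := by
      simp [oddPart, dualParity_apply]
    have he : ξ (evenPart (parity ℒ) b) = evenPart (dualParity ℒ) ξ b := by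
      simp [evenPart, dualParity_apply]
    rw [shiftHom, LinearMap.neg_apply, LinearMap.add_apply, LinearMap.comp_apply,
      LinearMap.comp_apply, LinearMap.comp_apply, evalFactor_tmul, evalFactor_tmul, ho, he,
      map_smul, leftParity_tmul, TensorProduct.add_tmul, TensorProduct.smul_tmul',
      TensorProduct.smul_tmul']
  have hA : P.adD l = ∑ i, C ((Module.finBasis 𝕜 L).coord i) ⊗ₜ Module.finBasis 𝕜 L i := rfl
  have hee : ∀ η, evenPart (dualParity ℒ) (evenPart (dualParity ℒ) η) =
      evenPart (dualParity ℒ) η := fun η =>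
    evenPart_of_even (apply_evenPart_self (dualParity_dualParity ℒ) η)
  have hoe : ∀ η, oddPart (dualParity ℒ) (evenPart (dualParity ℒ) η) = 0 := fun η =>
    oddPart_of_even (apply_evenPart_self (dualParity_dualParity ℒ) η)
  have hoo : ∀ η, oddPart (dualParity ℒ) (oddPart (dualParity ℒ) η) =
      oddPart (dualParity ℒ) η := fun η =>
    oddPart_of_odd (apply_oddPart_self (dualParity_dualParity ℒ) η)
  have heo : ∀ η, evenPart (dualParity ℒ) (oddPart (dualParity ℒ) η) = 0 := fun η =>
    evenPart_of_odd (apply_oddPart_self (dualParity_dualParity ℒ) η)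
  have key : ∀ i, C ((Module.finBasis 𝕜 L).coord i) •
      -((oddPart (dualParity ℒ) ξ (Module.finBasis 𝕜 L i) • ω +
        evenPart (dualParity ℒ) ξ (Module.finBasis 𝕜 L i) •
          seriesParity (subGr ℒ A) ω) ⊗ₜ[𝕜] ψ) =
      -((oddPart (dualParity ℒ) ξ (Module.finBasis 𝕜 L i) •
          C ((Module.finBasis 𝕜 L).coord i) * ω +
        evenPart (dualParity ℒ) ξ (Module.finBasis 𝕜 L i) •
          C ((Module.finBasis 𝕜 L).coord i) * seriesParity (subGr ℒ A) ω) ⊗ₜ[𝕜] ψ) := fun i => by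
    rw [smul_neg, smul_tmul_series, mul_add, mul_smul_comm, mul_smul_comm, smul_mul_assoc,
      smul_mul_assoc]
  rw [hA, map_sum]
  simp only [extendHom_tmul, hT, key]
  rw [Finset.sum_neg_distrib, ← TensorProduct.sum_tmul, Finset.sum_add_distrib, ← Finset.sum_mul,
    ← Finset.sum_mul, hsum, hsum, hC, hC, hoo, heo, hoe, hee, ← TensorProduct.neg_tmul]
  congr 1
  simp only [map_zero]
  rw [sub_zero, zero_sub, neg_mul]
  abel

/-- For even l the coefficient is odd when ξ is even and even when ξ is odd. Commuting it past ω
brings the contributions of both parts of ξ into the same form. -/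
theorem extendHom_shiftHom_adD_of_even (ω : Series (subGr ℒ A)) (ξ : Module.Dual 𝕜 L)
    (ψ : Module.End 𝕜 E) {l : L} (hl : parity ℒ l = l) :
    extendHom (subGr ℒ A) (shiftHom (subGr ℒ A) ℒ
      (evalFactor (ω ⊗ₜ[𝕜] (ξ ⊗ₜ[𝕜] ψ)))) (P.adD l) =
      -((ω * seriesParity (subGr ℒ A) (evalAt A l (P.coadD ξ))) ⊗ₜ ψ) := by
  have h := seriesParity_evalAt_coadD P l
  rw [hl] at h
  have he := h (evenPart (dualParity ℒ) ξ)
  rw [apply_evenPart_self (dualParity_dualParity ℒ)] at he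
  have ho := h (oddPart (dualParity ℒ) ξ)
  rw [apply_oddPart_self (dualParity_dualParity ℒ), map_neg, map_neg, neg_neg] at ho
  have hs : evalAt A l (P.coadD ξ) = evalAt A l (P.coadD (evenPart (dualParity ℒ) ξ)) +
      evalAt A l (P.coadD (oddPart (dualParity ℒ) ξ)) := by
    rw [← map_add, ← map_add, evenPart_add_oddPart]
  rw [extendHom_shiftHom_adD, hl, hs, map_add (seriesParity (subGr ℒ A)), he, ho,
    mul_of_odd_left _ he, seriesParity_seriesParity, mul_of_even_left _ ho,
    ← TensorProduct.neg_tmul]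
  congr 1
  rw [mul_add, mul_neg]
  abel

theorem extendHom_shiftHom_adD_of_odd (ω : Series (subGr ℒ A)) (ξ : Module.Dual 𝕜 L)
    (ψ : Module.End 𝕜 E) {l : L} (hl : parity ℒ l = -l) :
    extendHom (subGr ℒ A) (shiftHom (subGr ℒ A) ℒ
      (evalFactor (ω ⊗ₜ[𝕜] (ξ ⊗ₜ[𝕜] ψ)))) (P.adD l) =
      (seriesParity (subGr ℒ A) ω * evalAt A l (P.coadD ξ)) ⊗ₜ ψ := by
  have hn : ∀ x : Series (subGr ℒ A) ⊗[𝕜] Module.Dual 𝕜 L, evalAt A (-l) x = -evalAt A l x :=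
    fun x => by rw [← neg_one_smul 𝕜 l, evalAt_smul, LinearMap.smul_apply, neg_one_smul]
  have h := seriesParity_evalAt_coadD P l
  simp only [hl, hn, map_neg, neg_inj] at h
  have he := h (evenPart (dualParity ℒ) ξ)
  rw [apply_evenPart_self (dualParity_dualParity ℒ)] at he
  have ho := h (oddPart (dualParity ℒ) ξ)
  rw [apply_oddPart_self (dualParity_dualParity ℒ), map_neg, map_neg] at ho
  have hs : evalAt A l (P.coadD ξ) = evalAt A l (P.coadD (evenPart (dualParity ℒ) ξ)) +
      evalAt A l (P.coadD (oddPart (dualParity ℒ) ξ)) := by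
    rw [← map_add, ← map_add, evenPart_add_oddPart]
  rw [extendHom_shiftHom_adD, hl, hn, hs, neg_mul, sub_neg_eq_add,
    mul_of_even_left _ he, mul_of_odd_left _ ho, mul_add]

theorem SHModule.endShiftOp_tmul (ω : Series (subGr ℒ A)) (ψ : Module.End 𝕜 E) :
    M.endShiftOp (ω ⊗ₜ ψ) = P.toA.Q ω ⊗ₜ ψ - seriesParity (subGr ℒ A) ω •
      leftParity (subGr ℒ A) (Module.End 𝕜 E) (M.endD ψ) := by
  have h : ∀ η : Series (subGr ℒ A), η ⊗ₜ[𝕜] ψ =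
      η • ((1 : Series (subGr ℒ A)) ⊗ₜ[𝕜] ψ) := fun η => by
    rw [smul_tmul_series, mul_one]
  rw [h ω, M.endShiftOp_smul, ← h, M.endShiftOp_one_tmul, smul_neg_serEnd, sub_eq_add_neg]

/-- The twist carries the differential of φ to the defect of the corresponding map from commuting
with the differentials. The overall sign of the defect is opposite for odd l, which does not affect
its vanishing. -/
theorem shiftHom_cochainD_of_even (φ : LCochain ℒ A E) {l : L} (hl : parity ℒ l = l) :
    shiftHom (subGr ℒ A) ℒ (evalFactor (cochainD P M φ)) l =
      extendHom (subGr ℒ A) (shiftHom (subGr ℒ A) ℒ (evalFactor φ)) (P.adD l) -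
        M.endShiftOp (shiftHom (subGr ℒ A) ℒ (evalFactor φ) l) := by
  induction φ using lcochain_induction with
  | h0 =>
    rw [map_zero, evalFactor_zero, shiftHom_zero, extendHom_zero, LinearMap.zero_apply, map_zero, sub_zero]
  | ha x y hx hy =>
    rw [map_add, evalFactor_add, evalFactor_add, shiftHom_add, shiftHom_add, LinearMap.add_apply,
      LinearMap.add_apply, extendHom_add, map_add, hx, hy]
    abel
  | ht ω ξ ψ =>
    rw [extendHom_shiftHom_adD_of_even P _ _ _ hl, shiftHom_of_even _ _ _ hl,
      shiftHom_of_even _ _ _ hl, evalFactor_cochainD_of_even P M _ _ _ hl, evalFactor_tmul,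
      map_add, map_smul (leftParity (subGr ℒ A) (Module.End 𝕜 E)) (ξ l),
      map_smul (leftParity (subGr ℒ A) (Module.End 𝕜 E)) (ξ l), leftParity_smul, leftParity_tmul,
      leftParity_tmul, map_add, map_mul, map_smul, map_neg, map_smul, SHModule.endShiftOp_tmul, seriesParity_seriesParity,
      P.toA.seriesParity_Q, TensorProduct.add_tmul, smul_sub, ← TensorProduct.smul_tmul',
      TensorProduct.neg_tmul]
    simp only [smul_neg]
    abel

theorem shiftHom_cochainD_of_odd (φ : LCochain ℒ A E) {l : L} (hl : parity ℒ l = -l) :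
    shiftHom (subGr ℒ A) ℒ (evalFactor (cochainD P M φ)) l =
      M.endShiftOp (shiftHom (subGr ℒ A) ℒ (evalFactor φ) l) -
      extendHom (subGr ℒ A) (shiftHom (subGr ℒ A) ℒ (evalFactor φ)) (P.adD l) := by
  induction φ using lcochain_induction with
  | h0 =>
    rw [map_zero, evalFactor_zero, shiftHom_zero, extendHom_zero, LinearMap.zero_apply, map_zero, sub_zero]
  | ha x y hx hy =>
    rw [map_add, evalFactor_add, evalFactor_add, shiftHom_add, shiftHom_add, LinearMap.add_apply,
      LinearMap.add_apply, extendHom_add, map_add, hx, hy]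
    abel
  | ht ω ξ ψ =>
    rw [extendHom_shiftHom_adD_of_odd P _ _ _ hl, shiftHom_of_odd _ _ _ hl,
      shiftHom_of_odd _ _ _ hl, evalFactor_cochainD_of_odd P M _ _ _ hl, evalFactor_tmul,
      map_neg, map_smul, SHModule.endShiftOp_tmul, TensorProduct.add_tmul, smul_sub,
      ← TensorProduct.smul_tmul']
    abel

/-- A morphism from `L` to `End(E)[1]` commutes with the differentials if and only if the
corresponding element of `O(A) ⊗ L^∨ ⊗ End(E)` is a cocycle. -/
theorem cochainD_eq_zero_iff (φ : LCochain ℒ A E) :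
    cochainD P M φ = 0 ↔
      ∀ l, extendHom (subGr ℒ A) (shiftHom (subGr ℒ A) ℒ (evalFactor φ)) (P.adD l) =
        M.endShiftOp (shiftHom (subGr ℒ A) ℒ (evalFactor φ) l) := by
  constructor
  · intro h
    have h0 : shiftHom (subGr ℒ A) ℒ (evalFactor (cochainD P M φ)) = 0 := by
      rw [h, evalFactor_zero, shiftHom_zero]
    have : extendHom (subGr ℒ A) (shiftHom (subGr ℒ A) ℒ (evalFactor φ)) ∘ₗ P.adD =
        M.endShiftOp ∘ₗ shiftHom (subGr ℒ A) ℒ (evalFactor φ) := by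
      refine linear_ext_parity (parity_parity ℒ) fun l hl => ?_
      have h1 := DFunLike.congr_fun h0 l
      rcases hl with hl | hl
      · rw [shiftHom_cochainD_of_even P M φ hl] at h1
        exact sub_eq_zero.1 h1
      · rw [shiftHom_cochainD_of_odd P M φ hl] at h1
        exact (sub_eq_zero.1 h1).symm
    exact fun l => DFunLike.congr_fun this l
  · intro h
    have h0 : shiftHom (subGr ℒ A) ℒ (evalFactor (cochainD P M φ)) = 0 := by
      refine linear_ext_parity (parity_parity ℒ) fun l hl => ?_
      rcases hl with hl | hl
      · rw [shiftHom_cochainD_of_even P M φ hl, h]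
        exact sub_self _
      · rw [shiftHom_cochainD_of_odd P M φ hl, h]
        exact sub_self _
    apply evalFactor_injective
    rw [← shiftHom_shiftHom (subGr ℒ A) ℒ (evalFactor (cochainD P M φ)), h0, shiftHom_zero,
      evalFactor_zero]

end Dictionary

end SHLie

namespace SHLie

/-! ### Degrees under evaluation and shift. -/

section TensorDegree

variable {𝕜 : Type*} [Field 𝕜] {V : Type*} [AddCommGroup V] [Module 𝕜 V]
  {W : Type*} [AddCommGroup W] [Module 𝕜 W]

theorem tensorGr_shiftGr (𝒱 : ℤ → Submodule 𝕜 V) (𝒲 : ℤ → Submodule 𝕜 W) (k n : ℤ) :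
    tensorGr 𝒱 (shiftGr 𝒲 k) n = tensorGr 𝒱 𝒲 (n + k) := by
  refine iSup_congr fun i => ?_
  rw [shiftGr, sub_add_eq_add_sub]

theorem smul_mem_tensorGr_series {𝒱 : ℤ → Submodule 𝕜 V} {𝒲 : ℤ → Submodule 𝕜 W} {d e n : ℤ}
    (hn : d + e = n) {ω : Series 𝒱} (hω : ω ∈ seriesGr 𝒱 d) {x : Series 𝒱 ⊗[𝕜] W}
    (hx : x ∈ tensorGr (seriesGr 𝒱) 𝒲 e) : ω • x ∈ tensorGr (seriesGr 𝒱) 𝒲 n := by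
  obtain ⟨k, η, w, i, j, rfl, h⟩ := exists_sum_of_mem_tensorGr hx
  rw [Finset.smul_sum]
  refine Submodule.sum_mem _ fun a _ => ?_
  obtain ⟨hij, hη, hw⟩ := h a
  rw [smul_tmul_series]
  exact tmul_mem_tensorGr (by rw [add_assoc, hij, hn]) (mul_mem_seriesGr 𝒱 hω hη) hw

theorem leftParity_mem {𝒱 : ℤ → Submodule 𝕜 V} [DirectSum.Decomposition 𝒱]
    {𝒲 : ℤ → Submodule 𝕜 W} {n : ℤ} {x : Series 𝒱 ⊗[𝕜] W}
    (hx : x ∈ tensorGr (seriesGr 𝒱) 𝒲 n) : leftParity 𝒱 W x ∈ tensorGr (seriesGr 𝒱) 𝒲 n := by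
  have h : tensorGr (seriesGr 𝒱) 𝒲 n ≤ (tensorGr (seriesGr 𝒱) 𝒲 n).comap (leftParity 𝒱 W) :=
    tensorGr_le fun i j hij η hη w hw => tmul_mem_tensorGr hij (seriesParity_mem 𝒱 hη) hw
  exact h hx

theorem shiftHom_mem [CharZero 𝕜] {𝒱 : ℤ → Submodule 𝕜 V} [DirectSum.Decomposition 𝒱]
    {𝒲 : ℤ → Submodule 𝕜 W} {U : Type*} [AddCommGroup U] [Module 𝕜 U]
    {𝒰 : ℤ → Submodule 𝕜 U} [DirectSum.Decomposition 𝒰] {k n : ℤ} {T : U →ₗ[𝕜] Series 𝒱 ⊗[𝕜] W}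
    {u : U} (hu : u ∈ 𝒰 n) (hT : T u ∈ tensorGr (seriesGr 𝒱) 𝒲 k) :
    shiftHom 𝒱 𝒰 T u ∈ tensorGr (seriesGr 𝒱) 𝒲 k := by
  rcases parity_cases 𝒰 hu with ⟨-, h⟩ | ⟨-, h⟩
  · rw [shiftHom_of_even 𝒱 𝒰 T h]
    exact Submodule.neg_mem _ (leftParity_mem hT)
  · rw [shiftHom_of_odd 𝒱 𝒰 T h]
    exact Submodule.neg_mem _ hT

theorem evalFactor_mem {S : Type*} [AddCommGroup S] [Module 𝕜 S] {𝒮 : ℤ → Submodule 𝕜 S}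
    {𝒱 : ℤ → Submodule 𝕜 V} {𝒲 : ℤ → Submodule 𝕜 W} {d n : ℤ}
    {x : S ⊗[𝕜] (Module.Dual 𝕜 V ⊗[𝕜] W)} (hx : x ∈ tensorGr 𝒮 (tensorGr (dualGr 𝒱) 𝒲) d)
    {v : V} (hv : v ∈ 𝒱 n) : evalFactor x v ∈ tensorGr 𝒮 𝒲 (d + n) := by
  let F : S ⊗[𝕜] (Module.Dual 𝕜 V ⊗[𝕜] W) →ₗ[𝕜] S ⊗[𝕜] W :=
    LinearMap.lTensor S ((TensorProduct.lid 𝕜 W).toLinearMap ∘ₗ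
      LinearMap.rTensor W (Module.Dual.eval 𝕜 V v))
  have hF : ∀ s ξ w, F (s ⊗ₜ[𝕜] (ξ ⊗ₜ[𝕜] w)) = ξ v • (s ⊗ₜ[𝕜] w) := fun s ξ w =>
    evalFactor_tmul s ξ w v
  have h : tensorGr 𝒮 (tensorGr (dualGr 𝒱) 𝒲) d ≤ (tensorGr 𝒮 𝒲 (d + n)).comap F := by
    refine tensorGr_le fun i j hij s hs y hy => ?_
    have h2 : tensorGr (dualGr 𝒱) 𝒲 j ≤ ((tensorGr 𝒮 𝒲 (d + n)).comap F).comap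
        (TensorProduct.mk 𝕜 S _ s) := by
      refine tensorGr_le fun p q hpq ξ hξ w hw => ?_
      change F (s ⊗ₜ (ξ ⊗ₜ w)) ∈ tensorGr 𝒮 𝒲 (d + n)
      rw [hF]
      by_cases hp : n = -p
      · exact Submodule.smul_mem _ _ (tmul_mem_tensorGr (by omega) hs hw)
      · rw [hξ n hp v hv, zero_smul]
        exact Submodule.zero_mem _
    exact h2 hy
  exact h hx

/-- As in `J_mem`, the chosen basis is not homogeneous, so the canonical element is first decomposed
by projecting to each degree of V. -/
theorem ofHom_mem {S : Type*} [AddCommGroup S] [Module 𝕜 S] {𝒮 : ℤ → Submodule 𝕜 S}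
    [FiniteDimensional 𝕜 V] {𝒱 : ℤ → Submodule 𝕜 V} [DirectSum.Decomposition 𝒱]
    {𝒲 : ℤ → Submodule 𝕜 W} {d : ℤ} {T : V →ₗ[𝕜] S ⊗[𝕜] W}
    (hT : ∀ n, ∀ v ∈ 𝒱 n, T v ∈ tensorGr 𝒮 𝒲 (d + n)) :
    ofHom T ∈ tensorGr 𝒮 (tensorGr (dualGr 𝒱) 𝒲) d := by
  obtain ⟨s, hs⟩ := exists_sum_proj 𝒱
  have h1 : ∀ n, ∑ i, T (proj 𝒱 n (Module.finBasis 𝕜 V i)) ⊗ₜ[𝕜] (Module.finBasis 𝕜 V).coord i =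
      ∑ i, T (proj 𝒱 n (Module.finBasis 𝕜 V i)) ⊗ₜ[𝕜]
        ((Module.finBasis 𝕜 V).coord i ∘ₗ proj 𝒱 n) := by
    intro n
    have h := sum_tmul_comp (T ∘ₗ proj 𝒱 n) (proj 𝒱 n)
    simp only [LinearMap.comp_apply, proj_proj] at h
    exact h.symm
  have h2 : ∑ i, T (Module.finBasis 𝕜 V i) ⊗ₜ[𝕜] (Module.finBasis 𝕜 V).coord i =
      ∑ n ∈ s, ∑ i, T (proj 𝒱 n (Module.finBasis 𝕜 V i)) ⊗ₜ[𝕜]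
        ((Module.finBasis 𝕜 V).coord i ∘ₗ proj 𝒱 n) := by
    rw [← Finset.sum_congr rfl fun n _ => h1 n, Finset.sum_comm]
    refine Finset.sum_congr rfl fun i _ => ?_
    rw [← TensorProduct.sum_tmul, ← map_sum, hs]
  rw [ofHom, h2, map_sum]
  refine Submodule.sum_mem _ fun n _ => ?_
  rw [map_sum]
  refine Submodule.sum_mem _ fun i _ => ?_
  have h3 : tensorGr 𝒮 𝒲 (d + n) ≤ (tensorGr 𝒮 (tensorGr (dualGr 𝒱) 𝒲) d).comap
      (insertFactor ∘ₗ (TensorProduct.mk 𝕜 (S ⊗[𝕜] W) (Module.Dual 𝕜 V)).flip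
        ((Module.finBasis 𝕜 V).coord i ∘ₗ proj 𝒱 n)) := by
    refine tensorGr_le fun p q hpq x hx w hw => ?_
    change x ⊗ₜ[𝕜] (((Module.finBasis 𝕜 V).coord i ∘ₗ proj 𝒱 n) ⊗ₜ[𝕜] w) ∈
      tensorGr 𝒮 (tensorGr (dualGr 𝒱) 𝒲) d
    exact tmul_mem_tensorGr (i := p) (j := -n + q) (n := d) (by omega) hx
      (tmul_mem_tensorGr (i := -n) (j := q) rfl (comp_proj_mem_dualGr 𝒱 n _) hw)
  exact h3 (hT n _ (proj_mem 𝒱 n _))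

end TensorDegree

/-! ### The de Rham operator as a contraction, and the components of the canonical morphism. -/

section Contraction

variable {𝕜 : Type*} [Field 𝕜] {V : Type*} [AddCommGroup V] [Module 𝕜 V] (𝒱 : ℤ → Submodule 𝕜 V)
  [DirectSum.Decomposition 𝒱] {Y : Type*} [AddCommGroup Y] [Module 𝕜 Y]

/-- The map `v ↦ (ω ⌞ v) ⊗ y` for an element `ω ⊗ y` of `O(V) ⊗ Y`. -/
noncomputable def leftContr (x : Series 𝒱 ⊗[𝕜] Y) : V →ₗ[𝕜] Series 𝒱 ⊗[𝕜] Y :=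
  (LinearMap.rTensorHom Y ∘ₗ seriesContrHom 𝒱).flip x

theorem leftContr_apply (x : Series 𝒱 ⊗[𝕜] Y) (v : V) :
    leftContr 𝒱 x v = LinearMap.rTensor Y (seriesContr 𝒱 v) x := rfl

/-- The de Rham operator acts on the series factor alone, so the corresponding map is contraction
without the Koszul sign of the factor Y. -/
theorem ofHom_leftContr [FiniteDimensional 𝕜 V] (x : Series 𝒱 ⊗[𝕜] Y) :
    ofHom (leftContr 𝒱 x) =
      TensorProduct.assoc 𝕜 _ _ _ (LinearMap.rTensor Y (deRham 𝒱) x) := by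
  rw [ofHom]
  simp only [leftContr_apply]
  induction x using TensorProduct.induction_on with
  | zero => simp
  | add x y hx hy =>
    simp only [map_add, TensorProduct.add_tmul, Finset.sum_add_distrib] at hx hy ⊢
    rw [hx, hy]
  | tmul ω y =>
    rw [LinearMap.rTensor_tmul, deRham, LinearMap.sum_apply, TensorProduct.sum_tmul, map_sum,
      map_sum]
    rfl

end Contraction

section Restriction

variable {𝕜 : Type*} [Field 𝕜] {L : Type*} [AddCommGroup L] [Module 𝕜 L]
  {ℒ : ℤ → Submodule 𝕜 L} {A : Submodule 𝕜 L} {E : Type*} [AddCommGroup E] [Module 𝕜 E]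

theorem evalFactor_restrictCochain (φ : LCochain ℒ A E) :
    evalFactor (restrictCochain ℒ A E φ) = evalFactor φ ∘ₗ A.subtype := by
  induction φ using lcochain_induction with
  | h0 => rw [map_zero, evalFactor_zero, evalFactor_zero, LinearMap.zero_comp]
  | ha x y hx hy => rw [map_add, evalFactor_add, evalFactor_add, hx, hy, LinearMap.add_comp]
  | ht ω ξ ψ =>
    refine LinearMap.ext fun a => ?_
    rw [LinearMap.comp_apply, evalFactor_tmul]
    exact evalFactor_tmul ω (A.subtype.dualMap ξ) ψ a

end Restriction

section Values

variable {𝕜 : Type*} [Field 𝕜] [CharZero 𝕜] {V : Type*} [AddCommGroup V] [Module 𝕜 V]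
  {𝒱 : ℤ → Submodule 𝕜 V} [DirectSum.Decomposition 𝒱] {G : SHLieAlgebra 𝒱}
  {E : Type*} [AddCommGroup E] [Module 𝕜 E] {ℰ : ℤ → Submodule 𝕜 E} [DirectSum.Decomposition ℰ]

/-- Both sides are signs times κψ, where κ is a single iterated contraction of ω. The left side uses
the involution of End(E)[1], the right side that of End(E), so in each of the two parity patterns
exactly one side collects signs from moving vectors past ψ. -/
theorem evalList_shiftHom_tmul {k : ℕ} {n : Fin k → ℤ} {a : Fin k → V}
    {m : ℤ} {b : V} (ha : ∀ i, a i ∈ 𝒱 (n i)) (hb : b ∈ 𝒱 m) {ω : Series 𝒱} {ψ : Module.End 𝕜 E}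
    (h : (seriesParity 𝒱 ω = ω ∧ endParity ℰ ψ = -ψ) ∨
      (seriesParity 𝒱 ω = -ω ∧ endParity ℰ ψ = ψ)) :
    (m * (∑ i, n i) + k).negOnePow • evalList 𝒱 (-endParity ℰ)
      (shiftHom 𝒱 𝒱 (leftContr 𝒱 (ω ⊗ₜ ψ)) b) (List.ofFn a) =
        (k + 1 : ℤ).negOnePow • evalList 𝒱 (endParity ℰ) (ω ⊗ₜ ψ) (List.ofFn a ++ [b]) := by
  set s := ∑ i, n i with hs
  set κ := seriesConst 𝒱 (contrList 𝒱 (List.ofFn a) (seriesContr 𝒱 b ω)) with hκ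
  have hc : seriesConst 𝒱 (contrList 𝒱 (List.ofFn a ++ [b]) ω) = (m * s).negOnePow • κ := by
    rw [contrList_append 𝒱 hb ha, Units.smul_def, map_zsmul, ← Units.smul_def]
  have hPb : seriesParity 𝒱 (seriesContr 𝒱 b ω) =
      m.negOnePow • seriesContr 𝒱 b (seriesParity 𝒱 ω) := by
    rw [seriesParity_seriesContr, parity_of_mem 𝒱 hb, ← seriesContrHom_apply, Units.smul_def,
      map_zsmul]
    rfl
  -- This relation encodes that κ = 0 unless |ω| and s + m have the same parity, which settles the
  -- signs left over in both cases.
  have hP : κ = (s + m).negOnePow •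
      seriesConst 𝒱 (contrList 𝒱 (List.ofFn a) (seriesContr 𝒱 b (seriesParity 𝒱 ω))) := by
    rw [hκ, ← seriesConst_seriesParity, seriesParity_contrList 𝒱 ha, hPb, contrList_smul,
      smul_smul, ← Int.negOnePow_add, Units.smul_def, map_zsmul, ← Units.smul_def]
  have hT : leftContr 𝒱 (ω ⊗ₜ[𝕜] ψ) b = seriesContr 𝒱 b ω ⊗ₜ ψ := rfl
  have hsnoc : List.ofFn a ++ [b] = List.ofFn (Fin.snoc a b : Fin (k + 1) → V) := by
    rw [List.ofFn_succ', List.concat_eq_append]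
    simp
  have hsum : ∑ i, (Fin.snoc n m : Fin (k + 1) → ℤ) i = s + m := by
    rw [Fin.sum_univ_castSucc]
    simp [hs]
  have hmem : ∀ i, (Fin.snoc a b : Fin (k + 1) → V) i ∈
      𝒱 ((Fin.snoc n m : Fin (k + 1) → ℤ) i) := fun i => by
    refine Fin.lastCases ?_ (fun i => ?_) i
    · simpa using hb
    · simpa using ha i
  have hz : ∀ (u : ℤˣ) t, evalList 𝒱 (-endParity ℰ) (u • t) (List.ofFn a) =
      u • evalList 𝒱 (-endParity ℰ) t (List.ofFn a) := fun u t => by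
    rw [← evalListHom_apply, Units.smul_def, map_zsmul]
    rfl
  have hk : (k + 1 : ℤ).negOnePow = -(k : ℤ).negOnePow := Int.negOnePow_succ _
  have hassoc : ∀ u : ℤˣ, (u • κ) • ψ = u • (κ • ψ) := fun u => by
    rw [Units.smul_def, Units.smul_def, smul_assoc]
  rcases h with ⟨hω, hψ⟩ | ⟨hω, hψ⟩
  · have hψ' : (-endParity ℰ) ψ = ψ := by rw [LinearMap.neg_apply, hψ, neg_neg]
    rw [hω, ← hκ] at hP
    have hS : shiftHom 𝒱 𝒱 (leftContr 𝒱 (ω ⊗ₜ[𝕜] ψ)) b = -(seriesContr 𝒱 b ω ⊗ₜ ψ) := by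
      rcases parity_cases 𝒱 hb with ⟨hm, hb'⟩ | ⟨hm, hb'⟩
      · rw [shiftHom_of_even 𝒱 𝒱 _ hb', hT, leftParity_tmul, hPb, hω, Int.negOnePow_even _ hm,
          one_smul]
      · rw [shiftHom_of_odd 𝒱 𝒱 _ hb', hT]
    rw [hS, ← evalListHom_apply, map_neg, evalListHom_apply, evalList_of_even 𝒱 hψ', hsnoc,
      evalList_of_odd 𝒱 hψ hmem, hsum, ← hsnoc, hc, ← hκ,
      hassoc, smul_comm (s + m).negOnePow, ← hassoc (s + m).negOnePow, ← hP, hk,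
      Int.negOnePow_add, smul_neg, Units.neg_smul, smul_smul, mul_comm]
  · have hψ' : (-endParity ℰ) ψ = -ψ := by rw [LinearMap.neg_apply, hψ]
    have hS : shiftHom 𝒱 𝒱 (leftContr 𝒱 (ω ⊗ₜ[𝕜] ψ)) b =
        m.negOnePow • (seriesContr 𝒱 b ω ⊗ₜ ψ) := by
      rcases parity_cases 𝒱 hb with ⟨hm, hb'⟩ | ⟨hm, hb'⟩
      · rw [shiftHom_of_even 𝒱 𝒱 _ hb', hT, leftParity_tmul, hPb, hω, Int.negOnePow_even _ hm,
          one_smul, one_smul, map_neg, TensorProduct.neg_tmul, neg_neg]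
      · rw [shiftHom_of_odd 𝒱 𝒱 _ hb', hT, Int.negOnePow_odd _ hm, Units.neg_smul, one_smul]
    have hX : (s + m).negOnePow • (κ • ψ) = -(κ • ψ) := by
      rw [hω, map_neg] at hP
      have h1 : contrList 𝒱 (List.ofFn a) (-seriesContr 𝒱 b ω) =
          -contrList 𝒱 (List.ofFn a) (seriesContr 𝒱 b ω) := by
        have := contrList_smul 𝒱 (List.ofFn a) (-1) (seriesContr 𝒱 b ω)
        rwa [Units.neg_smul, one_smul, Units.neg_smul, one_smul] at this
      rw [h1, map_neg, ← hκ, smul_neg] at hP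
      rw [← hassoc, ← neg_smul]
      congr 1
      exact (neg_eq_iff_eq_neg.2 hP).symm
    rw [hS, hz, evalList_of_odd 𝒱 hψ' ha, evalList_of_even 𝒱 hψ, hc, ← hκ, hassoc,
      smul_smul m.negOnePow, ← Int.negOnePow_add, add_comm m, hX, hk, Int.negOnePow_add, smul_neg,
      Units.neg_smul, smul_smul, mul_comm]

/-- The maps f_{k+1} are thus the components of the twisted contraction of the connection form,
which identifies the canonical morphism. The minus sign in `shiftHom` accounts for (-1)^{k+1}
against (-1)^k. -/
theorem evalList_shiftHom (N : Connection G ℰ) {k : ℕ} {n : Fin k → ℤ} {a : Fin k → V} {m : ℤ} {b : V}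
    (ha : ∀ i, a i ∈ 𝒱 (n i)) (hb : b ∈ 𝒱 m) :
    (m * (∑ i, n i) + k).negOnePow • evalList 𝒱 (-endParity ℰ)
      (shiftHom 𝒱 𝒱 (leftContr 𝒱 N.D) b) (List.ofFn a) =
        N.f (List.ofFn a ++ [b]) := by
  obtain ⟨r, ω, ψ, i, j, hD, h⟩ := exists_sum_of_mem_tensorGr N.degree
  have hlen : ((List.ofFn a ++ [b]).length : ℤ) = k + 1 := by simp
  rw [Connection.f, hlen, hD]
  refine Finset.sum_induction _ (fun x => (m * (∑ i, n i) + k).negOnePow •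
    evalList 𝒱 (-endParity ℰ)
      (shiftHom 𝒱 𝒱 (leftContr 𝒱 x) b) (List.ofFn a) =
    (k + 1 : ℤ).negOnePow • evalList 𝒱 (endParity ℰ) x (List.ofFn a ++ [b]))
    (fun x y hx hy => ?_) ?_ fun c _ => ?_
  · have hxy : leftContr 𝒱 (x + y) =
        leftContr 𝒱 x + leftContr 𝒱 y := map_add _ x y
    rw [← evalListHom_apply 𝒱 (-endParity ℰ)] at hx hy ⊢
    rw [← evalListHom_apply 𝒱 (endParity ℰ)] at hx hy ⊢
    rw [hxy, shiftHom_add, LinearMap.add_apply, map_add, map_add, smul_add, smul_add, hx, hy]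
  · have h0 : leftContr 𝒱 (0 : Series 𝒱 ⊗[𝕜] Module.End 𝕜 E) = 0 := map_zero _
    rw [h0, shiftHom_zero, LinearMap.zero_apply, ← evalListHom_apply, ← evalListHom_apply,
      map_zero, map_zero, smul_zero, smul_zero]
  · obtain ⟨hij, hω, hψ⟩ := h c
    exact evalList_shiftHom_tmul ha hb (mem_serEndGr_parity hij hω hψ)

end Values

/-! ### Equivalence of conditions 2 and 3. -/

section Morphisms

variable {𝕜 : Type*} [Field 𝕜] {L : Type*} [AddCommGroup L] [Module 𝕜 L]
  [FiniteDimensional 𝕜 L]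
  {ℒ : ℤ → Submodule 𝕜 L} [DirectSum.Decomposition ℒ]
  {A : Submodule 𝕜 L} [DirectSum.Decomposition (subGr ℒ A)]
  {E : Type*} [AddCommGroup E] [Module 𝕜 E] {ℰ : ℤ → Submodule 𝕜 E} [DirectSum.Decomposition ℰ]
  {P : SHLiePair ℒ A} (M : SHModule P.toA ℰ)

theorem evalFactor_deRhamD : evalFactor (deRhamD M) = leftContr (subGr ℒ A) M.D := by
  rw [deRhamD, ← ofHom_leftContr, evalFactor_ofHom]

variable [CharZero 𝕜]

/-- Cocycles of degree `1` in `O(A) ⊗ L^∨ ⊗ End(E)` are morphisms from `L` to `End(E)[1]`. -/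
theorem isModuleMorphism_of_cocycle {φ : LCochain ℒ A E} (hd : φ ∈ cochainGr ℒ A ℰ 1)
    (hφ : cochainD P M φ = 0) :
    IsModuleMorphism M (extendHom (subGr ℒ A) (shiftHom (subGr ℒ A) ℒ (evalFactor φ))) where
  linear := extendHom_smul _ _
  degree d := by
    rw [tensorGr_shiftGr]
    have h : tensorGr (seriesGr (subGr ℒ A)) ℒ d ≤
        (tensorGr (seriesGr (subGr ℒ A)) (endGr ℰ) (d + 1)).comap
          (extendHom (subGr ℒ A) (shiftHom (subGr ℒ A) ℒ (evalFactor φ))) := by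
      refine tensorGr_le fun i j hij ω hω l hl => ?_
      exact smul_mem_tensorGr_series (e := 1 + j) (by omega) hω
        (shiftHom_mem hl (evalFactor_mem hd hl))
    exact fun x hx => h hx
  -- Both composites obey the same Leibniz rule over O(A), so only the elements 1 ⊗ l matter, and
  -- there the condition is closedness of φ.
  chain := TensorProduct.ext' fun ω l => by
    rw [LinearMap.comp_apply, LinearMap.comp_apply, SHLiePair.adOp, connOp_tmul, map_add,
      extendHom_smul, extendHom_tmul, extendHom_tmul, M.endShiftOp_smul,
      (cochainD_eq_zero_iff P M φ).1 hφ]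

/-- Morphisms from `L` to `End(E)[1]` come from cocycles of degree `1`. -/
theorem exists_cocycle_of_isModuleMorphism
    {Φ : Series (subGr ℒ A) ⊗[𝕜] L →ₗ[𝕜] Series (subGr ℒ A) ⊗[𝕜] Module.End 𝕜 E}
    (hΦ : IsModuleMorphism M Φ) : ∃ φ ∈ cochainGr ℒ A ℰ 1, cochainD P M φ = 0 ∧
      ∀ l, shiftHom (subGr ℒ A) ℒ (evalFactor φ) l = Φ (1 ⊗ₜ l) := by
  let T : L →ₗ[𝕜] Series (subGr ℒ A) ⊗[𝕜] Module.End 𝕜 E :=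
    Φ ∘ₗ TensorProduct.mk 𝕜 (Series (subGr ℒ A)) L 1
  have hT : ∀ n, ∀ l ∈ ℒ n, T l ∈ serEndGr (subGr ℒ A) ℰ (1 + n) := fun n l hl => by
    have h := hΦ.degree n (1 ⊗ₜ l) (tmul_mem_tensorGr (zero_add n) (one_mem_seriesGr _) hl)
    rwa [tensorGr_shiftGr, add_comm] at h
  have hev : shiftHom (subGr ℒ A) ℒ (evalFactor (ofHom (shiftHom (subGr ℒ A) ℒ T))) = T := by
    rw [evalFactor_ofHom, shiftHom_shiftHom]
  have hext : extendHom (subGr ℒ A) T = Φ := TensorProduct.ext' fun ω l => by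
    change ω • Φ (1 ⊗ₜ l) = Φ (ω ⊗ₜ l)
    rw [← hΦ.linear, smul_tmul_series, mul_one]
  -- The witness undoes the twist of the restriction of Φ to L and reads the result as a tensor.
  refine ⟨ofHom (shiftHom (subGr ℒ A) ℒ T), ofHom_mem fun n l hl => shiftHom_mem hl (hT n l hl),
    (cochainD_eq_zero_iff P M _).2 fun l => ?_, fun l => by rw [hev]; rfl⟩
  rw [hev, hext]
  have h := DFunLike.congr_fun hΦ.chain (1 ⊗ₜ[𝕜] l)
  rwa [LinearMap.comp_apply, LinearMap.comp_apply, SHLiePair.adOp, connOp_one_tmul] at h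

/-- Evaluation is injective and the twist is an involution compatible with the inclusion of A, so
the two cochains can be compared as twisted maps on A. -/
theorem restrictCochain_eq_deRhamD_iff (φ : LCochain ℒ A E) :
    restrictCochain ℒ A E φ = deRhamD M ↔
      ∀ a : A, shiftHom (subGr ℒ A) ℒ (evalFactor φ) a =
        shiftHom (subGr ℒ A) (subGr ℒ A) (leftContr (subGr ℒ A) M.D) a := by
  have hs : shiftHom (subGr ℒ A) (subGr ℒ A) (evalFactor φ ∘ₗ A.subtype) =
      shiftHom (subGr ℒ A) ℒ (evalFactor φ) ∘ₗ A.subtype :=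
    shiftHom_comp (subGr ℒ A) ℒ (subGr ℒ A) A.subtype (fun _ _ h => h) _
  rw [← evalFactor_injective.eq_iff, evalFactor_restrictCochain, evalFactor_deRhamD]
  constructor
  · intro h a
    rw [← h, hs]
    rfl
  · intro h
    rw [← shiftHom_shiftHom (subGr ℒ A) (subGr ℒ A) (evalFactor φ ∘ₗ A.subtype), hs,
      ← shiftHom_shiftHom (subGr ℒ A) (subGr ℒ A) (leftContr (subGr ℒ A) M.D)]
    congr 1
    exact LinearMap.ext h

theorem extendsCanonical_iff
    (Φ : Series (subGr ℒ A) ⊗[𝕜] L →ₗ[𝕜] Series (subGr ℒ A) ⊗[𝕜] Module.End 𝕜 E) :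
    ExtendsCanonical M Φ ↔ ∀ a : A, Φ (1 ⊗ₜ (a : L)) =
        shiftHom (subGr ℒ A) (subGr ℒ A) (leftContr (subGr ℒ A) M.D) a := by
  constructor
  · intro h
    have : Φ ∘ₗ TensorProduct.mk 𝕜 (Series (subGr ℒ A)) L 1 ∘ₗ A.subtype =
        shiftHom (subGr ℒ A) (subGr ℒ A) (leftContr (subGr ℒ A) M.D) := by
      refine graded_linear_ext (subGr ℒ A) fun m b hb => sub_eq_zero.1 ?_
      refine eq_zero_of_evalList_eq_zero (subGr ℒ A) (σ := -endParity ℰ)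
        (fun ψ => by simp [endParity_endParity]) fun vs hvs => ?_
      -- Choosing a degree for each entry recasts the list as a homogeneous family. The Koszul sign
      -- then appears identically on both sides and cancels.
      choose n hn using fun i : Fin vs.length => hvs (vs.get i) (List.get_mem vs i)
      have h1 := h vs.length n vs.get m b hn hb
      rw [← evalList_shiftHom M.toConnection hn hb, morphismComp, List.ofFn_get] at h1
      rw [← evalListHom_apply, map_sub, sub_eq_zero]
      exact smul_left_cancel _ h1
    exact fun a => DFunLike.congr_fun this a
  · intro h k n a m b ha hb
    rw [morphismComp, h, List.length_ofFn]
    exact evalList_shiftHom M.toConnection ha hb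

theorem exists_morphism_iff :
    (∃ φ ∈ cochainGr ℒ A ℰ 1, cochainD P M φ = 0 ∧ restrictCochain ℒ A E φ = deRhamD M) ↔
      ∃ Φ, IsModuleMorphism M Φ ∧ ExtendsCanonical M Φ := by
  constructor
  · rintro ⟨φ, hd, hφ, hr⟩
    refine ⟨_, isModuleMorphism_of_cocycle M hd hφ, (extendsCanonical_iff M _).2 fun a => ?_⟩
    rw [extendHom_tmul, one_smul]
    exact (restrictCochain_eq_deRhamD_iff M φ).1 hr a
  · rintro ⟨Φ, hΦ, hc⟩
    obtain ⟨φ, hd, hφ, hΦφ⟩ := exists_cocycle_of_isModuleMorphism M hΦ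
    refine ⟨φ, hd, hφ, (restrictCochain_eq_deRhamD_iff M φ).2 fun a => ?_⟩
    rw [hΦφ]
    exact (extendsCanonical_iff M Φ).1 hc a

end Morphisms

end SHLie
theorem theorem2p13 {𝕜 : Type*} [Field 𝕜] [CharZero 𝕜]
    {L : Type*} [AddCommGroup L] [Module 𝕜 L] [FiniteDimensional 𝕜 L]
    (ℒ : ℤ → Submodule 𝕜 L) [DirectSum.Decomposition ℒ]
    (A : Submodule 𝕜 L) [DirectSum.Decomposition (SHLie.subGr ℒ A)]
    (P : SHLie.SHLiePair ℒ A)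
    {E : Type*} [AddCommGroup E] [Module 𝕜 E]
    (ℰ : ℤ → Submodule 𝕜 E) [DirectSum.Decomposition ℰ]
    (M : SHLie.SHModule P.toA ℰ) :
    List.TFAE [
      SHLie.atiyahClasses M = {0},
      ∃ φ ∈ SHLie.cochainGr ℒ A ℰ 1, SHLie.cochainD P M φ = 0 ∧
        SHLie.restrictCochain ℒ A E φ = SHLie.deRhamD M,
      ∃ Φ, SHLie.IsModuleMorphism M Φ ∧ SHLie.ExtendsCanonical M Φ,
      ∃ N : SHLie.Connection P.toL ℰ, SHLie.Extends N M ∧ SHLie.atiyahCocycle N = 0] := by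
  tfae_have 1 ↔ 2 := SHLie.atiyahClasses_eq_iff M
  tfae_have 2 ↔ 3 := SHLie.exists_morphism_iff M
  tfae_have 2 ↔ 4 := SHLie.exists_flat_iff M
  tfae_finish
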